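/- Fix an optimal machine $U$ (a computable binary partial function on binary strings such that for every computable binary partial function $M$ on strings there is a constant $c_M$ with $C_U(x|y)\le C_M(x|y)+c_M$ for all $x,y$, where $C_M(x|y)=\min\{|p| : M(p,y)=x\}$) and a computable bijection between finite tuples of binary strings and binary strings. Write $C(x|y)=C_U(x|y)$, $C(x)=C(x|\Lambda)$ with $\Lambda$ the empty string, and let the complexity of, or conditional on, a tuple be that of, or conditional on, its code. Put $I(x:y)=C(x)+C(y)-C(x,y)$, $I(x:y|z)=C(x|z)+C(y|z)-C(x,y|z)$ and $I(x:y:z)=C(x)+C(y)+C(z)-C(x,y)-C(x,z)-C(y,z)+C(x,y,z)$. Let $\pi$ be a deterministic, uniformly computable two-party communication protocol (one pair of algorithms for inputs of all sizes) that terminates on all pairs of inputs of the same size. Here each party reads off the size from his or her own input by a fixed computable function (for instance, the length); the size and the messages sent so far determine whether the communication is over and, if not, who speaks next; each message is computed from the sender's input and the messages sent so far. The transcript is the sequence of all messages, coded by a string. Then there is a constant $c$, depending only on $U$, the coding of tuples and $\pi$, such that the following holds for all inputs $x,y$ of the same size and the transcript $t$ of $\pi$ on $(x,y)$. Let $n=C(x,y,t)$,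 and let $A\le^+B$ and $A=^+B$ stand for $A\le B+c\log_2(n+2)$ and $|A-B|\le c\log_2(n+2)$. (a) $C(t|x,y)\le^+0$. (b) $C(t|x)=^+I(t:y|x)$. (c) $C(t|y)=^+I(t:x|y)$. (d) $C(t|x)+C(t|y)=^+I(t:x|y)+I(t:y|x)\le^+C(t)$. (e) There exist strings $t_x$, $t_y$ of length exactly $C(t|x)$ and $C(t|y)$ respectively such that - $C(t_x)=^+C(t|x)$ and $C(t_y)=^+C(t|y)$; - $C(t_x|t)\le^+0$ and $C(t_y|t)\le^+0$; - $C(t|t_x,x)\le^+0$ and $C(t|t_y,y)\le^+0$; - $C(t_x,t_y)=^+C(t_x)+C(t_y)$; - the complexity profile of $x$, $y$ and $t'=\langle t_x,t_y\rangle$ is as follows: $C(t'|x,y)\le^+0$, $I(x:y:t')=^+0$, $I(x:y|t')=^+I(x:y)$, $I(t':x|y)=^+C(t_y)$, $I(t':y|x)=^+C(t_x)$, $C(x|t',y)=^+C(x|t,y)$ and $C(y|t',x)=^+C(y|t,x)$. -/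

import Mathlib

namespace AlgInfo

/-- Binary strings. -/
abbrev Str := List Bool

/-- A machine with two inputs (a program and a condition) and one output: a binary partial
function on strings. The Turing computable ones are those that satisfy `Partrec₂`. -/
abbrev Machine := Str → Str →. Str

/-- `C_M(x | y)`: the minimal length of a program `p` with `M(p, y) = x` (`⊤` if there is none). -/
noncomputable def condComplexity (M : Machine) (x y : Str) : ℕ∞ :=
  ⨅ p : Str, ⨅ _ : x ∈ M p y, (p.length : ℕ∞)

/-- `U` is an optimal machine: it is computable, and for every computable machine `M` one has
`C_U(x | y) ≤ C_M(x | y) + c_M` for all strings `x`, `y`. -/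
def IsOptimal (U : Machine) : Prop :=
  Partrec₂ U ∧ ∀ M : Machine, Partrec₂ M →
    ∃ c : ℕ, ∀ x y : Str, condComplexity U x y ≤ condComplexity M x y + c

/-- For an optimal machine all complexities are finite, so that `ENat.toNat` below loses nothing. -/
theorem IsOptimal.condComplexity_ne_top {U : Machine} (hU : IsOptimal U) (x y : Str) :
    condComplexity U x y ≠ ⊤ := by
  obtain ⟨c, hc⟩ := hU.2 (fun p _ => Part.some p)
    (Computable.partrec (Computable.fst (α := Str) (β := Str)))
  have h : condComplexity (fun p _ => Part.some p) x y ≤ (x.length : ℕ∞) :=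
    iInf_le_of_le x (iInf_le_of_le (Part.mem_some x) le_rfl)
  refine ne_top_of_le_ne_top (ENat.natCast_ne_top (x.length + c)) ((hc x y).trans ?_)
  push_cast
  exact add_le_add_left h _

/-- Kolmogorov complexity `C(x | y)` with respect to the optimal machine `U`. -/
noncomputable def CC (U : Machine) (x y : Str) : ℕ := (condComplexity U x y).toNat

/-- Kolmogorov complexity `C(x) = C(x | Λ)`, where `Λ` is the empty string. -/
noncomputable def C (U : Machine) (x : Str) : ℕ := CC U x []

/-- `I(x : y) = C(x) + C(y) - C(x, y)`; tuples are coded by single strings through `code`. -/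
noncomputable def I (U : Machine) (code : List Str ≃ Str) (x y : Str) : ℤ :=
  (C U x : ℤ) + C U y - C U (code [x, y])

/-- `I(x : y | z) = C(x | z) + C(y | z) - C(x, y | z)`. -/
noncomputable def IC (U : Machine) (code : List Str ≃ Str) (x y z : Str) : ℤ :=
  (CC U x z : ℤ) + CC U y z - CC U (code [x, y]) z

/-- `I(x : y : z) = C(x) + C(y) + C(z) - C(x, y) - C(x, z) - C(y, z) + C(x, y, z)`. -/
noncomputable def I3 (U : Machine) (code : List Str ≃ Str) (x y z : Str) : ℤ :=
  (C U x : ℤ) + C U y + C U z - C U (code [x, y]) - C U (code [x, z]) - C U (code [y, z])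
    + C U (code [x, y, z])

/-- `A ≤⁺ B` with error term `e`. -/
def LeUpTo (e : ℝ) (A B : ℤ) : Prop := (A : ℝ) ≤ B + e

/-- `A =⁺ B` with error term `e`. -/
def EqUpTo (e : ℝ) (A B : ℤ) : Prop := |(A : ℝ) - B| ≤ e

/-- A deterministic, uniformly computable two-party communication protocol. The algorithms work for
inputs of all sizes. Each party can read off the size parameter from his or her own input, and the
protocol is meant for pairs of inputs of the same size: with `sizeA = sizeB = List.length` these are
the pairs of strings of equal length, with constant `sizeA = sizeB` all pairs of strings. The
history of the communication is the list of the messages sent so far (arbitrary strings, any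
number of them). The size and the history determine whether the communication is over and, if it is
not, who sends the next message; this message is computed from the history and the sender's own
input. -/
structure Protocol where
  sizeA : Str → ℕ
  sizeB : Str → ℕ
  finished : ℕ → List Str → Bool
  aliceSpeaks : ℕ → List Str → Bool
  msgA : Str → List Str → Str
  msgB : Str → List Str → Str
  computable_sizeA : Computable sizeA
  computable_sizeB : Computable sizeB
  computable_finished : Computable₂ finished
  computable_aliceSpeaks : Computable₂ aliceSpeaks
  computable_msgA : Computable₂ msgA
  computable_msgB : Computable₂ msgB

namespace Protocol

/-- One more message is appended to the history `h`, unless the communication is over. -/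
def step (π : Protocol) (x y : Str) (h : List Str) : List Str :=
  if π.finished (π.sizeA x) h then h
  else h ++ [if π.aliceSpeaks (π.sizeA x) h then π.msgA x h else π.msgB y h]

/-- The history after the first `k` messages on inputs `x` (Alice) and `y` (Bob), or the final
history if at most `k` messages are sent altogether. -/
def history (π : Protocol) (x y : Str) (k : ℕ) : List Str := (π.step x y)^[k] []

/-- On each pair of inputs of the same size the communication eventually stops. -/
def Terminates (π : Protocol) : Prop :=
  ∀ x y : Str, π.sizeA x = π.sizeB y → ∃ k, π.finished (π.sizeA x) (π.history x y k) = true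

/-- `t` is the transcript (the sequence of all messages, coded by a string) of the protocol on the
inputs `x` and `y`, which have to be of the same size. -/
def IsTranscript (π : Protocol) (code : List Str ≃ Str) (x y t : Str) : Prop :=
  π.sizeA x = π.sizeB y ∧ ∃ k, π.finished (π.sizeA x) (π.history x y k) = true ∧
    t = code (π.history x y k)

end Protocol

end AlgInfo

open AlgInfo

/-! The key inequality is C(t|x) + C(t|y) ≤⁺ C(t). For a fixed size, the input pairs with a given
transcript form a rectangle, and rectangles of different transcripts are disjoint
(`Protocol.IsTranscript.cross`, `Protocol.IsTranscript.unique`). Consider all triples (x', y', t')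
whose complexities obey the bounds of (x, y, t). The triples with transcript t' number at most
|X_t'|·2^C(y|t,x) and at most |Y_t'|·2^C(x|t,y), up to constant factors, while disjointness bounds Σ
|X_t'||Y_t'| by about 2^(C(x)+C(y)). Cauchy–Schwarz over the at most about 2^C(t) transcripts
(`card_sq_le_of_rectangles`) gives 2C(x,y,t) ≤⁺ C(t) + C(x) + C(y) + C(y|t,x) + C(x|t,y)
(`CC_transcript_le`). Subtracting C(x) + C(t|x) + C(y|t,x) ≤⁺ C(x,y,t) and its mirror image
(`CC_chain_le`) leaves the inequality. The complexity of the size need not be logarithmic in n, so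
C(x), C(y) and C(x,y,t) are taken here conditional on the size.

Since t is computable from x and y, C(t,y|x) =⁺ C(y|x). This turns I(t:y|x) into C(t|x), and
symmetrically for x, so (a)–(d) follow.

For (e), let p be a shortest program of t, with k = C(t), a = C(t|x), b = C(t|y). Take a graph whose
left vertices are the k-bit strings and whose edges carry labels of a+b bits; the fingerprints are
the first a and the last b bits of the label of one edge at p. A random graph has three dispersion
properties (`exists_graph`): for every set H of small density, few vertices have a quarter of their
edges landing in H by the prefix, by the suffix, or by the whole label. A graph of this kind is
found by search from k, a, b and a precision r = O(log n), so it costs only O(log n) bits. The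
vertices violating one property for an enumerable H are enumerable and few, hence too simple to
include p.

Choose for H the prefixes shared by too many vertices of complexity about a given x, the suffixes
shared by too many vertices of complexity about b given y, and the compressible labels. At p each
choice spoils less than a quarter of the edges, so some edge escapes all three
(`exists_fingerprints`): its prefix with x, or its suffix with y, almost determines p, and its label
is incompressible. The degree is polynomial in n, so the fingerprints are simple given t. The key
inequality, in the form a + b ≤⁺ k, is exactly what allows labels of a+b bits.

For t' = ⟨t_x, t_y⟩ one has C(t'|x) =⁺ a, C(t'|y) =⁺ b and C(t') =⁺ a+b; the chain rule converts
this into the stated profile. -/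

namespace AlgInfo

attribute [fun_prop] Computable

/-! ### Closure properties of computable functions, for `fun_prop` -/

section Computability

variable {α β γ σ : Type*} [Primcodable α] [Primcodable β] [Primcodable γ] [Primcodable σ]

@[fun_prop] theorem computable_id : Computable fun a : α => a := Computable.id

@[fun_prop] theorem computable_const (s : σ) : Computable fun _ : α => s := Computable.const s

@[fun_prop] theorem computable_comp {f : β → σ} {g : α → β} (hf : Computable f)
    (hg : Computable g) : Computable fun a => f (g a) := hf.comp hg

@[fun_prop] theorem computable_fst {f : α → β × γ} (hf : Computable f) :
    Computable fun a => (f a).1 := Computable.fst.comp hf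

@[fun_prop] theorem computable_snd {f : α → β × γ} (hf : Computable f) :
    Computable fun a => (f a).2 := Computable.snd.comp hf

@[fun_prop] theorem computable_pair {f : α → β} {g : α → γ} (hf : Computable f)
    (hg : Computable g) : Computable fun a => (f a, g a) := hf.pair hg

@[fun_prop] theorem computable_cons {f : α → β} {g : α → List β} (hf : Computable f)
    (hg : Computable g) : Computable fun a => f a :: g a := Computable.list_cons.comp hf hg

@[fun_prop] theorem computable_append {f g : α → List β} (hf : Computable f)
    (hg : Computable g) : Computable fun a => f a ++ g a := Computable.list_append.comp hf hg

@[fun_prop] theorem computable_length {f : α → List β} (hf : Computable f) :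
    Computable fun a => (f a).length := Computable.list_length.comp hf

@[fun_prop] theorem computable_take {f : α → ℕ} {g : α → List β} (hf : Computable f)
    (hg : Computable g) : Computable fun a => (g a).take (f a) :=
  (Primrec₂.to_comp Primrec.list_take).comp hf hg

@[fun_prop] theorem computable_drop {f : α → ℕ} {g : α → List β} (hf : Computable f)
    (hg : Computable g) : Computable fun a => (g a).drop (f a) :=
  (Primrec₂.to_comp Primrec.list_drop).comp hf hg

@[fun_prop] theorem computable_getD {f : α → List β} {g : α → ℕ} (hf : Computable f)
    (hg : Computable g) (d : β) : Computable fun a => (f a).getD (g a) d :=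
  (Primrec₂.to_comp (Primrec.list_getD d)).comp hf hg

@[fun_prop] theorem computable_getElem? {f : α → List β} {g : α → ℕ} (hf : Computable f)
    (hg : Computable g) : Computable fun a => (f a)[g a]? :=
  Computable.list_getElem?.comp hf hg

@[fun_prop] theorem computable_some {f : α → β} (hf : Computable f) :
    Computable fun a => some (f a) := Computable.option_some.comp hf

@[fun_prop] theorem computable_encode {f : α → β} (hf : Computable f) :
    Computable fun a => Encodable.encode (f a) := Computable.encode.comp hf

@[fun_prop] theorem computable_range {f : α → ℕ} (hf : Computable f) :
    Computable fun a => List.range (f a) := (Primrec.to_comp Primrec.list_range).comp hf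

@[fun_prop] theorem computable_add {f g : α → ℕ} (hf : Computable f) (hg : Computable g) :
    Computable fun a => f a + g a := (Primrec₂.to_comp Primrec.nat_add).comp hf hg

@[fun_prop] theorem computable_sub {f g : α → ℕ} (hf : Computable f) (hg : Computable g) :
    Computable fun a => f a - g a := (Primrec₂.to_comp Primrec.nat_sub).comp hf hg

@[fun_prop] theorem computable_mul {f g : α → ℕ} (hf : Computable f) (hg : Computable g) :
    Computable fun a => f a * g a := (Primrec₂.to_comp Primrec.nat_mul).comp hf hg

@[fun_prop] theorem computable_pow {f g : α → ℕ} (hf : Computable f) (hg : Computable g) :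
    Computable fun a => f a ^ g a :=
  (Primrec₂.to_comp (Primrec₂.unpaired'.1 Nat.Primrec.pow)).comp hf hg

end Computability

/-! ### Recursively enumerable relations -/

section RecursivelyEnumerable

variable {α β γ σ : Type*} [Primcodable α] [Primcodable β] [Primcodable γ] [Primcodable σ]

/-- Recursively enumerable predicates, as projections of primitive recursive ones. -/
def RE (P : α → Prop) : Prop :=
  ∃ f : α → ℕ → Bool, Primrec₂ f ∧ ∀ a, P a ↔ ∃ s, f a s = true

theorem RE.of_iff {P Q : α → Prop} (h : RE P) (e : ∀ a, Q a ↔ P a) : RE Q := by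
  obtain ⟨f, hf, h⟩ := h
  exact ⟨f, hf, fun a => (e a).trans (h a)⟩

/-- Dovetailing: one search number codes a witness together with a step of its verification. -/
theorem RE.ex {P : α → β → Prop} (h : RE fun q : α × β => P q.1 q.2) :
    RE fun a => ∃ b, P a b := by
  obtain ⟨f, hf, h⟩ := h
  refine ⟨fun a s => ((Encodable.decode s : Option (β × ℕ)).map
    fun q => f (a, q.1) q.2).getD false, ?_, fun a => ⟨?_, ?_⟩⟩
  · refine Primrec.option_getD.comp (Primrec.option_map (Primrec.decode.comp Primrec.snd) ?_)
      (Primrec.const false)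
    exact hf.comp (Primrec.pair (Primrec.fst.comp Primrec.fst) (Primrec.fst.comp Primrec.snd))
      (Primrec.snd.comp Primrec.snd)
  · rintro ⟨b, hb⟩
    obtain ⟨s, hs⟩ := (h (a, b)).1 hb
    exact ⟨Encodable.encode (b, s), by simpa using hs⟩
  · rintro ⟨s, hs⟩
    cases hd : (Encodable.decode s : Option (β × ℕ)) with
    | none => simp [hd] at hs
    | some q => exact ⟨q.1, (h (a, q.1)).2 ⟨q.2, by simpa [hd] using hs⟩⟩

theorem RE.and {P Q : α → Prop} (hP : RE P) (hQ : RE Q) : RE fun a => P a ∧ Q a := by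
  obtain ⟨f, hf, hP⟩ := hP
  obtain ⟨g, hg, hQ⟩ := hQ
  refine ⟨fun a s => f a s.unpair.1 && g a s.unpair.2, ?_, fun a => ⟨?_, ?_⟩⟩
  · exact Primrec.and.comp
      (hf.comp Primrec.fst (Primrec.fst.comp (Primrec.unpair.comp Primrec.snd)))
      (hg.comp Primrec.fst (Primrec.snd.comp (Primrec.unpair.comp Primrec.snd)))
  · rintro ⟨h1, h2⟩
    obtain ⟨s, hs⟩ := (hP a).1 h1
    obtain ⟨s', hs'⟩ := (hQ a).1 h2
    exact ⟨Nat.pair s s', by simp [hs, hs']⟩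
  · rintro ⟨s, hs⟩
    simp only [Bool.and_eq_true] at hs
    exact ⟨(hP a).2 ⟨_, hs.1⟩, (hQ a).2 ⟨_, hs.2⟩⟩

theorem RE.or {P Q : α → Prop} (hP : RE P) (hQ : RE Q) : RE fun a => P a ∨ Q a := by
  obtain ⟨f, hf, hP⟩ := hP
  obtain ⟨g, hg, hQ⟩ := hQ
  refine ⟨fun a s => f a s || g a s, Primrec.or.comp hf hg, fun a => ?_⟩
  simp only [hP, hQ, Bool.or_eq_true, exists_or]

theorem RE.mem_partrec {f : α →. σ} (hf : Partrec f) : RE fun q : α × σ => q.2 ∈ f q.1 := by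
  obtain ⟨c, hc⟩ := Nat.Partrec.Code.exists_code.1 hf
  refine ⟨fun q s => decide (Nat.Partrec.Code.evaln s c (Encodable.encode q.1)
    = some (Encodable.encode q.2)), ?_, fun q => ?_⟩
  · refine (Primrec.eq.decide).comp (Nat.Partrec.Code.primrec_evaln.comp
      (Primrec.pair (Primrec.pair Primrec.snd (Primrec.const c))
        (Primrec.encode.comp (Primrec.fst.comp Primrec.fst)))) ?_
    exact Primrec.option_some.comp (Primrec.encode.comp (Primrec.snd.comp Primrec.fst))
  · have h := @Nat.Partrec.Code.evaln_complete c (Encodable.encode q.1) (Encodable.encode q.2)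
    simp only [decide_eq_true_eq]
    rw [hc] at h
    simpa using h

theorem RE.comp_primrec {P : β → Prop} (hP : RE P) {g : α → β} (hg : Primrec g) :
    RE fun a => P (g a) := by
  obtain ⟨f, hf, hP⟩ := hP
  exact ⟨fun a s => f (g a) s, hf.comp (hg.comp Primrec.fst) Primrec.snd, fun a => hP (g a)⟩

theorem RE.comp {P : β → Prop} (hP : RE P) {g : α → β} (hg : Computable g) :
    RE fun a => P (g a) := by
  have h : RE fun a => ∃ b, b ∈ Part.some (g a) ∧ P b :=
    RE.ex (RE.and (RE.mem_partrec (f := fun a => Part.some (g a)) hg)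
      (hP.comp_primrec Primrec.snd))
  exact h.of_iff fun a => by simp

theorem RE.of_computable {f : α → Bool} (hf : Computable f) : RE fun a => f a = true :=
  RE.comp (P := fun b : Bool => b = true)
    ⟨fun b _ => b, Primrec.fst, fun b => by simp⟩ hf

theorem RE.of_primrecPred {P : β → Prop} (hP : PrimrecPred P) {g : α → β}
    (hg : Computable g) : RE fun a => P (g a) := by
  obtain ⟨_, h⟩ := hP
  exact (RE.of_computable (h.to_comp.comp hg)).of_iff fun a => by simp

theorem RE.eq {f g : α → β} (hf : Computable f) (hg : Computable g) : RE fun a => f a = g a :=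
  RE.of_primrecPred (P := fun q : β × β => q.1 = q.2) Primrec.eq (hf.pair hg)

theorem RE.le {f g : α → ℕ} (hf : Computable f) (hg : Computable g) : RE fun a => f a ≤ g a :=
  RE.of_primrecPred (P := fun q : ℕ × ℕ => q.1 ≤ q.2) Primrec.nat_le (hf.pair hg)

theorem RE.lt {f g : α → ℕ} (hf : Computable f) (hg : Computable g) : RE fun a => f a < g a :=
  RE.of_primrecPred (P := fun q : ℕ × ℕ => q.1 < q.2) Primrec.nat_lt (hf.pair hg)

theorem primrecPred_mem : PrimrecPred fun q : β × List β => q.1 ∈ q.2 :=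
  ((PrimrecRel.exists_mem_list (R := fun a b : β => a = b) Primrec.eq).comp
    Primrec.snd Primrec.fst).of_eq fun q => by simp

theorem RE.notMem {f : α → β} {g : α → List β} (hf : Computable f) (hg : Computable g) :
    RE fun a => f a ∉ g a :=
  RE.of_primrecPred (P := fun q : β × List β => q.1 ∉ q.2) primrecPred_mem.not (hf.pair hg)

theorem RE.mem₂ {F : α → β →. σ} (hF : Partrec₂ F) {f : γ → α} {g : γ → β} {h : γ → σ}
    (hf : Computable f) (hg : Computable g) (hh : Computable h) :
    RE fun c => h c ∈ F (f c) (g c) :=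
  (RE.mem_partrec hF).comp (P := fun q : (α × β) × σ => q.2 ∈ F q.1.1 q.1.2)
    ((hf.pair hg).pair hh)

theorem RE.mem₁ {F : α →. σ} (hF : Partrec F) {f : γ → α} {h : γ → σ}
    (hf : Computable f) (hh : Computable h) : RE fun c => h c ∈ F (f c) :=
  (RE.mem_partrec hF).comp (P := fun q : α × σ => q.2 ∈ F q.1) (hf.pair hh)

/-- The finitely many witnesses have a common bound, so one unbounded search over this bound
suffices and the other quantifiers become bounded. -/
theorem RE.forall_mem {P : α → β → Prop} (hP : RE fun q : α × β => P q.1 q.2)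
    {l : α → List β} (hl : Computable l) : RE fun a => ∀ b ∈ l a, P a b := by
  obtain ⟨f, hf, hP⟩ := hP
  have h1 : PrimrecRel fun (b : β) (c : α × ℕ) => ∃ s < c.2, f (c.1, b) s = true :=
    ((PrimrecRel.exists_mem_list (R := fun (s : ℕ) (c : α × β) => f c s = true)
      (Primrec.eq.comp (hf.comp Primrec.snd Primrec.fst) (Primrec.const true))).comp
      (Primrec.list_range.comp (Primrec.snd.comp Primrec.snd))
      (Primrec.pair (Primrec.fst.comp Primrec.snd) Primrec.fst)).of_eq fun q => by simp
  have h2 : RE fun q : α × List β => ∃ N : ℕ, ∀ b ∈ q.2, ∃ s < N, f (q.1, b) s = true := by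
    refine RE.ex (RE.of_primrecPred (P := fun q : List β × (α × ℕ) =>
      ∀ b ∈ q.1, ∃ s < q.2.2, f (q.2.1, b) s = true) h1.forall_mem_list
      (g := fun q : (α × List β) × ℕ => (q.1.2, (q.1.1, q.2))) (by fun_prop))
  refine (h2.comp (g := fun a => (a, l a)) (by fun_prop)).of_iff fun a => ⟨fun h => ?_, ?_⟩
  · have h3 : ∀ b : β, ∃ s, b ∈ l a → f (a, b) s = true := by
      intro b
      by_cases hb : b ∈ l a
      · obtain ⟨s, hs⟩ := (hP (a, b)).1 (h b hb)
        exact ⟨s, fun _ => hs⟩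
      · exact ⟨0, fun h => absurd h hb⟩
    choose s hs using h3
    refine ⟨((l a).map s).sum + 1, fun b hb => ⟨s b, ?_, hs b hb⟩⟩
    exact Nat.lt_succ_of_le (List.single_le_sum (by simp) _ (List.mem_map_of_mem hb))
  · rintro ⟨N, hN⟩ b hb
    obtain ⟨s, -, hs⟩ := hN b hb
    exact (hP (a, b)).2 ⟨s, hs⟩

theorem RE.search {P : α → β → Prop} (hP : RE fun q : α × β => P q.1 q.2) :
    ∃ g : α → ℕ → Option β, Primrec₂ g ∧ ∀ a b, P a b ↔ ∃ n, g a n = some b := by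
  obtain ⟨f, hf, hP⟩ := hP
  refine ⟨fun a n => (Encodable.decode n : Option (β × ℕ)).bind
    fun q => bif f (a, q.1) q.2 then some q.1 else none, ?_, fun a b => ⟨?_, ?_⟩⟩
  · refine Primrec.option_bind (Primrec.decode.comp Primrec.snd) ?_
    refine Primrec.cond (hf.comp (Primrec.pair (Primrec.fst.comp Primrec.fst)
      (Primrec.fst.comp Primrec.snd)) (Primrec.snd.comp Primrec.snd)) ?_ (Primrec.const none)
    exact Primrec.option_some.comp (Primrec.fst.comp Primrec.snd)
  · intro h
    obtain ⟨s, hs⟩ := (hP (a, b)).1 h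
    exact ⟨Encodable.encode (b, s), by simp [hs]⟩
  · rintro ⟨n, hn⟩
    obtain ⟨q, -, hq⟩ := Option.bind_eq_some_iff.1 hn
    cases hs : f (a, q.1) q.2 with
    | false => simp [hs] at hq
    | true =>
      have : q.1 = b := by simpa [hs] using hq
      subst this
      exact (hP (a, q.1)).2 ⟨_, hs⟩

/-- Every recursively enumerable relation is uniformized by a partial recursive function. -/
theorem RE.uniformize {P : α → β → Prop} (hP : RE fun q : α × β => P q.1 q.2) :
    ∃ F : α →. β, Partrec F ∧ (∀ a b, b ∈ F a → P a b) ∧ ∀ a b, P a b → ∃ b', b' ∈ F a := by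
  obtain ⟨g, hg, hP⟩ := hP.search
  refine ⟨fun a => Nat.rfindOpt (g a), Partrec.rfindOpt hg.to_comp, fun a b h => ?_,
    fun a b h => ?_⟩
  · obtain ⟨n, hn⟩ := Nat.rfindOpt_spec h
    exact (hP a b).2 ⟨n, hn⟩
  · obtain ⟨n, hn⟩ := (hP a b).1 h
    exact Part.dom_iff_mem.1 (Nat.rfindOpt_dom.2 ⟨n, b, hn⟩)

/-- The duplicate-free list of the elements that a primitive recursive procedure finds within
`N` steps. -/
def foundUpTo [DecidableEq β] (g : α → ℕ → Option β) (a : α) (N : ℕ) : List β :=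
  Nat.rec [] (fun n l => (g a n).elim l fun b => if b ∈ l then l else l ++ [b]) N

/-- Earlier stages being prefixes of later ones, the index of an element does not depend on the
stage. This lets an index serve as a description of the element. -/
theorem RE.enumeration {P : α → β → Prop} (hP : RE fun q : α × β => P q.1 q.2) :
    ∃ L : α → ℕ → List β, Computable₂ L ∧ (∀ a N, (L a N).Nodup) ∧
      (∀ a N N', N ≤ N' → L a N <+: L a N') ∧ (∀ a N, ∀ b ∈ L a N, P a b) ∧
      ∀ a b, P a b → ∃ N, b ∈ L a N := by
  classical
  obtain ⟨g, hg, hP⟩ := hP.search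
  have hsucc : ∀ a N, foundUpTo g a (N + 1) = (g a N).elim (foundUpTo g a N)
      fun b => if b ∈ foundUpTo g a N then foundUpTo g a N else foundUpTo g a N ++ [b] :=
    fun a N => rfl
  have hcases : ∀ a N, foundUpTo g a (N + 1) = foundUpTo g a N ∨ ∃ b, g a N = some b ∧
      b ∉ foundUpTo g a N ∧ foundUpTo g a (N + 1) = foundUpTo g a N ++ [b] := by
    intro a N
    rw [hsucc]
    cases hb : g a N with
    | none => exact Or.inl rfl
    | some b =>
      by_cases hm : b ∈ foundUpTo g a N
      · exact Or.inl (by simp [hm])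
      · exact Or.inr ⟨b, rfl, hm, by simp [hm]⟩
  refine ⟨foundUpTo g, ?_, fun a N => ?_, fun a N N' hN => ?_, fun a N => ?_, fun a b h => ?_⟩
  · refine Primrec.to_comp ?_
    refine Primrec.nat_rec' (f := fun q : α × ℕ => q.2) (g := fun _ => ([] : List β))
      (h := fun q r => (g q.1 r.1).elim r.2 fun b => if b ∈ r.2 then r.2 else r.2 ++ [b])
      Primrec.snd (Primrec.const []) ?_
    refine (Primrec.option_casesOn (o := fun q : (α × ℕ) × (ℕ × List β) => g q.1.1 q.2.1)
      (f := fun q => q.2.2)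
      (g := fun q b => if b ∈ q.2.2 then q.2.2 else q.2.2 ++ [b]) ?_ ?_ ?_).of_eq ?_
    · exact hg.comp (Primrec.fst.comp Primrec.fst) (Primrec.fst.comp Primrec.snd)
    · exact Primrec.snd.comp Primrec.snd
    · have h2 : Primrec fun q : ((α × ℕ) × (ℕ × List β)) × β => q.1.2.2 :=
        Primrec.snd.comp (Primrec.snd.comp Primrec.fst)
      exact Primrec.ite (primrecPred_mem.comp (Primrec.pair Primrec.snd h2)) h2
        (Primrec.list_concat.comp h2 Primrec.snd)
    · rintro ⟨⟨a, N⟩, n, l⟩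
      dsimp only
      cases g a n <;> rfl
  · induction N with
    | zero => exact List.nodup_nil
    | succ N ih =>
      rcases hcases a N with h | ⟨b, -, hb, h⟩
      · rwa [h]
      · rw [h]
        exact List.nodup_append.2 ⟨ih, by simp, by
          intro x hx y hy; simp at hy; subst hy; exact fun e => hb (e ▸ hx)⟩
  · induction hN with
    | refl => exact List.prefix_rfl
    | step _ ih =>
      refine ih.trans ?_
      rcases hcases a _ with h | ⟨b, -, -, h⟩ <;> rw [h]
      exact List.prefix_append _ _
  · induction N with
    | zero => intro b hb; exact absurd hb (List.not_mem_nil)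
    | succ N ih =>
      rcases hcases a N with h | ⟨b, hb, -, h⟩
      · rwa [h]
      · rw [h]
        intro b' hb'
        rcases List.mem_append.1 hb' with h' | h'
        · exact ih b' h'
        · rw [List.mem_singleton.1 h']
          exact (hP a b).2 ⟨N, hb⟩
  · obtain ⟨n, hn⟩ := (hP a b).1 h
    refine ⟨n + 1, ?_⟩
    rw [hsucc, hn]
    by_cases hm : b ∈ foundUpTo g a n <;> simp [hm]

/-- At least `m` objects have the property `P`. -/
def AtLeast (m : ℕ) (P : β → Prop) : Prop := ∃ s : Finset β, m ≤ s.card ∧ ∀ b ∈ s, P b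

/-- A lower bound on a cardinality is confirmed as soon as the duplicate-free enumeration is long
enough. Later conditions are therefore phrased as lower bounds. -/
theorem RE.atLeast {P : α → β → Prop} (hP : RE fun q : α × β => P q.1 q.2) {m : α → ℕ}
    (hm : Computable m) : RE fun a => AtLeast (m a) (P a) := by
  classical
  obtain ⟨L, hL, hnd, hmono, hsound, hcompl⟩ := hP.enumeration
  have h : RE fun a => ∃ N, m a ≤ (L a N).length := by
    refine RE.ex (RE.le (by fun_prop) ?_)
    exact Computable.list_length.comp hL
  refine h.of_iff fun a => ⟨?_, ?_⟩
  · rintro ⟨s, hs, hsP⟩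
    have h3 : ∀ b : β, ∃ N, b ∈ s → b ∈ L a N := by
      intro b
      by_cases hb : b ∈ s
      · obtain ⟨N, hN⟩ := hcompl a b (hsP b hb)
        exact ⟨N, fun _ => hN⟩
      · exact ⟨0, fun h => absurd h hb⟩
    choose N hN using h3
    refine ⟨s.sup N, hs.trans ?_⟩
    rw [← List.toFinset_card_of_nodup (hnd a _)]
    refine Finset.card_le_card fun b hb => ?_
    rw [List.mem_toFinset]
    exact (hmono a _ _ (Finset.le_sup (f := N) hb)).subset (hN b hb)
  · rintro ⟨N, hN⟩
    exact ⟨(L a N).toFinset, by rwa [List.toFinset_card_of_nodup (hnd a N)], fun b hb =>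
      hsound a N b (List.mem_toFinset.1 hb)⟩

end RecursivelyEnumerable

/-! ### Binary numerals, self-delimiting codes, strings of given length -/

section BitStrings

/-- The number with the binary digits `r`, least significant digit first. -/
def val (r : Str) : ℕ := r.foldr (fun b n => 2 * n + b.toNat) 0

/-- A self-delimiting code of strings. -/
def selfDelim (w : Str) : Str := w.foldr (fun b l => true :: b :: l) [false]

/-- The list of all strings of a given length. -/
def allStr (m : ℕ) : List Str :=
  Nat.rec [[]] (fun _ l => l.map (List.cons false) ++ l.map (List.cons true)) m

@[simp] theorem val_nil : val [] = 0 := rfl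

@[simp] theorem val_cons (b : Bool) (r : Str) : val (b :: r) = 2 * val r + b.toNat := rfl

@[simp] theorem selfDelim_nil : selfDelim [] = [false] := rfl

@[simp] theorem selfDelim_cons (b : Bool) (r : Str) :
    selfDelim (b :: r) = true :: b :: selfDelim r := rfl

theorem val_lt (r : Str) : val r < 2 ^ r.length := by
  induction r with
  | nil => simp
  | cons b r ih =>
    rw [val_cons, List.length_cons, pow_succ]
    have := Bool.toNat_le b
    omega

theorem val_injective {r s : Str} (hl : r.length = s.length) (h : val r = val s) : r = s := by
  induction r generalizing s with
  | nil => exact (List.length_eq_zero_iff.1 hl.symm).symm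
  | cons b r ih =>
    cases s with
    | nil => simp at hl
    | cons b' s =>
      simp only [val_cons, List.length_cons, add_left_inj] at h hl
      have hb : b = b' := by
        cases b <;> cases b' <;> simp at h ⊢ <;> omega
      subst hb
      rw [ih hl (by omega)]

theorem exists_val_eq (m : ℕ) : ∀ q < 2 ^ m, ∃ r : Str, r.length = m ∧ val r = q := by
  induction m with
  | zero => intro q hq; exact ⟨[], rfl, by simp at hq; simp [hq]⟩
  | succ m ih =>
    intro q hq
    obtain ⟨r, hr, hv⟩ := ih (q / 2) (by rw [pow_succ] at hq; omega)
    refine ⟨decide (q % 2 = 1) :: r, by simp [hr], ?_⟩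
    rw [val_cons, hv]
    rcases Nat.mod_two_eq_zero_or_one q with h | h <;> simp [h] <;> omega

theorem length_selfDelim (w : Str) : (selfDelim w).length = 2 * w.length + 1 := by
  induction w with
  | nil => rfl
  | cons b w ih => simp only [selfDelim_cons, List.length_cons, ih]; ring

theorem selfDelim_append_inj {w w' r r' : Str} (h : selfDelim w ++ r = selfDelim w' ++ r') :
    w = w' ∧ r = r' := by
  induction w generalizing w' with
  | nil =>
    cases w' with
    | nil => simpa using h
    | cons b w' => simp at h
  | cons a w ih =>
    cases w' with
    | nil => simp at h
    | cons b w' =>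
      simp only [selfDelim_cons, List.cons_append, List.cons.injEq, true_and] at h
      obtain ⟨h1, h2⟩ := ih h.2
      exact ⟨by rw [h.1, h1], h2⟩

theorem mem_allStr {m : ℕ} {w : Str} : w ∈ allStr m ↔ w.length = m := by
  induction m generalizing w with
  | zero => simp [allStr]
  | succ m ih =>
    have : allStr (m + 1) = (allStr m).map (List.cons false) ++ (allStr m).map (List.cons true) :=
      rfl
    rw [this]
    cases w with
    | nil => simp
    | cons b w => cases b <;> simp [ih]

theorem nodup_allStr (m : ℕ) : (allStr m).Nodup := by
  induction m with
  | zero => simp [allStr]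
  | succ m ih =>
    have : allStr (m + 1) = (allStr m).map (List.cons false) ++ (allStr m).map (List.cons true) :=
      rfl
    rw [this, List.nodup_append]
    refine ⟨ih.map (List.cons_injective), ih.map (List.cons_injective), ?_⟩
    intro a ha b hb hab
    obtain ⟨x, -, rfl⟩ := List.mem_map.1 ha
    obtain ⟨y, -, rfl⟩ := List.mem_map.1 hb
    simp at hab

theorem length_allStr (m : ℕ) : (allStr m).length = 2 ^ m := by
  induction m with
  | zero => rfl
  | succ m ih =>
    have : allStr (m + 1) = (allStr m).map (List.cons false) ++ (allStr m).map (List.cons true) :=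
      rfl
    rw [this, List.length_append, List.length_map, List.length_map, ih, pow_succ]
    ring

theorem card_allStr (m : ℕ) : (allStr m).toFinset.card = 2 ^ m := by
  rw [List.toFinset_card_of_nodup (nodup_allStr m), length_allStr]

variable {α : Type*} [Primcodable α]

@[fun_prop] theorem computable_val {f : α → Str} (hf : Computable f) :
    Computable fun a => val (f a) := by
  have h : Primrec val := by
    refine Primrec.list_foldr (f := fun a : Str => a) (g := fun _ => 0)
      (h := fun _ q => 2 * q.2 + q.1.toNat) Primrec.id (Primrec.const 0) ?_
    exact Primrec.nat_add.comp
      (Primrec.nat_mul.comp (Primrec.const 2) (Primrec.snd.comp Primrec.snd))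
      ((Primrec.dom_bool Bool.toNat).comp (Primrec.fst.comp Primrec.snd))
  exact h.to_comp.comp hf

@[fun_prop] theorem computable_selfDelim {f : α → Str} (hf : Computable f) :
    Computable fun a => selfDelim (f a) := by
  have h : Primrec selfDelim := by
    refine Primrec.list_foldr (f := fun a : Str => a) (g := fun _ => [false])
      (h := fun _ q => true :: q.1 :: q.2) Primrec.id (Primrec.const [false]) ?_
    exact Primrec.list_cons.comp (Primrec.const true) (Primrec.list_cons.comp
      (Primrec.fst.comp Primrec.snd) (Primrec.snd.comp Primrec.snd))
  exact h.to_comp.comp hf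

@[fun_prop] theorem computable_allStr {f : α → ℕ} (hf : Computable f) :
    Computable fun a => allStr (f a) := by
  have hc : ∀ b : Bool, Primrec fun l : List Str => l.map (List.cons b) := fun b =>
    Primrec.list_map Primrec.id (Primrec.list_cons.comp (Primrec.const b) Primrec.snd)
  have h : Primrec allStr := by
    refine Primrec.nat_rec₁ (f := fun _ l => l.map (List.cons false) ++ l.map (List.cons true))
      [[]] ?_
    exact Primrec.list_append.comp ((hc false).comp Primrec.snd) ((hc true).comp Primrec.snd)
  exact h.to_comp.comp hf

end BitStrings

/-! ### An integer logarithm for the error terms -/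

section Logarithm

/-- An integer version of the logarithmic error term. -/
def L (n : ℕ) : ℕ := Nat.log 2 (n + 2)

theorem one_le_L (n : ℕ) : 1 ≤ L n := Nat.le_log_of_pow_le (by norm_num) (by omega)

theorem L_mono {m n : ℕ} (h : m ≤ n) : L m ≤ L n := Nat.log_mono_right (by omega)

theorem lt_two_pow_L (n : ℕ) : n + 2 < 2 ^ (L n + 1) := Nat.lt_pow_succ_log_self (by norm_num) _

theorem two_pow_L_le (n : ℕ) : 2 ^ L n ≤ n + 2 := Nat.pow_log_le_self 2 (by omega)

theorem L_le {n m : ℕ} (h : n + 2 < 2 ^ (m + 1)) : L n ≤ m :=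
  Nat.lt_succ_iff.1 (Nat.log_lt_of_lt_pow (by omega) h)

theorem L_le_self (n : ℕ) : L n ≤ n + 1 := by
  have h1 := two_pow_L_le n
  have h2 := Nat.lt_two_pow_self (n := L n)
  omega

theorem L_mul_le (m n : ℕ) : L (m * n) ≤ L m + L n + 1 := by
  refine L_le ?_
  have h1 := lt_two_pow_L m
  have h2 := lt_two_pow_L n
  calc m * n + 2 < (m + 2) * (n + 2) := by nlinarith
    _ ≤ 2 ^ (L m + 1) * 2 ^ (L n + 1) := Nat.mul_le_mul h1.le h2.le
    _ = _ := by rw [← pow_add]; congr 1; ring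

theorem L_add_le (m n : ℕ) : L (m + n) ≤ L m + L n := by
  have h1 := lt_two_pow_L m
  have h2 := lt_two_pow_L n
  have h3 := two_pow_L_le m
  have h4 := two_pow_L_le n
  refine L_le ?_
  have e1 := one_le_L m
  have e2 := one_le_L n
  obtain ⟨i, hi⟩ := Nat.exists_eq_add_of_le e1
  obtain ⟨j, hj⟩ := Nat.exists_eq_add_of_le e2
  rw [hi] at h1
  rw [hj] at h2
  rw [hi, hj, show 1 + i + (1 + j) + 1 = i + j + 3 by ring]
  have p1 : 1 ≤ 2 ^ i := Nat.one_le_two_pow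
  have p2 : 1 ≤ 2 ^ j := Nat.one_le_two_pow
  rw [show 1 + i + 1 = i + 2 by ring, pow_add] at h1
  rw [show 1 + j + 1 = j + 2 by ring, pow_add] at h2
  rw [pow_add, pow_add]
  nlinarith

theorem L_pair_le (m n : ℕ) : L (Nat.pair m n) ≤ 2 * L m + 2 * L n := by
  refine L_le ?_
  have h0 := Nat.pair_lt_max_add_one_sq m n
  have h1 := lt_two_pow_L (max m n)
  have h2 : L (max m n) + 1 ≤ L m + L n := by
    have e1 := one_le_L m
    have e2 := one_le_L n
    rcases max_choice m n with h | h <;> rw [h] <;> omega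
  calc Nat.pair m n + 2 < (max m n + 2) ^ 2 := by
        have h3 : (max m n + 2) ^ 2 = (max m n + 1) ^ 2 + 2 * max m n + 3 := by ring
        omega
    _ ≤ (2 ^ (L m + L n)) ^ 2 :=
      Nat.pow_le_pow_left (h1.le.trans (Nat.pow_le_pow_right (by norm_num) h2)) 2
    _ ≤ _ := by rw [← pow_mul]; exact Nat.pow_le_pow_right (by norm_num) (by ring_nf; omega)

theorem L_encode_pair_le {α β : Type*} [Encodable α] [Encodable β] (a : α) (b : β) :
    L (Encodable.encode (a, b)) ≤ 2 * L (Encodable.encode a) + 2 * L (Encodable.encode b) :=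
  L_pair_le _ _

@[simp] theorem L_encode_nat (n : ℕ) : L (Encodable.encode n) = L n := rfl

end Logarithm

/-! ### Kolmogorov complexity: counting and enumeration bounds -/

section Complexity

variable {U : Machine}

theorem IsOptimal.CC_le_iff (hU : IsOptimal U) {x y : Str} {m : ℕ} :
    CC U x y ≤ m ↔ ∃ p : Str, p.length ≤ m ∧ x ∈ U p y := by
  have h1 : CC U x y ≤ m ↔ condComplexity U x y ≤ m := by
    rw [CC]
    obtain ⟨k, hk⟩ := ENat.ne_top_iff_exists.1 (hU.condComplexity_ne_top x y)
    rw [← hk, ENat.toNat_natCast, Nat.cast_le]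
  rw [h1, condComplexity]
  constructor
  · intro h
    by_contra hcon
    push Not at hcon
    have h2 : ((m + 1 : ℕ) : ℕ∞) ≤ ⨅ p : Str, ⨅ _ : x ∈ U p y, (p.length : ℕ∞) := by
      refine le_iInf fun p => le_iInf fun hp => ?_
      by_contra hlt
      exact hcon p (by exact_mod_cast Nat.lt_succ_iff.1 (by exact_mod_cast not_le.1 hlt)) hp
    have h3 := h2.trans h
    norm_cast at h3
    omega
  · rintro ⟨p, hp, hx⟩
    exact (iInf_le_of_le p (iInf_le_of_le hx le_rfl)).trans (by exact_mod_cast hp)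

theorem IsOptimal.exists_program (hU : IsOptimal U) (x y : Str) :
    ∃ p : Str, p.length = CC U x y ∧ x ∈ U p y := by
  obtain ⟨p, hp, hx⟩ := hU.CC_le_iff.1 (le_refl (CC U x y))
  exact ⟨p, le_antisymm hp (hU.CC_le_iff.2 ⟨p, le_rfl, hx⟩), hx⟩

/-- Distinct outputs need distinct programs, and there are fewer than 2^(m+1) programs of length at
most m. -/
theorem IsOptimal.card_le (hU : IsOptimal U) {y : Str} {m : ℕ} {s : Finset Str}
    (hs : ∀ x ∈ s, CC U x y ≤ m) : s.card ≤ 2 ^ (m + 1) := by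
  have h : ∀ x : Str, ∃ p : Str, x ∈ s → p.length ≤ m ∧ x ∈ U p y := by
    intro x
    by_cases hx : x ∈ s
    · obtain ⟨p, hp⟩ := hU.CC_le_iff.1 (hs x hx)
      exact ⟨p, fun _ => hp⟩
    · exact ⟨[], fun h => absurd h hx⟩
  choose p hp using h
  have hcard : ((Finset.range (m + 1)).biUnion fun i => (allStr i).toFinset).card
      ≤ 2 ^ (m + 1) := by
    refine Finset.card_biUnion_le.trans ?_
    simp only [card_allStr]
    exact (Nat.geomSum_lt le_rfl (by simp)).le
  refine (Finset.card_le_card_of_injOn p (fun x hx => ?_) fun x hx x' hx' h => ?_).trans hcard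
  · simp only [Finset.coe_biUnion, Set.mem_iUnion, Finset.mem_coe, List.mem_toFinset, mem_allStr,
      Finset.mem_range]
    exact ⟨_, Nat.lt_succ_of_le (hp x hx).1, rfl⟩
  · have h1 := (hp x hx).2
    rw [h] at h1
    exact Part.mem_unique h1 (hp x' hx').2

theorem RE.CC_le (hU : IsOptimal U) {α : Type*} [Primcodable α] {f g : α → Str} {m : α → ℕ}
    (hf : Computable f) (hg : Computable g) (hm : Computable m) :
    RE fun a => CC U (f a) (g a) ≤ m a :=
  RE.of_iff (RE.ex (RE.and (RE.le (by fun_prop) (by fun_prop))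
    (RE.mem₂ hU.1 (by fun_prop) (by fun_prop) (by fun_prop))))
    fun _ => hU.CC_le_iff

/-- Optimality, with the graph of the machine given as a recursively enumerable relation. -/
theorem IsOptimal.CC_le_length (hU : IsOptimal U) {G : Str × Str → Str → Prop}
    (hG : RE fun q : (Str × Str) × Str => G q.1 q.2) :
    ∃ c : ℕ, ∀ p y z, G (p, y) z → (∀ z', G (p, y) z' → z' = z) → CC U z y ≤ p.length + c := by
  obtain ⟨F, hF, hs, hc⟩ := hG.uniformize
  obtain ⟨c, hc'⟩ := hU.2 (fun p y => F (p, y)) (hF.to₂ (f := F))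
  refine ⟨c, fun p y z hz huniq => ?_⟩
  obtain ⟨z', hz'⟩ := hc _ _ hz
  obtain rfl := huniq z' (hs _ _ hz')
  have h1 : condComplexity (fun p y => F (p, y)) z' y ≤ p.length :=
    iInf_le_of_le p (iInf_le_of_le hz' le_rfl)
  have h2 := (hc' z' y).trans (add_le_add_left h1 _)
  have h3 := ENat.toNat_le_toNat h2 (by norm_cast; exact ENat.natCast_ne_top _)
  exact_mod_cast h3

/-- An element of a recursively enumerable set with at most `2 ^ m` elements is determined by `m`
bits and the parameter of the set. -/
theorem IsOptimal.CC_le_of_card_le (hU : IsOptimal U) {α : Type*} [Primcodable α]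
    {R : α × Str → Str → Prop} (hR : RE fun q : (α × Str) × Str => R q.1 q.2) :
    ∃ c : ℕ, ∀ q y z m, R (q, y) z →
      (∀ s : Finset Str, (∀ z' ∈ s, R (q, y) z') → s.card ≤ 2 ^ m) →
      CC U z y ≤ m + c * L (Encodable.encode q) := by
  obtain ⟨E, hE, hnd, hmono, hsound, hcompl⟩ := hR.enumeration
  have hE' : Computable fun q : (α × Str) × ℕ => E q.1 q.2 := hE
  -- A program consists of the self-delimited parameter `w` followed by the index `r` in the
  -- enumeration; any stage `N` that is long enough may be used.
  have hG : RE fun q : (Str × Str) × Str => ∃ w r : Str, ∃ a : α, ∃ N : ℕ,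
      q.1.1 = selfDelim w ++ r ∧ Encodable.encode a = val w ∧
      (E (a, q.1.2) N)[val r]? = some q.2 := by
    refine RE.ex (RE.ex (RE.ex (RE.ex (RE.and (RE.eq (by fun_prop) (by fun_prop))
      (RE.and (RE.eq (by fun_prop) (by fun_prop)) (RE.eq ?_ (by fun_prop)))))))
    exact computable_getElem?
      (hE'.comp (g := fun q : (((((Str × Str) × Str) × Str) × Str) × α) × ℕ =>
        ((q.1.2, q.1.1.1.1.1.2), q.2)) (by fun_prop)) (by fun_prop)
  obtain ⟨c, hc⟩ := hU.CC_le_length (G := fun s z => ∃ w r : Str, ∃ a : α, ∃ N : ℕ,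
      s.1 = selfDelim w ++ r ∧ Encodable.encode a = val w ∧
      (E (a, s.2) N)[val r]? = some z) hG
  -- The self-delimited parameter takes 2(L+1)+1 bits, which is at most 5L since L ≥ 1.
  refine ⟨5 + c, fun q y z m hz hcard => ?_⟩
  obtain ⟨N, hN⟩ := hcompl _ _ hz
  obtain ⟨i, hi, hiz⟩ := List.getElem_of_mem hN
  have hi2 : i < 2 ^ m := by
    refine hi.trans_le ?_
    rw [← List.toFinset_card_of_nodup (hnd _ _)]
    exact hcard _ fun z' hz' => hsound _ _ _ (List.mem_toFinset.1 hz')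
  obtain ⟨r, hr, hri⟩ := exists_val_eq m i hi2
  obtain ⟨w, hw, hwq⟩ := exists_val_eq (L (Encodable.encode q) + 1) (Encodable.encode q)
    (by have := lt_two_pow_L (Encodable.encode q); omega)
  have h1 := hc (selfDelim w ++ r) y z ⟨w, r, q, N, rfl, hwq.symm, by
    rw [hri, List.getElem?_eq_getElem hi, hiz]⟩ ?_
  · rw [List.length_append, length_selfDelim, hw, hr] at h1
    have := one_le_L (Encodable.encode q)
    nlinarith
  · rintro z' ⟨w', r', a, N', h2, h3, h4⟩
    obtain ⟨rfl, rfl⟩ := selfDelim_append_inj h2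
    obtain rfl : a = q := Encodable.encode_injective (h3.trans hwq)
    dsimp only at h4
    obtain ⟨hlt, h5⟩ := List.getElem?_eq_some_iff.1 h4
    rw [hri] at hlt
    -- The stages `N` and `N'` are both prefixes of the later one, so their entries at `i` agree.
    have h6 : z = (E (a, y) (max N N'))[i]'(hi.trans_le
        (hmono _ _ _ (le_max_left N N')).length_le) := by
      rw [← hiz]; exact (hmono _ _ _ (le_max_left N N')).getElem hi
    rw [← h5, h6]
    simp only [hri]
    exact (hmono _ _ _ (le_max_right N N')).getElem hlt

theorem IsOptimal.CC_le_of_unique (hU : IsOptimal U) {α : Type*} [Primcodable α]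
    {R : α × Str → Str → Prop} (hR : RE fun q : (α × Str) × Str => R q.1 q.2) :
    ∃ c : ℕ, ∀ q y z, R (q, y) z → (∀ z', R (q, y) z' → z' = z) →
      CC U z y ≤ c * L (Encodable.encode q) := by
  obtain ⟨c, hc⟩ := hU.CC_le_of_card_le hR
  refine ⟨c, fun q y z hz huniq => ?_⟩
  have := hc q y z 0 hz fun s hs => ?_
  · omega
  · rw [pow_zero, Finset.card_le_one_iff]
    intro a b ha hb
    rw [huniq a (hs a ha), huniq b (hs b hb)]

/-- If `v` can be computed from `w` and `y`, then `v` is not much more complex given `y` than `w` is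
given some `g y`. -/
theorem IsOptimal.CC_le_CC_of_RE (hU : IsOptimal U) {R : Str × Str → Str → Prop}
    (hR : RE fun q : (Str × Str) × Str => R q.1 q.2) {g : Str → Str} (hg : Computable g) :
    ∃ c : ℕ, ∀ w y v, R (w, y) v → (∀ v', R (w, y) v' → v' = v) →
      CC U v y ≤ CC U w (g y) + c := by
  obtain ⟨c, hc⟩ := hU.CC_le_length (G := fun q v => ∃ w, w ∈ U q.1 (g q.2) ∧ R (w, q.2) v)
    (RE.ex (RE.and (RE.mem₂ hU.1 (by fun_prop) (by fun_prop) (by fun_prop))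
      (hR.comp (g := fun q : ((Str × Str) × Str) × Str => ((q.2, q.1.1.2), q.1.2))
        (by fun_prop))))
  refine ⟨c, fun w y v hv huniq => ?_⟩
  obtain ⟨p, hp, hw⟩ := hU.exists_program w (g y)
  rw [← hp]
  refine hc p y v ⟨w, hw, hv⟩ ?_
  rintro v' ⟨w', hw', hv'⟩
  obtain rfl := Part.mem_unique hw hw'
  exact huniq v' hv'

theorem IsOptimal.CC_le_CC (hU : IsOptimal U) {f : Str → Str → Str}
    (hf : Computable fun q : Str × Str => f q.1 q.2) {g : Str → Str} (hg : Computable g) :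
    ∃ c : ℕ, ∀ w y, CC U (f w y) y ≤ CC U w (g y) + c := by
  obtain ⟨c, hc⟩ := hU.CC_le_CC_of_RE (R := fun q v => v = f q.1 q.2)
    (RE.eq (by fun_prop) (by fun_prop)) hg
  exact ⟨c, fun w y => hc w y _ rfl fun _ h => h⟩

end Complexity

/-! ### Coded tuples -/

section Tuples

/-- The `i`-th entry of the tuple with the code `s`. -/
def entry (code : List Str ≃ Str) (i : ℕ) (s : Str) : Str := (code.symm s).getD i []

variable {code : List Str ≃ Str} {α : Type*} [Primcodable α]

@[simp] theorem entry_zero (a : Str) (l : List Str) : entry code 0 (code (a :: l)) = a := by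
  simp [entry]

@[simp] theorem entry_one (a b : Str) (l : List Str) :
    entry code 1 (code (a :: b :: l)) = b := by
  simp [entry]

@[simp] theorem entry_two (a b c : Str) (l : List Str) :
    entry code 2 (code (a :: b :: c :: l)) = c := by
  simp [entry]

@[fun_prop] theorem computable_entry (hcode : code.Computable) (i : ℕ) {f : α → Str}
    (hf : Computable f) : Computable fun a => entry code i (f a) :=
  computable_getD (hcode.2.comp hf) (Computable.const i) []

@[fun_prop] theorem computable_code (hcode : code.Computable) {f : α → List Str}
    (hf : Computable f) : Computable fun a => code (f a) := hcode.1.comp hf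

end Tuples

/-! ### Chain rule and symmetry of information -/

section ChainRules

/-- The size of a nonempty finite set, up to a factor of two. -/
theorem exists_atLeast_two_pow {β : Type*} {P : β → Prop} {m : ℕ} {b : β} (hb : P b)
    (hP : ∀ s : Finset β, (∀ b ∈ s, P b) → s.card ≤ 2 ^ m) :
    ∃ e ≤ m, AtLeast (2 ^ e) P ∧ ∀ s : Finset β, (∀ b ∈ s, P b) → s.card ≤ 2 ^ (e + 1) := by
  classical
  have h0 : AtLeast (2 ^ 0) P := ⟨{b}, by simp, by simpa using hb⟩
  refine ⟨Nat.findGreatest (fun e => AtLeast (2 ^ e) P) m, Nat.findGreatest_le m,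
    Nat.findGreatest_spec (P := fun e => AtLeast (2 ^ e) P) (Nat.zero_le m) h0, fun s hs => ?_⟩
  rcases (Nat.findGreatest_le (P := fun e => AtLeast (2 ^ e) P) m).eq_or_lt with h | h
  · rw [h]
    exact (hP s hs).trans (Nat.pow_le_pow_right (by norm_num) (Nat.le_succ m))
  · by_contra hlt
    exact Nat.findGreatest_is_greatest (P := fun e => AtLeast (2 ^ e) P) (Nat.lt_succ_self _) h
      ⟨s, (not_le.1 hlt).le, hs⟩

variable {U : Machine} {code : List Str ≃ Str}

/-- Two-step descriptions: `K(v | y) ≤ K(w | y) + K(v | w, y)` up to a logarithmic term. -/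
theorem CC_le_add (hU : IsOptimal U) (hcode : code.Computable) :
    ∃ c : ℕ, ∀ N v w y, CC U w y ≤ N → CC U v (code [w, y]) ≤ N →
      CC U v y ≤ CC U w y + CC U v (code [w, y]) + c * L N := by
  -- The set to be counted contains all `v` reachable through some `w` within the two bounds; its
  -- size is at most the number of `w` times the number of `v` per `w`.
  obtain ⟨c, hc⟩ := hU.CC_le_of_card_le (R := fun (q : (ℕ × ℕ) × Str) v =>
    ∃ w, CC U w q.2 ≤ q.1.1 ∧ CC U v (code [w, q.2]) ≤ q.1.2)
    (RE.ex (RE.and (RE.CC_le hU (by fun_prop) (by fun_prop) (by fun_prop))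
      (RE.CC_le hU (by fun_prop) (by fun_prop) (by fun_prop))))
  refine ⟨2 + 4 * c, fun N v w y hw hv => ?_⟩
  have h1 := hc (CC U w y, CC U v (code [w, y])) y v (CC U w y + 1 + (CC U v (code [w, y]) + 1))
    ⟨w, le_rfl, le_rfl⟩ fun s hs => ?_
  · have h2 := L_encode_pair_le (CC U w y) (CC U v (code [w, y]))
    have h3 := L_mono hw
    have h4 := L_mono hv
    have h5 := one_le_L N
    simp only [L_encode_nat] at h2
    nlinarith [Nat.mul_le_mul_left c (h2.trans (show _ ≤ 4 * L N by omega))]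
  · classical
    choose! w' hw' hs' using hs
    rw [pow_add]
    calc s.card ≤ ((s.image w').sigma fun u => s.filter fun v => w' v = u).card := by
          refine Finset.card_le_card_of_injOn (fun v => ⟨w' v, v⟩) (fun v hv => ?_) ?_
          · simp only [Finset.coe_sigma, Set.mem_sigma_iff, Finset.mem_coe, Finset.mem_filter]
            exact ⟨Finset.mem_image_of_mem _ hv, hv, trivial⟩
          · intro a _ b _ h
            simp only [Sigma.mk.injEq] at h
            exact eq_of_heq h.2
      _ = ∑ u ∈ s.image w', (s.filter fun v => w' v = u).card := Finset.card_sigma _ _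
      _ ≤ ∑ u ∈ s.image w', 2 ^ (CC U v (code [w, y]) + 1) := by
          refine Finset.sum_le_sum fun u _ => hU.card_le (y := code [u, y]) fun v hv => ?_
          rw [Finset.mem_filter] at hv
          rw [← hv.2]
          exact hs' v hv.1
      _ = (s.image w').card * 2 ^ (CC U v (code [w, y]) + 1) := by
          rw [Finset.sum_const, smul_eq_mul]
      _ ≤ _ := by
          refine Nat.mul_le_mul_right _ (hU.card_le (y := y) fun u hu => ?_)
          obtain ⟨v, hv, rfl⟩ := Finset.mem_image.1 hu
          exact hw' v hv

theorem card_code_le (hU : IsOptimal U) {a y : Str} {m : ℕ} {s : Finset Str}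
    (hs : ∀ b ∈ s, CC U (code [a, b]) y ≤ m) : s.card ≤ 2 ^ (m + 1) := by
  rw [← Finset.card_image_of_injective s (f := fun b => code [a, b])
    (fun b b' h => by simpa using h)]
  refine hU.card_le (y := y) fun x hx => ?_
  obtain ⟨b, hb, rfl⟩ := Finset.mem_image.1 hx
  exact hs b hb

/-- Symmetry of information: `K(a | z) + K(b | a, z) ≤ K(a, b | z)` up to a logarithmic term. -/
theorem CC_add_le (hU : IsOptimal U) (hcode : code.Computable) :
    ∃ c : ℕ, ∀ a b z, CC U a z + CC U b (code [a, z]) ≤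
      CC U (code [a, b]) z + c * L (CC U (code [a, b]) z) := by
  obtain ⟨c₁, h₁⟩ := hU.CC_le_of_card_le (R := fun (q : ℕ × Str) b =>
    CC U (code [entry code 0 q.2, b]) (entry code 1 q.2) ≤ q.1)
    (RE.CC_le hU (by fun_prop) (by fun_prop) (by fun_prop))
  obtain ⟨c₂, h₂⟩ := hU.CC_le_of_card_le (R := fun (q : (ℕ × ℕ) × Str) a =>
    AtLeast (2 ^ q.1.2) fun b => CC U (code [a, b]) q.2 ≤ q.1.1)
    (RE.atLeast (RE.CC_le hU (by fun_prop) (by fun_prop) (by fun_prop)) (by fun_prop))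
  refine ⟨2 + c₁ + 6 * c₂, fun a b z => ?_⟩
  generalize hm : CC U (code [a, b]) z = m
  -- Here 2^e approximates the number of b' with C(a,b'|z) ≤ m. Given a and z, the string b costs
  -- e+1 bits; only 2^(m+1-e) strings can have that many partners, so a costs m+1-e bits given z.
  -- The sum is m+2.
  obtain ⟨e, hem, he, he'⟩ := exists_atLeast_two_pow (β := Str)
    (P := fun b' => CC U (code [a, b']) z ≤ m) (m := m + 1) (b := b) hm.le
    fun s hs => card_code_le hU hs
  have k₁ := h₁ m (code [a, z]) b (e + 1) (by simpa using hm.le) (by simpa using he')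
  have k₂ := h₂ (m, e) z a (m + 1 - e) he fun s hs => ?_
  · have l1 := L_encode_pair_le m e
    have l2 : L e ≤ 2 * L m :=
      (L_mono hem).trans ((L_add_le m 1).trans
        (by have := one_le_L m; have : L 1 = 1 := by decide
            omega))
    have l3 := one_le_L m
    simp only [L_encode_nat] at l1 k₁
    have l4 := Nat.mul_le_mul_left c₂ (l1.trans (show _ ≤ 6 * L m by omega))
    have l5 : e + 1 + (m + 1 - e) = m + 2 := by omega
    nlinarith
  · choose! t ht htm using hs
    have h3 : s.card * 2 ^ e ≤ 2 ^ (m + 1) := by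
      calc s.card * 2 ^ e = ∑ _a ∈ s, 2 ^ e := by rw [Finset.sum_const, smul_eq_mul]
        _ ≤ ∑ a ∈ s, (t a).card := Finset.sum_le_sum ht
        _ = (s.sigma t).card := (Finset.card_sigma _ _).symm
        _ = ((s.sigma t).image fun q => code [q.1, q.2]).card := by
            rw [Finset.card_image_of_injective]
            rintro ⟨a, b⟩ ⟨a', b'⟩ h
            simpa using h
        _ ≤ _ := by
            refine hU.card_le (y := z) fun x hx => ?_
            obtain ⟨q, hq, rfl⟩ := Finset.mem_image.1 hx
            rw [Finset.mem_sigma] at hq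
            exact htm q.1 hq.1 q.2 hq.2
    have h4 : 2 ^ (m + 1) = 2 ^ (m + 1 - e) * 2 ^ e := by
      rw [← pow_add, Nat.sub_add_cancel hem]
    rw [h4] at h3
    exact Nat.le_of_mul_le_mul_right h3 (by positivity)

end ChainRules

/-! ### Transcripts and combinatorial rectangles -/

namespace Protocol

variable {π : Protocol} {code : List Str ≃ Str} {x y x' y' t t' : Str}

theorem history_succ (π : Protocol) (x y : Str) (k : ℕ) :
    π.history x y (k + 1) = π.step x y (π.history x y k) :=
  Function.iterate_succ_apply' _ _ _

theorem history_prefix (π : Protocol) (x y : Str) {j k : ℕ} (h : j ≤ k) :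
    π.history x y j <+: π.history x y k := by
  induction h with
  | refl => exact List.prefix_rfl
  | step _ ih =>
    refine ih.trans ?_
    rw [history_succ, step]
    split
    · exact List.prefix_rfl
    · exact List.prefix_append _ _

theorem history_eq_of_finished {j k : ℕ}
    (hk : π.finished (π.sizeA x) (π.history x y k) = true) (h : k ≤ j) :
    π.history x y j = π.history x y k := by
  induction h with
  | refl => rfl
  | step _ ih => rw [history_succ, ih, step, if_pos hk]

theorem history_prefix_of_finished {j k : ℕ}
    (hk : π.finished (π.sizeA x) (π.history x y k) = true) :
    π.history x y j <+: π.history x y k := by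
  rcases le_total j k with h | h
  · exact history_prefix π x y h
  · rw [history_eq_of_finished hk h]

theorem IsTranscript.unique (h : π.IsTranscript code x y t) (h' : π.IsTranscript code x y t') :
    t' = t := by
  obtain ⟨-, k, hk, rfl⟩ := h
  obtain ⟨-, k', hk', rfl⟩ := h'
  congr 1
  rcases le_total k k' with h | h
  · exact history_eq_of_finished hk h
  · exact (history_eq_of_finished hk' h).symm

/-- The pairs of inputs of a given size with a given transcript form a combinatorial rectangle. -/
theorem IsTranscript.cross (h : π.IsTranscript code x y t) (h' : π.IsTranscript code x' y' t)
    (hs : π.sizeA x = π.sizeA x') : π.IsTranscript code x y' t := by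
  obtain ⟨hxy, k, hk, ht⟩ := h
  obtain ⟨hxy', k', hk', ht'⟩ := h'
  have hfin : π.history x' y' k' = π.history x y k := code.injective (ht'.symm.trans ht)
  -- The two given runs are prefixes of the same final history, so they agree at each time. The
  -- mixed run takes Alice's messages from the first and Bob's from the second, hence agrees with
  -- both.
  have key : ∀ j, π.history x' y' j = π.history x y j ∧ π.history x y' j = π.history x y j := by
    intro j
    induction j with
    | zero => exact ⟨rfl, rfl⟩
    | succ j ih =>
      have p1 : π.history x y (j + 1) <+: π.history x y k := history_prefix_of_finished hk
      have p2 : π.history x' y' (j + 1) <+: π.history x y k :=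
        hfin ▸ history_prefix_of_finished hk'
      simp only [history_succ, ih.1, ih.2] at p1 p2 ⊢
      generalize π.history x y j = g at p1 p2 ⊢
      simp only [step, ← hs] at p1 p2 ⊢
      by_cases hf : π.finished (π.sizeA x) g = true
      · simp [hf]
      · simp only [hf, if_false, Bool.false_eq_true] at p1 p2 ⊢
        have e := List.prefix_or_prefix_of_prefix p1 p2
        by_cases ha : π.aliceSpeaks (π.sizeA x) g = true <;> simp [ha] at e ⊢ <;> tauto
  refine ⟨hs.trans hxy', k, ?_, ?_⟩
  · rw [(key k).2, hk]
  · rw [(key k).2, ht]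

theorem re_isTranscript (π : Protocol) (hcode : code.Computable) :
    RE fun q : (Str × Str) × Str => π.IsTranscript code q.1.1 q.1.2 q.2 := by
  have hA : Computable π.sizeA := π.computable_sizeA
  have hB : Computable π.sizeB := π.computable_sizeB
  have hF : Computable fun q : ℕ × List Str => π.finished q.1 q.2 := π.computable_finished
  have hS : Computable fun q : ℕ × List Str => π.aliceSpeaks q.1 q.2 := π.computable_aliceSpeaks
  have hmA : Computable fun q : Str × List Str => π.msgA q.1 q.2 := π.computable_msgA
  have hmB : Computable fun q : Str × List Str => π.msgB q.1 q.2 := π.computable_msgB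
  have hstep : Computable fun q : (Str × Str) × List Str => π.step q.1.1 q.1.2 q.2 := by
    refine (Computable.cond (c := fun q : (Str × Str) × List Str =>
      π.finished (π.sizeA q.1.1) q.2) (f := fun q => q.2)
      (g := fun q => q.2 ++ [bif π.aliceSpeaks (π.sizeA q.1.1) q.2 then π.msgA q.1.1 q.2
        else π.msgB q.1.2 q.2]) ?_ (by fun_prop) ?_).of_eq ?_
    · exact hF.comp (g := fun q : (Str × Str) × List Str => (π.sizeA q.1.1, q.2)) (by fun_prop)
    · refine computable_append (by fun_prop) (computable_cons (Computable.cond ?_ ?_ ?_)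
        (by fun_prop))
      · exact hS.comp (g := fun q : (Str × Str) × List Str => (π.sizeA q.1.1, q.2)) (by fun_prop)
      · exact hmA.comp (g := fun q : (Str × Str) × List Str => (q.1.1, q.2)) (by fun_prop)
      · exact hmB.comp (g := fun q : (Str × Str) × List Str => (q.1.2, q.2)) (by fun_prop)
    · rintro ⟨⟨x, y⟩, h⟩
      simp only [step, Bool.cond_eq_ite]
  have hhist : Computable fun q : (Str × Str) × ℕ => π.history q.1.1 q.1.2 q.2 := by
    refine (Computable.nat_rec (f := fun q : (Str × Str) × ℕ => q.2)
      (g := fun _ => ([] : List Str)) (h := fun q r => π.step q.1.1 q.1.2 r.2)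
      (by fun_prop) (by fun_prop) ?_).of_eq ?_
    · exact hstep.comp (g := fun q : ((Str × Str) × ℕ) × (ℕ × List Str) => (q.1.1, q.2.2))
        (by fun_prop)
    · rintro ⟨⟨x, y⟩, k⟩
      induction k with
      | zero => rfl
      | succ k ih =>
        rw [history_succ]
        dsimp only at ih ⊢
        rw [ih]
  have hhist' : Computable fun q : ((Str × Str) × Str) × ℕ =>
      π.history q.1.1.1 q.1.1.2 q.2 :=
    hhist.comp (g := fun q : ((Str × Str) × Str) × ℕ => (q.1.1, q.2)) (by fun_prop)
  refine RE.and (RE.eq (by fun_prop) (by fun_prop)) (RE.ex (RE.and (RE.of_computable ?_)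
    (RE.eq (by fun_prop) (by fun_prop))))
  exact hF.comp (g := fun q : ((Str × Str) × Str) × ℕ =>
    (π.sizeA q.1.1.1, π.history q.1.1.1 q.1.1.2 q.2)) (by fun_prop)

end Protocol

/-- A counting form of `2 H(x, y) ≤ H(t) + H(x) + H(y) + H(y | x, t) + H(x | y, t)` for a set of
pairs partitioned by disjoint rectangles. -/
theorem card_sq_le_of_rectangles {α β τ : Type*} [DecidableEq α] [DecidableEq β] [DecidableEq τ]
    {S : Finset (α × β × τ)} {T : Finset τ} {X : Finset α} {Y : Finset β} {M N : ℕ}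
    {P : α → β → τ → Prop} (huniq : ∀ x y t t', P x y t → P x y t' → t' = t)
    (hcross : ∀ x y x' y' t, (x, y, t) ∈ S → (x', y', t) ∈ S → P x y' t)
    (hT : ∀ q ∈ S, q.2.2 ∈ T) (hX : ∀ q ∈ S, q.1 ∈ X) (hY : ∀ q ∈ S, q.2.1 ∈ Y)
    (hM : ∀ x t, ∀ s : Finset β, (∀ y ∈ s, (x, y, t) ∈ S) → s.card ≤ M)
    (hN : ∀ y t, ∀ s : Finset α, (∀ x ∈ s, (x, y, t) ∈ S) → s.card ≤ N) :
    S.card ^ 2 ≤ T.card * (X.card * Y.card * (M * N)) := by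
  let St : τ → Finset (α × β × τ) := fun t => S.filter fun q => q.2.2 = t
  let Xt : τ → Finset α := fun t => (St t).image fun q => q.1
  let Yt : τ → Finset β := fun t => (St t).image fun q => q.2.1
  have hmem : ∀ {q t}, q ∈ St t ↔ q ∈ S ∧ q.2.2 = t := Finset.mem_filter
  have h1 : S.card = ∑ t ∈ T, (St t).card :=
    Finset.card_eq_sum_card_fiberwise (f := fun q => q.2.2) fun q hq => hT q hq
  have h2 : ∀ t, (St t).card ≤ (Xt t).card * M := by
    intro t
    refine (Finset.card_le_mul_card_image (f := fun q : α × β × τ => q.1) (St t) M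
      fun x _ => ?_).trans_eq (mul_comm _ _)
    rw [← Finset.card_image_of_injOn (f := fun q : α × β × τ => q.2.1)]
    · refine hM x t _ fun y hy => ?_
      obtain ⟨⟨x', y', t'⟩, hq, rfl⟩ := Finset.mem_image.1 hy
      obtain ⟨hq1, rfl⟩ := Finset.mem_filter.1 hq
      obtain ⟨hq2, rfl⟩ := hmem.1 hq1
      exact hq2
    · rintro ⟨x₁, y₁, t₁⟩ hq₁ ⟨x₂, y₂, t₂⟩ hq₂ h
      simp only [Finset.mem_coe, Finset.mem_filter, hmem] at hq₁ hq₂ h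
      obtain ⟨⟨-, rfl⟩, rfl⟩ := hq₁
      obtain ⟨⟨-, rfl⟩, rfl⟩ := hq₂
      rw [h]
  have h3 : ∀ t, (St t).card ≤ (Yt t).card * N := by
    intro t
    refine (Finset.card_le_mul_card_image (f := fun q : α × β × τ => q.2.1) (St t) N
      fun y _ => ?_).trans_eq (mul_comm _ _)
    rw [← Finset.card_image_of_injOn (f := fun q : α × β × τ => q.1)]
    · refine hN y t _ fun x hx => ?_
      obtain ⟨⟨x', y', t'⟩, hq, rfl⟩ := Finset.mem_image.1 hx
      obtain ⟨hq1, rfl⟩ := Finset.mem_filter.1 hq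
      obtain ⟨hq2, rfl⟩ := hmem.1 hq1
      exact hq2
    · rintro ⟨x₁, y₁, t₁⟩ hq₁ ⟨x₂, y₂, t₂⟩ hq₂ h
      simp only [Finset.mem_coe, Finset.mem_filter, hmem] at hq₁ hq₂ h
      obtain ⟨⟨-, rfl⟩, rfl⟩ := hq₁
      obtain ⟨⟨-, rfl⟩, rfl⟩ := hq₂
      rw [h]
  -- Each rectangle `Xt t ×ˢ Yt t` consists of pairs with transcript `t`, even when these pairs are
  -- not in `S`; uniqueness of the transcript makes the rectangles disjoint.
  have h4 : ∑ t ∈ T, (Xt t).card * (Yt t).card ≤ X.card * Y.card := by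
    rw [← Finset.card_product]
    simp_rw [← Finset.card_product (Xt _)]
    rw [← Finset.card_biUnion]
    · refine Finset.card_le_card fun q hq => ?_
      obtain ⟨t, -, hq⟩ := Finset.mem_biUnion.1 hq
      obtain ⟨hx, hy⟩ := Finset.mem_product.1 hq
      obtain ⟨a, ha, hax⟩ := Finset.mem_image.1 hx
      obtain ⟨b, hb, hby⟩ := Finset.mem_image.1 hy
      exact Finset.mem_product.2 ⟨hax ▸ hX a (hmem.1 ha).1, hby ▸ hY b (hmem.1 hb).1⟩
    · intro t _ t' _ hne
      have key : ∀ q t, q ∈ Xt t ×ˢ Yt t → P q.1 q.2 t := by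
        intro q t hq
        obtain ⟨hx, hy⟩ := Finset.mem_product.1 hq
        obtain ⟨⟨a₁, a₂, a₃⟩, ha, hax⟩ := Finset.mem_image.1 hx
        obtain ⟨⟨b₁, b₂, b₃⟩, hb, hby⟩ := Finset.mem_image.1 hy
        obtain ⟨haS, hat⟩ := hmem.1 ha
        obtain ⟨hbS, hbt⟩ := hmem.1 hb
        dsimp only at hat hbt hax hby
        subst hat hbt hax hby
        exact hcross _ _ _ _ _ haS hbS
      exact Finset.disjoint_left.2 fun q hq hq' => hne (huniq _ _ _ _ (key q t' hq') (key q t hq))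
  calc S.card ^ 2 = (∑ t ∈ T, (St t).card) ^ 2 := by rw [h1]
    -- Cauchy–Schwarz over transcripts. Afterwards one factor |S_t| is bounded by rows and the other
    -- by columns.
    _ ≤ T.card * ∑ t ∈ T, (St t).card ^ 2 := sq_sum_le_card_mul_sum_sq
    _ ≤ T.card * ∑ t ∈ T, ((Xt t).card * (Yt t).card) * (M * N) := by
        refine Nat.mul_le_mul_left _ (Finset.sum_le_sum fun t _ => ?_)
        calc (St t).card ^ 2 = (St t).card * (St t).card := sq _
          _ ≤ ((Xt t).card * M) * ((Yt t).card * N) := Nat.mul_le_mul (h2 t) (h3 t)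
          _ = _ := by ring
    _ ≤ _ := by
        rw [← Finset.sum_mul]
        exact Nat.mul_le_mul_left _ (Nat.mul_le_mul_right _ h4)

theorem L_add_const_le (n c : ℕ) : L (n + c) ≤ (1 + L c) * L n := by
  have h1 := L_add_le n c
  have h2 := one_le_L n
  nlinarith

theorem L_le_of_le_add {m n c : ℕ} (h : m ≤ n + c) : L m ≤ (1 + L c) * L n :=
  (L_mono h).trans (L_add_const_le n c)

/-- The unary notation of a number. -/
def unary (n : ℕ) : Str := List.replicate n true

@[fun_prop] theorem computable_unary {α : Type*} [Primcodable α] {f : α → ℕ}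
    (hf : Computable f) : Computable fun a => unary (f a) := by
  have h : Primrec unary := by
    refine (Primrec.nat_rec₁ (f := fun _ l => true :: l) ([] : Str)
      (Primrec.list_cons.comp (Primrec.const true) Primrec.snd)).of_eq fun n => ?_
    induction n with
    | zero => rfl
    | succ n ih => rw [unary, List.replicate_succ, ← unary, ← ih]
  exact h.to_comp.comp hf

@[simp] theorem length_unary (n : ℕ) : (unary n).length = n := List.length_replicate

/-! ### The inequality C(t|x) + C(t|y) ≤ C(t) for transcripts -/

section Transcript

variable {U : Machine} {code : List Str ≃ Str}

/-- Symmetry of information is applied to x and (t,y), then to t and y given x. In the application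
`z x` is the input size; being computable from x, it can be dropped from conditions that contain x.
-/
theorem CC_chain_le (hU : IsOptimal U) (hcode : code.Computable) {z : Str → Str}
    (hz : Computable z) : ∃ c : ℕ, ∀ x y t,
      CC U x (z x) + CC U t x + CC U y (code [t, x]) ≤
        CC U (code [x, y, t]) (z x) + c * L (C U (code [x, y, t])) := by
  obtain ⟨c₁, h₁⟩ := CC_add_le hU hcode
  obtain ⟨c₂, h₂⟩ := hU.CC_le_CC (f := fun w _ => code [entry code 0 w,
    code [entry code 2 w, entry code 1 w]]) (g := fun s => s) (by fun_prop) (by fun_prop)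
  obtain ⟨c₃, h₃⟩ := hU.CC_le_CC (f := fun w _ => w) (g := fun s => code [s, z s])
    (by fun_prop) (by fun_prop)
  obtain ⟨c₄, h₄⟩ := hU.CC_le_CC (f := fun w _ => w)
    (g := fun s => code [entry code 0 s, code [entry code 1 s, z (entry code 1 s)]])
    (by fun_prop) (by fun_prop)
  obtain ⟨c₅, h₅⟩ := hU.CC_le_CC (f := fun w _ => code [entry code 0 w,
    code [entry code 2 w, entry code 1 w]]) (g := fun _ => []) (by fun_prop) (by fun_prop)
  obtain ⟨c₆, h₆⟩ := hU.CC_le_CC (f := fun w _ => code [entry code 2 w, entry code 1 w])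
    (g := fun _ => []) (by fun_prop) (by fun_prop)
  refine ⟨c₁ * (1 + L c₅) + c₁ * (1 + L c₆) + c₂ + c₃ + c₄, fun x y t => ?_⟩
  have k₁ := h₁ x (code [t, y]) (z x)
  have k₁' := h₁ t y (code [x, z x])
  have k₂ := h₂ (code [x, y, t]) (z x)
  have k₃ := h₃ t x
  have k₄ := h₄ y (code [t, x])
  have k₅ := h₅ (code [x, y, t]) (z x)
  have k₆ := h₆ (code [x, y, t]) (code [x, z x])
  simp only [entry_zero, entry_one, entry_two] at k₂ k₄ k₅ k₆
  change _ ≤ C U _ + _ at k₅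
  change _ ≤ C U _ + _ at k₆
  have l₅ := Nat.mul_le_mul_left c₁ (L_le_of_le_add k₅)
  have l₆ := Nat.mul_le_mul_left c₁ (L_le_of_le_add k₆)
  have l := one_le_L (C U (code [x, y, t]))
  have m₂ := Nat.mul_le_mul_left (c₂ + c₃ + c₄) l
  linarith

/-- With the five complexities as parameters, the triples obeying these bounds are enumerable, and
`card_sq_le_of_rectangles` bounds the square of their number. The size is a condition: the rectangle
property needs it fixed, and as a parameter it would cost its logarithm, which need not be small. -/
theorem CC_transcript_le (hU : IsOptimal U) (hcode : code.Computable) (π : Protocol) :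
    ∃ c : ℕ, ∀ x y t, π.IsTranscript code x y t → ∀ N, C U t ≤ N →
      CC U x (unary (π.sizeA x)) ≤ N → CC U y (unary (π.sizeA x)) ≤ N →
      CC U y (code [t, x]) ≤ N → CC U x (code [t, y]) ≤ N →
      2 * CC U (code [x, y, t]) (unary (π.sizeA x)) ≤ C U t + CC U x (unary (π.sizeA x)) +
        CC U y (unary (π.sizeA x)) + CC U y (code [t, x]) + CC U x (code [t, y]) + c * L N := by
  have hA : Computable π.sizeA := π.computable_sizeA
  obtain ⟨c, hc⟩ := hU.CC_le_of_card_le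
    (R := fun (q : (ℕ × ℕ × ℕ × ℕ × ℕ) × Str) v => ∃ r : Str × Str × Str,
      v = code [r.1, r.2.1, r.2.2] ∧ π.sizeA r.1 = q.2.length ∧
      π.IsTranscript code r.1 r.2.1 r.2.2 ∧ CC U r.2.2 [] ≤ q.1.1 ∧ CC U r.1 q.2 ≤ q.1.2.1 ∧
      CC U r.2.1 q.2 ≤ q.1.2.2.1 ∧ CC U r.2.1 (code [r.2.2, r.1]) ≤ q.1.2.2.2.1 ∧
      CC U r.1 (code [r.2.2, r.2.1]) ≤ q.1.2.2.2.2)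
    (RE.ex (RE.and (RE.eq (by fun_prop) (by fun_prop)) (RE.and (RE.eq (by fun_prop) (by fun_prop))
      (RE.and ((π.re_isTranscript hcode).comp
          (g := fun q : (((ℕ × ℕ × ℕ × ℕ × ℕ) × Str) × Str) × Str × Str × Str =>
            ((q.2.1, q.2.2.1), q.2.2.2)) (by fun_prop))
        (RE.and (RE.CC_le hU (by fun_prop) (by fun_prop) (by fun_prop))
        (RE.and (RE.CC_le hU (by fun_prop) (by fun_prop) (by fun_prop))
        (RE.and (RE.CC_le hU (by fun_prop) (by fun_prop) (by fun_prop))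
        (RE.and (RE.CC_le hU (by fun_prop) (by fun_prop) (by fun_prop))
        (RE.CC_le hU (by fun_prop) (by fun_prop) (by fun_prop))))))))))
  refine ⟨6 + 2 * c * 92, fun x y t ht N h0 h1 h2 h3 h4 => ?_⟩
  change CC U t [] ≤ N at h0
  change _ ≤ CC U t [] + _ + _ + _ + _ + _
  -- The division by 2 undoes the square. In the summand 6, five units come from the five factors
  -- 2^(p+1) of the counting bound, one from rounding up.
  have key := hc (CC U t [], CC U x (unary (π.sizeA x)), CC U y (unary (π.sizeA x)),
    CC U y (code [t, x]), CC U x (code [t, y])) (unary (π.sizeA x)) (code [x, y, t])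
    ((CC U t [] + CC U x (unary (π.sizeA x)) + CC U y (unary (π.sizeA x)) + CC U y (code [t, x])
      + CC U x (code [t, y]) + 6) / 2)
    ⟨(x, y, t), rfl, by simp, ht, le_rfl, le_rfl, le_rfl, le_rfl, le_rfl⟩
  generalize CC U t [] = p0 at *
  generalize CC U x (unary (π.sizeA x)) = p1 at *
  generalize CC U y (unary (π.sizeA x)) = p2 at *
  generalize CC U y (code [t, x]) = p3 at *
  generalize CC U x (code [t, y]) = p4 at *
  generalize CC U (code [x, y, t]) (unary (π.sizeA x)) = K at *
  have key' := key fun s hs => ?_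
  · have e0 := one_le_L N
    have e1 := L_encode_pair_le p0 (p1, p2, p3, p4)
    have e2 := L_encode_pair_le p1 (p2, p3, p4)
    have e3 := L_encode_pair_le p2 (p3, p4)
    have e4 := L_encode_pair_le p3 p4
    have f0 := L_mono h0
    have f1 := L_mono h1
    have f2 := L_mono h2
    have f3 := L_mono h3
    have f4 := L_mono h4
    simp only [L_encode_nat] at e1 e2 e3 e4
    have e5 : L (Encodable.encode (p0, p1, p2, p3, p4)) ≤ 92 * L N := by omega
    have e6 := Nat.mul_le_mul_left c e5
    rw [add_mul]
    have e7 : 2 * c * 92 * L N = 2 * (c * (92 * L N)) := by ring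
    omega
  · clear key
    choose! r hr1 hr2 hr3 hr4 hr5 hr6 hr7 hr8 using hs
    dsimp only at hr1 hr2 hr3 hr4 hr5 hr6 hr7 hr8
    have hrinj : Set.InjOn r s := fun a ha b hb h => by rw [hr1 a ha, hr1 b hb, h]
    have hcard := card_sq_le_of_rectangles (S := s.image r)
      (T := (s.image r).image fun q => q.2.2) (X := (s.image r).image fun q => q.1)
      (Y := (s.image r).image fun q => q.2.1) (M := 2 ^ (p3 + 1)) (N := 2 ^ (p4 + 1))
      (P := fun x y t => π.IsTranscript code x y t)
      (fun x y t t' h h' => h.unique h')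
      (fun x₁ y₁ x₂ y₂ t' h₁ h₂ => ?_) (fun q hq => Finset.mem_image_of_mem _ hq)
      (fun q hq => Finset.mem_image_of_mem _ hq) (fun q hq => Finset.mem_image_of_mem _ hq)
      (fun x' t' u hu => hU.card_le (y := code [t', x']) fun y' hy' => ?_)
      (fun y' t' u hu => hU.card_le (y := code [t', y']) fun x' hx' => ?_)
    · rw [Finset.card_image_of_injOn hrinj] at hcard
      have hT : ((s.image r).image fun q => q.2.2).card ≤ 2 ^ (p0 + 1) := by
        refine hU.card_le (y := []) fun t' ht' => ?_
        obtain ⟨q, hq, rfl⟩ := Finset.mem_image.1 ht'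
        obtain ⟨v, hv, rfl⟩ := Finset.mem_image.1 hq
        exact hr4 v hv
      have hX : ((s.image r).image fun q => q.1).card ≤ 2 ^ (p1 + 1) := by
        refine hU.card_le (y := unary (π.sizeA x)) fun t' ht' => ?_
        obtain ⟨q, hq, rfl⟩ := Finset.mem_image.1 ht'
        obtain ⟨v, hv, rfl⟩ := Finset.mem_image.1 hq
        exact hr5 v hv
      have hY : ((s.image r).image fun q => q.2.1).card ≤ 2 ^ (p2 + 1) := by
        refine hU.card_le (y := unary (π.sizeA x)) fun t' ht' => ?_
        obtain ⟨q, hq, rfl⟩ := Finset.mem_image.1 ht'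
        obtain ⟨v, hv, rfl⟩ := Finset.mem_image.1 hq
        exact hr6 v hv
      have h5 : s.card ^ 2 ≤ 2 ^ (p0 + p1 + p2 + p3 + p4 + 5) := by
        refine hcard.trans ((Nat.mul_le_mul hT (Nat.mul_le_mul (Nat.mul_le_mul hX hY)
          le_rfl)).trans_eq ?_)
        simp only [← pow_add]
        congr 1
        ring
      have h6 : s.card ^ 2 ≤ (2 ^ ((p0 + p1 + p2 + p3 + p4 + 6) / 2)) ^ 2 := by
        refine h5.trans ?_
        rw [← pow_mul]
        exact Nat.pow_le_pow_right (by norm_num) (by omega)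
      exact (Nat.pow_le_pow_iff_left (by norm_num)).1 h6
    · obtain ⟨v₁, hv₁, e₁⟩ := Finset.mem_image.1 h₁
      obtain ⟨v₂, hv₂, e₂⟩ := Finset.mem_image.1 h₂
      have a1 := hr3 v₁ hv₁
      have a2 := hr3 v₂ hv₂
      have b1 := hr2 v₁ hv₁
      have b2 := hr2 v₂ hv₂
      rw [e₁] at a1 b1
      rw [e₂] at a2 b2
      exact a1.cross a2 (b1.trans b2.symm)
    · obtain ⟨v, hv, e⟩ := Finset.mem_image.1 (hu y' hy')
      have := hr7 v hv
      rwa [e] at this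
    · obtain ⟨v, hv, e⟩ := Finset.mem_image.1 (hu x' hx')
      have := hr8 v hv
      rwa [e] at this

/-- The main inequality for transcripts: `K(t | x) + K(t | y) ≤ K(t)` up to a logarithmic term. -/
theorem CC_transcript_add_le (hU : IsOptimal U) (hcode : code.Computable) (π : Protocol) :
    ∃ c : ℕ, ∀ x y t, π.IsTranscript code x y t →
      CC U t x + CC U t y ≤ C U t + c * L (C U (code [x, y, t])) := by
  have hA : Computable π.sizeA := π.computable_sizeA
  have hB : Computable π.sizeB := π.computable_sizeB
  obtain ⟨c₁, h₁⟩ := CC_transcript_le hU hcode π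
  obtain ⟨c₂, h₂⟩ := CC_chain_le hU hcode (z := fun x => unary (π.sizeA x)) (by fun_prop)
  obtain ⟨c₃, h₃⟩ := CC_chain_le hU hcode (z := fun x => unary (π.sizeB x)) (by fun_prop)
  obtain ⟨d₀, g₀⟩ := hU.CC_le_CC (f := fun w _ => entry code 0 w) (g := fun _ => [])
    (by fun_prop) (by fun_prop)
  obtain ⟨d₁, g₁⟩ := hU.CC_le_CC (f := fun w _ => entry code 1 w) (g := fun _ => [])
    (by fun_prop) (by fun_prop)
  obtain ⟨d₂, g₂⟩ := hU.CC_le_CC (f := fun w _ => entry code 2 w) (g := fun _ => [])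
    (by fun_prop) (by fun_prop)
  obtain ⟨d₃, g₃⟩ := hU.CC_le_CC (f := fun w _ => code [entry code 1 w, entry code 0 w,
    entry code 2 w]) (g := fun s => s) (by fun_prop) (by fun_prop)
  refine ⟨c₁ * (1 + L (d₀ + d₁ + d₂)) + c₂ + c₃ * (1 + L d₃) + d₃, fun x y t ht => ?_⟩
  have k₁ := h₁ x y t ht (C U (code [x, y, t]) + (d₀ + d₁ + d₂))
  -- The chain rules starting from x and from y add up to at most twice the complexity of the
  -- triple; against `k₁` the terms for x, y, y given (t,x) and x given (t,y) cancel.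
  have k₂ := h₂ x y t
  have k₃ := h₃ y x t
  rw [← ht.1] at k₃
  have i₀ := fun s => g₀ (code [x, y, t]) s
  have i₁ := fun s => g₁ (code [x, y, t]) s
  have i₂ := fun s => g₂ (code [x, y, t]) s
  have i₃ := fun s => g₃ (code [x, y, t]) s
  simp only [entry_zero, entry_one, entry_two] at i₀ i₁ i₂ i₃
  have k₄ := k₁ ((i₂ _).trans (by unfold C; omega)) ((i₀ _).trans (by unfold C; omega))
    ((i₁ _).trans (by unfold C; omega)) ((i₁ _).trans (by unfold C; omega))
    ((i₀ _).trans (by unfold C; omega))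
  have k₅ := i₃ (unary (π.sizeA x))
  have k₆ : C U (code [y, x, t]) ≤ C U (code [x, y, t]) + d₃ := i₃ []
  have l₁ := Nat.mul_le_mul_left c₁ (L_add_const_le (C U (code [x, y, t])) (d₀ + d₁ + d₂))
  have l₃ := Nat.mul_le_mul_left c₃ (L_le_of_le_add k₆)
  have m₃ := Nat.mul_le_mul_left d₃ (one_le_L (C U (code [x, y, t])))
  linarith

end Transcript

/-! ### The probabilistic method: dispersing graphs -/

section RandomGraph

open Finset

/-- An exponential moment bound for the number of functions that often take values in `B`. -/
theorem card_filter_mul_pow_le {ι ρ : Type*} [Fintype ι] [DecidableEq ι] [Fintype ρ]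
    [DecidableEq ρ] (B : Finset ρ) (μ q : ℕ) (hμ : 1 ≤ μ) :
    #{f : ι → ρ | q ≤ #{i | f i ∈ B}} * μ ^ q ≤
      (Fintype.card ρ + μ * #B) ^ Fintype.card ι := by
  -- With this weight the product over coordinates is μ to the number of hits, and its sum over all
  -- functions factorizes.
  let w : ρ → ℕ := fun r => if r ∈ B then μ else 1
  have h1 : ∀ f : ι → ρ, ∏ i, w (f i) = μ ^ #{i | f i ∈ B} := by
    intro f
    simp only [w]
    rw [Finset.prod_ite]
    simp
  have h2 : ∑ r, w r ≤ Fintype.card ρ + μ * #B := by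
    simp only [w]
    rw [Finset.sum_ite]
    simp only [sum_const, smul_eq_mul, mul_one, filter_univ_mem]
    rw [add_comm, mul_comm]
    gcongr
    exact Finset.card_le_univ _
  calc #{f : ι → ρ | q ≤ #{i | f i ∈ B}} * μ ^ q
      = ∑ f ∈ ({f : ι → ρ | q ≤ #{i | f i ∈ B}} : Finset (ι → ρ)), μ ^ q := by simp
    _ ≤ ∑ f ∈ ({f : ι → ρ | q ≤ #{i | f i ∈ B}} : Finset (ι → ρ)), ∏ i, w (f i) := by
        refine sum_le_sum fun f hf => ?_
        rw [h1]
        exact Nat.pow_le_pow_right hμ (mem_filter.1 hf).2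
    _ ≤ ∑ f : ι → ρ, ∏ i, w (f i) :=
        sum_le_sum_of_subset (subset_univ _)
    _ = (∑ r, w r) ^ Fintype.card ι := by
        rw [← Finset.card_univ (α := ι), ← Finset.prod_const, Finset.prod_univ_sum,
          Fintype.piFinset_univ]
    _ ≤ _ := Nat.pow_le_pow_left h2 _

/-- For positive n this is (1 + 1/n)^n ≤ e < 3. -/
theorem succ_pow_self_le (n : ℕ) : (n + 1) ^ n ≤ 3 * n ^ n := by
  rcases Nat.eq_zero_or_pos n with rfl | hn
  · simp
  have hn' : (0 : ℝ) < n := by exact_mod_cast hn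
  have h1 : ((1 : ℝ) / n + 1) ^ n ≤ 3 := by
    calc ((1 : ℝ) / n + 1) ^ n ≤ (Real.exp (1 / n)) ^ n := by
          gcongr
          exact Real.add_one_le_exp _
      _ = Real.exp 1 := by rw [← Real.exp_nat_mul]; congr 1; field_simp
      _ ≤ 3 := by linarith [Real.exp_one_lt_d9]
  have h2 : ((n : ℝ) + 1) ^ n = ((1 : ℝ) / n + 1) ^ n * n ^ n := by
    rw [← mul_pow]; congr 1; field_simp; ring
  have h3 : ((n : ℝ) + 1) ^ n ≤ 3 * n ^ n := by
    rw [h2]; gcongr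
  exact_mod_cast h3

variable {V Ω : Type*} [Fintype V] [DecidableEq V] [Fintype Ω] [DecidableEq Ω]

/-- For weight 2^12 the moment is at most (2|Ω|)^(4d), while d hits contribute 2^(12d); a vertex is
thus bad with probability at most 2^(-8d). -/
theorem card_rows_le {d : ℕ} {H : Finset Ω} (hH : 2 ^ 12 * #H ≤ Fintype.card Ω) :
    #{f : Fin (4 * d) → Ω | d ≤ #{i | f i ∈ H}} * 2 ^ (8 * d) ≤
      Fintype.card (Fin (4 * d) → Ω) := by
  have h := card_filter_mul_pow_le (ι := Fin (4 * d)) H (2 ^ 12) d (by norm_num)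
  have h2 : (Fintype.card Ω + 2 ^ 12 * #H) ^ Fintype.card (Fin (4 * d)) ≤
      Fintype.card (Fin (4 * d) → Ω) * 2 ^ (4 * d) := by
    rw [Fintype.card_fun, Fintype.card_fin, ← mul_pow]
    exact Nat.pow_le_pow_left (by omega) _
  refine Nat.le_of_mul_le_mul_right (c := 2 ^ (4 * d)) ?_ (by positivity)
  refine le_trans (le_of_eq ?_) (h.trans h2)
  rw [mul_assoc, ← pow_add, ← pow_mul]
  congr 2
  ring

/-- The moment bound is applied again, now over vertices. The weight 2^(8d-k) keeps the moment
within a factor (1 + 2^(-k))^(2^k) ≤ 3 and is at least 2^(4d), because k ≤ 4d. -/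
theorem card_bad_graphs_le {k d Q : ℕ} (hV : Fintype.card V = 2 ^ k) (hk : k ≤ 4 * d)
    {H : Finset Ω} (hH : 2 ^ 12 * #H ≤ Fintype.card Ω) :
    #{F : V → Fin (4 * d) → Ω | Q ≤ #{v | d ≤ #{i | F v i ∈ H}}} * 2 ^ (4 * d * Q) ≤
      3 * Fintype.card (V → Fin (4 * d) → Ω) := by
  set B : Finset (Fin (4 * d) → Ω) := {f | d ≤ #{i | f i ∈ H}} with hB
  have hBc := card_rows_le (d := d) hH
  rw [← hB] at hBc
  have h := card_filter_mul_pow_le (ι := V) B (2 ^ (8 * d - k)) Q Nat.one_le_two_pow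
  have h1 : ({F : V → Fin (4 * d) → Ω | Q ≤ #{v | d ≤ #{i | F v i ∈ H}}} :
      Finset (V → Fin (4 * d) → Ω)) =
      ({F : V → Fin (4 * d) → Ω | Q ≤ #{v | F v ∈ B}} : Finset (V → Fin (4 * d) → Ω)) := by
    simp [hB]
  rw [h1]
  have h2 : 2 ^ (4 * d * Q) ≤ (2 ^ (8 * d - k)) ^ Q := by
    rw [← pow_mul]
    exact Nat.pow_le_pow_right (by norm_num) (Nat.mul_le_mul_right _ (by omega))
  refine (Nat.mul_le_mul_left _ h2).trans (h.trans ?_)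
  rw [hV, Fintype.card_fun (α := V), hV]
  generalize Fintype.card (Fin (4 * d) → Ω) = R at *
  have h3 : (R + 2 ^ (8 * d - k) * #B) * 2 ^ k ≤ R * (2 ^ k + 1) := by
    have : 2 ^ (8 * d - k) * 2 ^ k = 2 ^ (8 * d) := by
      rw [← pow_add]; congr 1; omega
    calc (R + 2 ^ (8 * d - k) * #B) * 2 ^ k
        = R * 2 ^ k + #B * (2 ^ (8 * d - k) * 2 ^ k) := by ring
      _ ≤ R * 2 ^ k + R := by rw [this]; omega
      _ = _ := by ring
  refine Nat.le_of_mul_le_mul_right (c := (2 ^ k) ^ (2 ^ k)) ?_ (by positivity)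
  calc (R + 2 ^ (8 * d - k) * #B) ^ 2 ^ k * (2 ^ k) ^ 2 ^ k
      = ((R + 2 ^ (8 * d - k) * #B) * 2 ^ k) ^ 2 ^ k := (mul_pow _ _ _).symm
    _ ≤ (R * (2 ^ k + 1)) ^ 2 ^ k := Nat.pow_le_pow_left h3 _
    _ = R ^ 2 ^ k * (2 ^ k + 1) ^ 2 ^ k := mul_pow _ _ _
    _ ≤ R ^ 2 ^ k * (3 * (2 ^ k) ^ 2 ^ k) := Nat.mul_le_mul_left _ (succ_pow_self_le _)
    _ = _ := by ring

/-- Union bound over the family: the failure probability is at most 3·2^M/2^(4dQ) ≤ 3/16. -/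
theorem card_bad_graphs_family_le {k d Q M : ℕ} (hV : Fintype.card V = 2 ^ k) (hk : k ≤ 4 * d)
    {𝓗 : Finset (Finset Ω)} (hH : ∀ H ∈ 𝓗, 2 ^ 12 * #H ≤ Fintype.card Ω) (h𝓗 : #𝓗 ≤ 2 ^ M)
    (hM : M + 4 ≤ 4 * d * Q) :
    #{F : V → Fin (4 * d) → Ω | ∃ H ∈ 𝓗, Q ≤ #{v | d ≤ #{i | F v i ∈ H}}} * 16 ≤
      3 * Fintype.card (V → Fin (4 * d) → Ω) := by
  have h1 : #{F : V → Fin (4 * d) → Ω | ∃ H ∈ 𝓗, Q ≤ #{v | d ≤ #{i | F v i ∈ H}}} ≤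
      ∑ H ∈ 𝓗, #{F : V → Fin (4 * d) → Ω | Q ≤ #{v | d ≤ #{i | F v i ∈ H}}} := by
    refine (Finset.card_le_card fun F hF => ?_).trans Finset.card_biUnion_le
    simpa using hF
  refine Nat.le_of_mul_le_mul_right (c := 2 ^ M) ?_ (by positivity)
  calc _ = _ * 2 ^ (M + 4) := by rw [pow_add]; ring
    _ ≤ (∑ H ∈ 𝓗, #{F : V → Fin (4 * d) → Ω | Q ≤ #{v | d ≤ #{i | F v i ∈ H}}}) *
        2 ^ (4 * d * Q) := Nat.mul_le_mul h1 (Nat.pow_le_pow_right (by norm_num) hM)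
    _ ≤ ∑ H ∈ 𝓗, 3 * Fintype.card (V → Fin (4 * d) → Ω) := by
        rw [Finset.sum_mul]
        exact Finset.sum_le_sum fun H h => card_bad_graphs_le hV hk (hH H h)
    _ ≤ _ := by
        rw [Finset.sum_const, smul_eq_mul, mul_comm]
        exact Nat.mul_le_mul_left _ h𝓗

/-- Three failure probabilities of at most 3/16 sum to 9/16 < 1. -/
theorem exists_graph {k d Q₁ Q₂ Q₃ M₁ M₂ M₃ : ℕ} [Nonempty Ω] (hV : Fintype.card V = 2 ^ k)
    (hk : k ≤ 4 * d) {𝓗₁ 𝓗₂ 𝓗₃ : Finset (Finset Ω)}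
    (hH₁ : ∀ H ∈ 𝓗₁, 2 ^ 12 * #H ≤ Fintype.card Ω)
    (hH₂ : ∀ H ∈ 𝓗₂, 2 ^ 12 * #H ≤ Fintype.card Ω)
    (hH₃ : ∀ H ∈ 𝓗₃, 2 ^ 12 * #H ≤ Fintype.card Ω)
    (h𝓗₁ : #𝓗₁ ≤ 2 ^ M₁) (h𝓗₂ : #𝓗₂ ≤ 2 ^ M₂) (h𝓗₃ : #𝓗₃ ≤ 2 ^ M₃)
    (hM₁ : M₁ + 4 ≤ 4 * d * Q₁) (hM₂ : M₂ + 4 ≤ 4 * d * Q₂) (hM₃ : M₃ + 4 ≤ 4 * d * Q₃) :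
    ∃ F : V → Fin (4 * d) → Ω, (∀ H ∈ 𝓗₁, #{v | d ≤ #{i | F v i ∈ H}} < Q₁) ∧
      (∀ H ∈ 𝓗₂, #{v | d ≤ #{i | F v i ∈ H}} < Q₂) ∧
      ∀ H ∈ 𝓗₃, #{v | d ≤ #{i | F v i ∈ H}} < Q₃ := by
  have h1 := card_bad_graphs_family_le (Q := Q₁) hV hk hH₁ h𝓗₁ hM₁
  have h2 := card_bad_graphs_family_le (Q := Q₂) hV hk hH₂ h𝓗₂ hM₂
  have h3 := card_bad_graphs_family_le (Q := Q₃) hV hk hH₃ h𝓗₃ hM₃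
  have hpos : 0 < Fintype.card (V → Fin (4 * d) → Ω) := Fintype.card_pos
  rw [← Finset.card_univ (α := V → Fin (4 * d) → Ω)] at h1 h2 h3 hpos
  by_contra hcon
  push Not at hcon
  have h4 : (univ : Finset (V → Fin (4 * d) → Ω)) ⊆
      univ.filter (fun F => ∃ H ∈ 𝓗₁, Q₁ ≤ #{v | d ≤ #{i | F v i ∈ H}}) ∪
      univ.filter (fun F => ∃ H ∈ 𝓗₂, Q₂ ≤ #{v | d ≤ #{i | F v i ∈ H}}) ∪
      univ.filter (fun F => ∃ H ∈ 𝓗₃, Q₃ ≤ #{v | d ≤ #{i | F v i ∈ H}}) := by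
    intro F _
    simp only [mem_union, mem_filter, mem_univ, true_and]
    by_contra hF
    push Not at hF
    obtain ⟨H, hH, hlt⟩ := hcon F hF.1.1 hF.1.2
    exact absurd (hF.2 H hH) (not_lt.2 hlt)
  have h5 := (card_le_card h4).trans ((card_union_le _ _).trans
    (Nat.add_le_add_right (card_union_le _ _) _))
  omega

end RandomGraph

/-! ### Dispersing graphs on strings -/

section StringGraph

open Finset

theorem card_vector_filter_le {n m : ℕ} (f g : Str → Str) (H : Finset Str)
    (hinj : ∀ w w', f w = f w' → g w = g w' → w = w')
    (hg : ∀ w : Str, w.length = n + m → (g w).length = m) :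
    #{w : List.Vector Bool (n + m) | f w.1 ∈ H} ≤ #H * 2 ^ m := by
  rw [← card_allStr m, ← Finset.card_product]
  refine card_le_card_of_injOn (fun w => (f w.1, g w.1)) (fun w hw => ?_) fun w _ w' _ h => ?_
  · simp only [coe_product, Set.mem_prod, mem_coe, List.mem_toFinset, mem_allStr]
    exact ⟨(mem_filter.1 hw).2, hg _ w.2⟩
  · simp only [Prod.mk.injEq] at h
    exact Subtype.ext (hinj _ _ h.1 h.2)

/-- The label of the `i`-th edge at the vertex `p` of a graph of degree `D` given by the list `E` of
its labels. -/
def edge (E : List Str) (D : ℕ) (p : Str) (i : ℕ) : Str := E.getD (val p * D + i) []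

/-- The graph becomes a finite list so that it can be found by a computable search. -/
theorem exists_edge_list {k d n : ℕ} (F : List.Vector Bool k → Fin (4 * d) → List.Vector Bool n) :
    ∃ E : List Str, ∀ (p : List.Vector Bool k) (i : Fin (4 * d)),
      edge E (4 * d) p.1 i = (F p i).1 := by
  have hdec : ∀ q : ℕ, ∃ r : List.Vector Bool k, q < 2 ^ k → val r.1 = q := by
    intro q
    by_cases hq : q < 2 ^ k
    · obtain ⟨r, hr, hv⟩ := exists_val_eq k q hq
      exact ⟨⟨r, hr⟩, fun _ => hv⟩
    · exact ⟨List.Vector.replicate k true, fun h => absurd h hq⟩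
  choose dec hdec using hdec
  refine ⟨(List.range (2 ^ k * (4 * d))).map fun j =>
    if h : 0 < 4 * d then (F (dec (j / (4 * d))) ⟨j % (4 * d), Nat.mod_lt _ h⟩).1 else [],
    fun p i => ?_⟩
  have hd : 0 < 4 * d := i.pos
  have hp : val p.1 < 2 ^ k := by have := val_lt p.1; rwa [p.2] at this
  have hi : val p.1 * (4 * d) + i < 2 ^ k * (4 * d) := by
    calc val p.1 * (4 * d) + i < (val p.1 + 1) * (4 * d) := by have := i.2; linarith
      _ ≤ _ := Nat.mul_le_mul_right _ hp
  have e1 : (val p.1 * (4 * d) + i) / (4 * d) = val p.1 := by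
    rw [mul_comm, Nat.mul_add_div hd, Nat.div_eq_of_lt i.2, add_zero]
  have e2 : (val p.1 * (4 * d) + i) % (4 * d) = i := by
    rw [mul_comm, Nat.mul_add_mod, Nat.mod_eq_of_lt i.2]
  have e3 : dec (val p.1) = p := Subtype.ext
    (val_injective ((dec (val p.1)).2.trans p.2.symm) (hdec _ hp))
  rw [edge, List.getD_eq_getElem _ _ (by simpa using hi)]
  simp only [List.getElem_map, List.getElem_range, dif_pos hd, e1, e2, e3]

/-- For every small set `H` of strings of length `m` only few vertices have many edges with a label
whose image under `f` belongs to `H`. -/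
def Disperses (k d : ℕ) (E : List Str) (f : Str → Str) (m Q : ℕ) : Prop :=
  ∀ H ⊆ (allStr m).toFinset, 2 ^ 12 * #H ≤ 2 ^ m →
    #{p ∈ (allStr k).toFinset | d ≤ #{i ∈ range (4 * d) | f (edge E (4 * d) p i) ∈ H}} < Q

theorem disperses_of_graph {k d n m Q : ℕ} {F : List.Vector Bool k → Fin (4 * d) → List.Vector Bool n}
    {E : List Str} (hE : ∀ (p : List.Vector Bool k) (i : Fin (4 * d)),
      edge E (4 * d) p.1 i = (F p i).1) {f : Str → Str} {𝓗 : Finset (Finset (List.Vector Bool n))}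
    (h𝓗 : 𝓗 = ({H ∈ (allStr m).toFinset.powerset | 2 ^ 12 * #H ≤ 2 ^ m}).image
      fun H => ({w | f w.1 ∈ H} : Finset (List.Vector Bool n)))
    (hF : ∀ H ∈ 𝓗, #{v | d ≤ #{i | F v i ∈ H}} < Q) : Disperses k d E f m Q := by
  intro H hH hc
  have h := hF {w | f w.1 ∈ H} (by
    rw [h𝓗]
    exact mem_image_of_mem _ (mem_filter.2 ⟨mem_powerset.2 hH, hc⟩))
  refine lt_of_le_of_lt ?_ h
  rw [← card_image_of_injective (f := fun v : List.Vector Bool k => v.1) _ Subtype.val_injective]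
  refine card_le_card fun p hp => ?_
  simp only [mem_filter, List.mem_toFinset, mem_allStr] at hp
  refine mem_image.2 ⟨⟨p, hp.1⟩, mem_filter.2 ⟨mem_univ _, hp.2.trans ?_⟩, rfl⟩
  rw [← card_image_of_injective (f := fun i : Fin (4 * d) => i.1) _ Fin.val_injective]
  refine card_le_card fun i hi => ?_
  simp only [mem_filter, mem_range] at hi
  refine mem_image.2 ⟨⟨i, hi.1⟩, ?_, rfl⟩
  simp only [mem_filter, mem_univ, true_and]
  have e := hE ⟨p, hp.1⟩ ⟨i, hi.1⟩
  exact e ▸ hi.2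

/-- There are at most 2^(2^m) sets of m-bit strings, whence the terms 2^a, 2^b and 2^(a+b). Pulling
a set of prefixes or suffixes back to whole labels preserves its density, so all three families fit
into one random graph. -/
theorem exists_dispersing_list {k a b d Q₁ Q₂ Q₃ : ℕ} (hk : k ≤ 4 * d)
    (h₁ : 2 ^ a + 4 ≤ 4 * d * Q₁) (h₂ : 2 ^ b + 4 ≤ 4 * d * Q₂)
    (h₃ : 2 ^ (a + b) + 4 ≤ 4 * d * Q₃) :
    ∃ E : List Str, (∀ p : Str, p.length = k → ∀ i < 4 * d,
        (edge E (4 * d) p i).length = a + b) ∧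
      Disperses k d E (fun w => w.take a) a Q₁ ∧ Disperses k d E (fun w => w.drop a) b Q₂ ∧
      Disperses k d E (fun w => w) (a + b) Q₃ := by
  have hΩ : Fintype.card (List.Vector Bool (a + b)) = 2 ^ (a + b) := by
    rw [card_vector, Fintype.card_bool]
  have hV : Fintype.card (List.Vector Bool k) = 2 ^ k := by
    rw [card_vector, Fintype.card_bool]
  have hcard : ∀ (f : Str → Str) (m : ℕ),
      #(({H ∈ (allStr m).toFinset.powerset | 2 ^ 12 * #H ≤ 2 ^ m}).image
      fun H => ({w | f w.1 ∈ H} : Finset (List.Vector Bool (a + b)))) ≤ 2 ^ 2 ^ m := by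
    intro f m
    refine card_image_le.trans ((card_filter_le _ _).trans ?_)
    rw [card_powerset, card_allStr]
  have side1 : ∀ H' ∈ ({H ∈ (allStr a).toFinset.powerset | 2 ^ 12 * #H ≤ 2 ^ a}).image
      fun H => ({w | w.1.take a ∈ H} : Finset (List.Vector Bool (a + b))),
      2 ^ 12 * #H' ≤ Fintype.card (List.Vector Bool (a + b)) := by
    intro H' hH'
    obtain ⟨H, hH, rfl⟩ := mem_image.1 hH'
    have h := card_vector_filter_le (n := a) (m := b) (fun w => w.take a) (fun w => w.drop a) H
      (fun w w' h h' => by rw [← List.take_append_drop a w, h, h', List.take_append_drop])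
      (fun w hw => by simp [hw])
    rw [hΩ, pow_add]
    have h2 := Nat.mul_le_mul_right (2 ^ b) (mem_filter.1 hH).2
    linarith
  have side2 : ∀ H' ∈ ({H ∈ (allStr b).toFinset.powerset | 2 ^ 12 * #H ≤ 2 ^ b}).image
      fun H => ({w | w.1.drop a ∈ H} : Finset (List.Vector Bool (a + b))),
      2 ^ 12 * #H' ≤ Fintype.card (List.Vector Bool (a + b)) := by
    intro H' hH'
    obtain ⟨H, hH, rfl⟩ := mem_image.1 hH'
    have h : #{w : List.Vector Bool (a + b) | w.1.drop a ∈ H} ≤ #H * 2 ^ a := by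
      rw [← card_allStr a, ← Finset.card_product]
      refine card_le_card_of_injOn (fun w => (w.1.drop a, w.1.take a)) (fun w hw => ?_)
        fun w _ w' _ h => ?_
      · simp only [coe_product, Set.mem_prod, mem_coe, List.mem_toFinset, mem_allStr]
        exact ⟨(mem_filter.1 hw).2, by simp⟩
      · simp only [Prod.mk.injEq] at h
        exact Subtype.ext (by
          rw [← List.take_append_drop a w.1, h.1, h.2, List.take_append_drop])
    rw [hΩ, pow_add]
    have h2 := Nat.mul_le_mul_right (2 ^ a) (mem_filter.1 hH).2
    linarith
  have side3 : ∀ H' ∈ ({H ∈ (allStr (a + b)).toFinset.powerset | 2 ^ 12 * #H ≤ 2 ^ (a + b)}).image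
      fun H => ({w | w.1 ∈ H} : Finset (List.Vector Bool (a + b))),
      2 ^ 12 * #H' ≤ Fintype.card (List.Vector Bool (a + b)) := by
    intro H' hH'
    obtain ⟨H, hH, rfl⟩ := mem_image.1 hH'
    rw [hΩ]
    refine le_trans (Nat.mul_le_mul_left _ ?_) (mem_filter.1 hH).2
    exact card_le_card_of_injOn (fun w => w.1) (fun w hw => (mem_filter.1 hw).2)
      fun w _ w' _ h => Subtype.ext h
  obtain ⟨F, hF₁, hF₂, hF₃⟩ := exists_graph (V := List.Vector Bool k)
    (Ω := List.Vector Bool (a + b)) (Q₁ := Q₁) (Q₂ := Q₂) (Q₃ := Q₃) hV hk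
    (𝓗₁ := ({H ∈ (allStr a).toFinset.powerset | 2 ^ 12 * #H ≤ 2 ^ a}).image
      fun H => ({w | w.1.take a ∈ H} : Finset (List.Vector Bool (a + b))))
    (𝓗₂ := ({H ∈ (allStr b).toFinset.powerset | 2 ^ 12 * #H ≤ 2 ^ b}).image
      fun H => ({w | w.1.drop a ∈ H} : Finset (List.Vector Bool (a + b))))
    (𝓗₃ := ({H ∈ (allStr (a + b)).toFinset.powerset | 2 ^ 12 * #H ≤ 2 ^ (a + b)}).image
      fun H => ({w | w.1 ∈ H} : Finset (List.Vector Bool (a + b))))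
    side1 side2 side3 (hcard (fun w => w.take a) a) (hcard (fun w => w.drop a) b)
    (hcard (fun w => w) (a + b)) h₁ h₂ h₃
  obtain ⟨E, hE⟩ := exists_edge_list F
  refine ⟨E, fun p hp i hi => ?_, disperses_of_graph hE rfl hF₁, disperses_of_graph hE rfl hF₂,
    disperses_of_graph hE rfl hF₃⟩
  rw [hE ⟨p, hp⟩ ⟨i, hi⟩]
  exact (F _ _).2

end StringGraph

/-! ### Searching for a graph; vertices with many bad edges are simple -/

section Fingerprint

open Finset

variable {α : Type*} [Primcodable α]

@[fun_prop] theorem computable_edge {E : α → List Str} {D i : α → ℕ} {p : α → Str}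
    (hE : Computable E) (hD : Computable D) (hp : Computable p) (hi : Computable i) :
    Computable fun a => edge (E a) (D a) (p a) (i a) := by
  unfold edge
  fun_prop

@[fun_prop] theorem computable_sublists' {β : Type*} [Primcodable β] {f : α → List β}
    (hf : Computable f) : Computable fun a => (f a).sublists' := by
  have h : Primrec fun l : List β => l.sublists' := by
    refine (Primrec.list_foldr (f := fun l : List β => l) (g := fun _ => [([] : List β)])
      (h := fun _ q => q.2 ++ q.2.map (List.cons q.1)) Primrec.id (Primrec.const _) ?_).of_eq ?_
    · refine Primrec.list_append.comp (Primrec.snd.comp Primrec.snd)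
        (Primrec.list_map (Primrec.snd.comp Primrec.snd) ?_)
      exact Primrec.list_cons.comp (Primrec.fst.comp (Primrec.snd.comp Primrec.fst)) Primrec.snd
    · intro l
      induction l with
      | nil => rfl
      | cons b l ih => rw [List.foldr_cons, ih, List.sublists'_cons]
  exact h.to_comp.comp hf

/-- Upper bounds on bad vertices and bad edges become lower bounds on good ones, which `RE.atLeast`
can enumerate. If Q exceeds 2^k, the truncated difference is 0 and both sides of the vertex count
are trivial. -/
theorem disperses_iff {k d : ℕ} {E : List Str} {f : Str → Str} {m Q : ℕ} :
    Disperses k d E f m Q ↔ ∀ H ∈ (allStr m).sublists', 2 ^ m < 2 ^ 12 * H.length ∨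
      AtLeast (2 ^ k + 1 - Q) fun p => p.length = k ∧
        AtLeast (3 * d + 1) fun i => i < 4 * d ∧ f (edge E (4 * d) p i) ∉ H := by
  constructor
  · intro h H hH
    rw [List.mem_sublists'] at hH
    rw [or_iff_not_imp_left, not_lt]
    intro hc
    have hnd := hH.nodup (nodup_allStr m)
    have h1 := h H.toFinset (fun w hw => List.mem_toFinset.2 (hH.subset (List.mem_toFinset.1 hw)))
      (by rwa [List.toFinset_card_of_nodup hnd])
    have h2 := card_filter_add_card_filter_not (s := (allStr k).toFinset) fun p =>
      d ≤ #{i ∈ range (4 * d) | f (edge E (4 * d) p i) ∈ H.toFinset}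
    rw [card_allStr] at h2
    refine ⟨{p ∈ (allStr k).toFinset |
        ¬ d ≤ #{i ∈ range (4 * d) | f (edge E (4 * d) p i) ∈ H.toFinset}}, by omega,
      fun p hp => ?_⟩
    simp only [mem_filter, List.mem_toFinset, mem_allStr, not_le] at hp
    refine ⟨hp.1, {i ∈ range (4 * d) | ¬ f (edge E (4 * d) p i) ∈ H}, ?_, fun i hi => ?_⟩
    · have h3 := card_filter_add_card_filter_not (s := range (4 * d)) fun i =>
        f (edge E (4 * d) p i) ∈ H
      rw [card_range] at h3
      omega
    · simpa using hi
  · intro h H hH hc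
    have hmem : ∀ w, w ∈ (allStr m).filter (fun w => w ∈ H) ↔ w ∈ H := by
      intro w
      rw [List.mem_filter, decide_eq_true_eq]
      exact ⟨fun h => h.2, fun h => ⟨List.mem_toFinset.1 (hH h), h⟩⟩
    have hlen : ((allStr m).filter (fun w => w ∈ H)).length = #H := by
      rw [← List.toFinset_card_of_nodup ((nodup_allStr m).filter _)]
      congr 1
      ext w
      rw [List.mem_toFinset, hmem]
    rcases h ((allStr m).filter fun w => w ∈ H)
      (List.mem_sublists'.2 List.filter_sublist) with h1 | ⟨s, hs, hs'⟩
    · rw [hlen] at h1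
      omega
    · set B : Finset Str := {p ∈ (allStr k).toFinset |
        d ≤ #{i ∈ range (4 * d) | f (edge E (4 * d) p i) ∈ H}} with hB
      have hdisj : Disjoint s B := by
        rw [Finset.disjoint_left]
        intro p hp hpB
        obtain ⟨-, I, hI, hI'⟩ := hs' p hp
        have h2 := (mem_filter.1 hpB).2
        have h3 : I ⊆ ({i ∈ range (4 * d) | ¬ f (edge E (4 * d) p i) ∈ H} : Finset ℕ) := by
          intro i hi
          obtain ⟨h4, h5⟩ := hI' i hi
          rw [hmem] at h5
          exact mem_filter.2 ⟨mem_range.2 h4, h5⟩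
        have h4 := card_filter_add_card_filter_not (s := range (4 * d)) fun i =>
          f (edge E (4 * d) p i) ∈ H
        rw [card_range] at h4
        have h5 := card_le_card h3
        omega
      have hsub : s ∪ B ⊆ (allStr k).toFinset := by
        refine union_subset (fun p hp => ?_) (filter_subset _ _)
        exact List.mem_toFinset.2 (mem_allStr.2 (hs' p hp).1)
      have h2 := card_le_card hsub
      rw [card_union_of_disjoint hdisj, card_allStr] at h2
      omega

theorem RE.disperses {k d m e : α → ℕ} {E : α → List Str} {f : α → Str → Str}
    (hk : Computable k) (hd : Computable d) (hm : Computable m) (he : Computable e)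
    (hE : Computable E) (hf : Computable fun q : α × Str => f q.1 q.2) :
    RE fun a => Disperses (k a) (d a) (E a) (f a) (m a) (2 ^ e a) := by
  have hf' : Computable fun q : ((α × List Str) × Str) × ℕ =>
      f q.1.1.1 (edge (E q.1.1.1) (4 * d q.1.1.1) q.1.2 q.2) :=
    hf.comp (g := fun q : ((α × List Str) × Str) × ℕ =>
      (q.1.1.1, edge (E q.1.1.1) (4 * d q.1.1.1) q.1.2 q.2)) (by fun_prop)
  have h1 : RE fun q : ((α × List Str) × Str) => AtLeast (3 * d q.1.1 + 1) fun i =>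
      i < 4 * d q.1.1 ∧ f q.1.1 (edge (E q.1.1) (4 * d q.1.1) q.2 i) ∉ q.1.2 := by
    refine RE.atLeast ?_ (by fun_prop)
    exact RE.and (RE.lt (by fun_prop) (by fun_prop)) (RE.notMem hf' (by fun_prop))
  have h2 : RE fun q : α × List Str => AtLeast (2 ^ k q.1 + 1 - 2 ^ e q.1) fun p : Str =>
      p.length = k q.1 ∧ AtLeast (3 * d q.1 + 1) fun i =>
        i < 4 * d q.1 ∧ f q.1 (edge (E q.1) (4 * d q.1) p i) ∉ q.2 := by
    refine RE.atLeast ?_ (by fun_prop)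
    exact RE.and (RE.eq (by fun_prop) (by fun_prop)) h1
  have h3 : RE fun a => ∀ H ∈ (allStr (m a)).sublists', 2 ^ m a < 2 ^ 12 * H.length ∨
      AtLeast (2 ^ k a + 1 - 2 ^ e a) fun p : Str => p.length = k a ∧
        AtLeast (3 * d a + 1) fun i => i < 4 * d a ∧ f a (edge (E a) (4 * d a) p i) ∉ H := by
    refine RE.forall_mem ?_ (by fun_prop)
    exact RE.or (RE.lt (by fun_prop) (by fun_prop)) h2
  exact h3.of_iff fun a => disperses_iff

/-- A quarter of the degree of the graphs that define the fingerprints. -/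
def deg (k r : ℕ) : ℕ := (k + 1) * 2 ^ (2 * r + 1)

@[fun_prop] theorem computable_deg {k r : α → ℕ} (hk : Computable k) (hr : Computable r) :
    Computable fun a => deg (k a) (r a) := by
  unfold deg
  fun_prop

theorem four_mul_deg_le (k r : ℕ) : 4 * deg k r ≤ 2 ^ (L k + 2 * r + 4) := by
  have h := lt_two_pow_L k
  calc 4 * deg k r = (k + 1) * 2 ^ (2 * r + 3) := by rw [deg]; ring
    _ ≤ 2 ^ (L k + 1) * 2 ^ (2 * r + 3) := Nat.mul_le_mul_right _ (by omega)
    _ = _ := by rw [← pow_add]; congr 1; ring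

/-- The graphs that define the fingerprints; the parameters are the length of the vertices, the
lengths of the two parts of the labels, and the logarithm of the precision. -/
def IsGraph (q : ℕ × ℕ × ℕ × ℕ) (E : List Str) : Prop :=
  (∀ p ∈ allStr q.1, ∀ i ∈ List.range (4 * deg q.1 q.2.2.2),
    (edge E (4 * deg q.1 q.2.2.2) p i).length = q.2.1 + q.2.2.1) ∧
  Disperses q.1 (deg q.1 q.2.2.2) E (fun w => w.take q.2.1) q.2.1 (2 ^ (q.2.1 - q.2.2.2)) ∧
  Disperses q.1 (deg q.1 q.2.2.2) E (fun w => w.drop q.2.1) q.2.2.1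
    (2 ^ (q.2.2.1 - q.2.2.2)) ∧
  Disperses q.1 (deg q.1 q.2.2.2) E (fun w => w) (q.2.1 + q.2.2.1) (2 ^ (q.1 - q.2.2.2))

/-- The exponent 2r in `deg` covers the gap between label length and logarithm of the allowed number
of bad vertices: at most r for a and for b, and (a+b) - (k-r) ≤ 2r for the whole label by the
hypothesis. The factor k+1 secures k ≤ 4d. -/
theorem exists_isGraph {k a b r : ℕ} (h : a + b ≤ k + r) : ∃ E, IsGraph (k, a, b, r) E := by
  have aux : ∀ m e s, m ≤ e + s → 2 ^ m + 4 ≤ 4 * ((k + 1) * 2 ^ (s + 1)) * 2 ^ e := by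
    intro m e s hs
    have h1 : 2 ^ m ≤ 2 ^ s * 2 ^ e := by
      rw [← pow_add]; exact Nat.pow_le_pow_right (by norm_num) (by omega)
    have h2 : 1 ≤ 2 ^ s * 2 ^ e := Nat.mul_pos (by positivity) (by positivity)
    have h3 : 4 * ((k + 1) * 2 ^ (s + 1)) * 2 ^ e = 8 * (2 ^ s * 2 ^ e) + 8 * k * (2 ^ s * 2 ^ e) := by
      rw [pow_succ]; ring
    rw [h3]
    have : 0 ≤ 8 * k * (2 ^ s * 2 ^ e) := Nat.zero_le _
    omega
  have hk : k ≤ 4 * deg k r := by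
    have : 1 ≤ 2 ^ (2 * r + 1) := Nat.one_le_two_pow
    rw [deg]
    nlinarith
  obtain ⟨E, h0, h1, h2, h3⟩ := exists_dispersing_list (k := k) (a := a) (b := b) (d := deg k r)
    (Q₁ := 2 ^ (a - r)) (Q₂ := 2 ^ (b - r)) (Q₃ := 2 ^ (k - r)) hk
    (aux _ _ _ (by omega)) (aux _ _ _ (by omega)) (aux _ _ _ (by omega))
  exact ⟨E, fun p hp i hi => h0 p (mem_allStr.1 hp) i (List.mem_range.1 hi), h1, h2, h3⟩

theorem re_isGraph : RE fun q : (ℕ × ℕ × ℕ × ℕ) × List Str => IsGraph q.1 q.2 := by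
  refine RE.and ?_ (RE.and ?_ (RE.and ?_ ?_))
  · refine RE.forall_mem ?_ (by fun_prop)
    refine RE.forall_mem ?_ (by fun_prop)
    exact RE.eq (by fun_prop) (by fun_prop)
  all_goals refine RE.disperses ?_ ?_ ?_ ?_ ?_ ?_ <;> fun_prop

/-- A fixed partial recursive choice: the four numbers determine the graph, so no further bits are
needed to describe it. -/
theorem exists_graph_search : ∃ G : ℕ × ℕ × ℕ × ℕ →. List Str, Partrec G ∧
    (∀ q, ∀ E ∈ G q, IsGraph q E) ∧
    ∀ k a b r, a + b ≤ k + r → ∃ E, E ∈ G (k, a, b, r) := by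
  obtain ⟨G, hG, hs, hc⟩ := re_isGraph.uniformize
  refine ⟨G, hG, hs, fun k a b r h => ?_⟩
  obtain ⟨E, hE⟩ := exists_isGraph h
  exact hc _ E hE

variable {U : Machine} {code : List Str ≃ Str}

/-- A vertex many of whose labels belong to a small enumerable set has small complexity. -/
theorem CC_le_of_many_labels (hU : IsOptimal U) {G : ℕ × ℕ × ℕ × ℕ →. List Str} (hG : Partrec G)
    {f : ℕ × ℕ × ℕ × ℕ → Str → Str} (hf : Computable fun q : (ℕ × ℕ × ℕ × ℕ) × Str => f q.1 q.2)
    {m e : ℕ × ℕ × ℕ × ℕ → ℕ} {T : (ℕ × ℕ × ℕ × ℕ) × Str → Str → Prop}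
    (hT : RE fun q : ((ℕ × ℕ × ℕ × ℕ) × Str) × Str => T q.1 q.2) :
    ∃ c : ℕ, ∀ q s E p, E ∈ G q →
      Disperses q.1 (deg q.1 q.2.2.2) E (f q) (m q) (2 ^ e q) →
      (∀ p ∈ allStr q.1, ∀ i < 4 * deg q.1 q.2.2.2,
        (f q (edge E (4 * deg q.1 q.2.2.2) p i)).length = m q) →
      (∀ H : Finset Str, (∀ w ∈ H, w.length = m q ∧ T (q, s) w) → 2 ^ 12 * #H ≤ 2 ^ m q) →
      p.length = q.1 →
      AtLeast (deg q.1 q.2.2.2) (fun i => i < 4 * deg q.1 q.2.2.2 ∧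
        T (q, s) (f q (edge E (4 * deg q.1 q.2.2.2) p i))) →
      0 < e q ∧ CC U p s ≤ e q + c * L (Encodable.encode q) := by
  classical
  have hf' : Computable fun q : ((((ℕ × ℕ × ℕ × ℕ) × Str) × Str) × List Str) × ℕ =>
      f q.1.1.1.1 (edge q.1.2 (4 * deg q.1.1.1.1.1 q.1.1.1.1.2.2.2) q.1.1.2 q.2) :=
    hf.comp (g := fun q : ((((ℕ × ℕ × ℕ × ℕ) × Str) × Str) × List Str) × ℕ =>
      (q.1.1.1.1, edge q.1.2 (4 * deg q.1.1.1.1.1 q.1.1.1.1.2.2.2) q.1.1.2 q.2)) (by fun_prop)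
  have h1 : RE fun q : (((ℕ × ℕ × ℕ × ℕ) × Str) × Str) × List Str =>
      AtLeast (deg q.1.1.1.1 q.1.1.1.2.2.2) fun i => i < 4 * deg q.1.1.1.1 q.1.1.1.2.2.2 ∧
      T q.1.1 (f q.1.1.1 (edge q.2 (4 * deg q.1.1.1.1 q.1.1.1.2.2.2) q.1.2 i)) := by
    refine RE.atLeast ?_ (by fun_prop)
    refine RE.and (RE.lt (by fun_prop) (by fun_prop)) ?_
    exact hT.comp (g := fun q : ((((ℕ × ℕ × ℕ × ℕ) × Str) × Str) × List Str) × ℕ =>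
      (q.1.1.1, f q.1.1.1.1 (edge q.1.2 (4 * deg q.1.1.1.1.1 q.1.1.1.1.2.2.2) q.1.1.2 q.2)))
      (computable_pair (by fun_prop) hf')
  let R : ((ℕ × ℕ × ℕ × ℕ) × Str) → Str → Prop := fun q p => ∃ E : List Str,
    E ∈ G q.1 ∧ p.length = q.1.1 ∧ AtLeast (deg q.1.1 q.1.2.2.2) fun i =>
      i < 4 * deg q.1.1 q.1.2.2.2 ∧ T q (f q.1 (edge E (4 * deg q.1.1 q.1.2.2.2) p i))
  have hR : RE fun q : ((ℕ × ℕ × ℕ × ℕ) × Str) × Str => R q.1 q.2 := by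
    refine RE.ex (RE.and (RE.mem₁ hG (by fun_prop) (by fun_prop)) (RE.and ?_ h1))
    exact RE.eq (by fun_prop) (by fun_prop)
  obtain ⟨c, hc⟩ := hU.CC_le_of_card_le hR
  refine ⟨c, fun q s E p hE hD hlen hH hp hat => ?_⟩
  have key : ∀ S : Finset Str, (∀ p ∈ S, p.length = q.1 ∧ AtLeast (deg q.1 q.2.2.2)
      (fun i => i < 4 * deg q.1 q.2.2.2 ∧ T (q, s) (f q (edge E (4 * deg q.1 q.2.2.2) p i)))) →
      #S < 2 ^ e q := by
    intro S hS
    refine lt_of_le_of_lt (card_le_card fun p hp => ?_) (hD {w ∈ (allStr (m q)).toFinset |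
      T (q, s) w} (filter_subset _ _) (hH _ fun w hw => by
        simpa [mem_allStr] using hw))
    obtain ⟨h1, I, hI, hI'⟩ := hS p hp
    refine mem_filter.2 ⟨List.mem_toFinset.2 (mem_allStr.2 h1), hI.trans (card_le_card
      fun i hi => ?_)⟩
    obtain ⟨h2, h3⟩ := hI' i hi
    refine mem_filter.2 ⟨mem_range.2 h2, mem_filter.2 ⟨?_, h3⟩⟩
    exact List.mem_toFinset.2 (mem_allStr.2 (hlen p (mem_allStr.2 h1) i h2))
  refine ⟨?_, hc q s p (e q) ⟨E, hE, hp, hat⟩ fun S hS => (key S fun p' hp' => ?_).le⟩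
  -- The strict bound leaves no bad vertices when the exponent is 0, but `p` is one. This covers the
  -- case where the truncated difference in the exponent vanishes.
  · have h1 := key {p} (by simpa using ⟨hp, hat⟩)
    by_contra h0
    simp [Nat.eq_zero_of_not_pos h0] at h1
  · obtain ⟨E', hE', h1, h2⟩ := hS p' hp'
    obtain rfl := Part.mem_unique hE hE'
    exact ⟨h1, h2⟩

/-- For most edges at a vertex `p`, a part of the label identifies `p` among the vertices of small
complexity given `s`. -/
theorem CC_vertex_le (hU : IsOptimal U) (hcode : code.Computable)
    {G : ℕ × ℕ × ℕ × ℕ →. List Str} (hG : Partrec G)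
    {f : ℕ × ℕ × ℕ × ℕ → Str → Str} (hf : Computable fun q : (ℕ × ℕ × ℕ × ℕ) × Str => f q.1 q.2)
    {m : ℕ × ℕ × ℕ × ℕ → ℕ} (hm : Computable m) :
    ∃ c : ℕ, ∀ q s E p, E ∈ G q →
      Disperses q.1 (deg q.1 q.2.2.2) E (f q) (m q) (2 ^ (m q - q.2.2.2)) →
      (∀ p ∈ allStr q.1, ∀ i < 4 * deg q.1 q.2.2.2,
        (f q (edge E (4 * deg q.1 q.2.2.2) p i)).length = m q) →
      p.length = q.1 → CC U p s ≤ m q + q.2.2.2 →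
      (q.2.2.2 < m q → m q - q.2.2.2 + c * L (Encodable.encode q) < CC U p s) →
      ∃ B : Finset ℕ, #B < deg q.1 q.2.2.2 ∧ ∀ i < 4 * deg q.1 q.2.2.2, i ∉ B →
        CC U p (code [f q (edge E (4 * deg q.1 q.2.2.2) p i), s]) ≤
          L q.1 + 3 * q.2.2.2 + 17 + c * L (Encodable.encode q) := by
  classical
  -- The edges with label part `u` at vertices of complexity at most m+r given the condition. The
  -- slack r gives a known threshold that still admits `p`.
  let N : ((ℕ × ℕ × ℕ × ℕ) × Str) → Str → Str × ℕ → Prop := fun q u v =>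
    v.1.length = q.1.1 ∧ CC U v.1 q.2 ≤ m q.1 + q.1.2.2.2 ∧ v.2 < 4 * deg q.1.1 q.1.2.2.2 ∧
      ∃ E, E ∈ G q.1 ∧ f q.1 (edge E (4 * deg q.1.1 q.1.2.2.2) v.1 v.2) = u
  have hN : RE fun q : (((ℕ × ℕ × ℕ × ℕ) × Str) × Str) × (Str × ℕ) => N q.1.1 q.1.2 q.2 :=
    RE.and (RE.eq (by fun_prop) (by fun_prop)) (RE.and
      (RE.CC_le hU (by fun_prop) (by fun_prop) (by fun_prop)) (RE.and
      (RE.lt (by fun_prop) (by fun_prop)) (RE.ex (RE.and (RE.mem₁ hG (by fun_prop) (by fun_prop))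
        (RE.eq (hf.comp (g := fun q : ((((ℕ × ℕ × ℕ × ℕ) × Str) × Str) × (Str × ℕ)) × List Str =>
          (q.1.1.1.1, edge q.2 (4 * deg q.1.1.1.1.1 q.1.1.1.1.2.2.2) q.1.2.1 q.1.2.2))
          (by fun_prop)) (by fun_prop))))))
  -- Heavy label parts. There are fewer than 2^(m+r+1) candidate vertices up to equality, each with
  -- 4d edges, so at most 2^(m-12) parts are heavy: the factor 2^13 matches the density 2^(-12) in
  -- `Disperses`.
  let T : ((ℕ × ℕ × ℕ × ℕ) × Str) → Str → Prop := fun q u =>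
    AtLeast (2 ^ (q.1.2.2.2 + 13) * (4 * deg q.1.1 q.1.2.2.2)) (N q u)
  have hT : RE fun q : ((ℕ × ℕ × ℕ × ℕ) × Str) × Str => T q.1 q.2 := RE.atLeast hN (by fun_prop)
  obtain ⟨c₁, h₁⟩ := CC_le_of_many_labels hU hG hf (m := m) (e := fun q => m q - q.2.2.2) hT
  obtain ⟨c₂, h₂⟩ := hU.CC_le_of_card_le (R := fun (q : (ℕ × ℕ × ℕ × ℕ) × Str) p =>
    ∃ i, N (q.1, entry code 1 q.2) (entry code 0 q.2) (p, i) )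
    (RE.ex (hN.comp (g := fun q : (((ℕ × ℕ × ℕ × ℕ) × Str) × Str) × ℕ =>
      (((q.1.1.1, entry code 1 q.1.1.2), entry code 0 q.1.1.2), (q.1.2, q.2))) (by fun_prop)))
  refine ⟨c₁ + c₂, fun q s E p hE hD hlen hp hps hlow => ?_⟩
  refine ⟨{i ∈ range (4 * deg q.1 q.2.2.2) |
    T (q, s) (f q (edge E (4 * deg q.1 q.2.2.2) p i))}, ?_, fun i hi hiB => ?_⟩
  · by_contra hcon
    have hsmall : ∀ H : Finset Str, (∀ w ∈ H, w.length = m q ∧ T (q, s) w) →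
        2 ^ 12 * #H ≤ 2 ^ m q := by
      intro H hH
      choose! S hS hS' using fun w hw => (hH w hw).2
      have hd : 0 < 4 * deg q.1 q.2.2.2 := by rw [deg]; positivity
      have h3 : #H * (2 ^ (q.2.2.2 + 13) * (4 * deg q.1 q.2.2.2)) ≤
          2 ^ (m q + q.2.2.2 + 1) * (4 * deg q.1 q.2.2.2) := by
        calc _ = ∑ w ∈ H, 2 ^ (q.2.2.2 + 13) * (4 * deg q.1 q.2.2.2) := by
              rw [sum_const, smul_eq_mul]
          _ ≤ ∑ w ∈ H, #(S w) := sum_le_sum hS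
          _ = #(H.biUnion S) := by
              rw [card_biUnion]
              intro w hw w' hw' hne
              refine Finset.disjoint_left.2 fun v hv hv' => hne ?_
              obtain ⟨-, -, -, E₁, hE₁, e₁⟩ := hS' w hw v hv
              obtain ⟨-, -, -, E₂, hE₂, e₂⟩ := hS' w' hw' v hv'
              obtain rfl := Part.mem_unique hE₁ hE₂
              exact e₁.symm.trans e₂
          _ ≤ #(((H.biUnion S).image Prod.fst) ×ˢ range (4 * deg q.1 q.2.2.2)) := by
              refine card_le_card fun v hv => mem_product.2 ⟨mem_image_of_mem _ hv, ?_⟩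
              obtain ⟨w, hw, hvw⟩ := mem_biUnion.1 hv
              exact mem_range.2 (hS' w hw v hvw).2.2.1
          _ ≤ _ := by
              rw [card_product, card_range]
              refine Nat.mul_le_mul_right _ (hU.card_le (y := s) fun p' hp' => ?_)
              obtain ⟨v, hv, rfl⟩ := mem_image.1 hp'
              obtain ⟨w, hw, hvw⟩ := mem_biUnion.1 hv
              exact (hS' w hw v hvw).2.1
      rw [← mul_assoc] at h3
      have h4 := Nat.le_of_mul_le_mul_right h3 hd
      refine Nat.le_of_mul_le_mul_right (c := 2 ^ (q.2.2.2 + 1)) ?_ (by positivity)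
      calc 2 ^ 12 * #H * 2 ^ (q.2.2.2 + 1) = #H * 2 ^ (q.2.2.2 + 13) := by ring
        _ ≤ _ := h4
        _ = _ := by ring
    obtain ⟨h3, h4⟩ := h₁ q s E p hE hD hlen hsmall hp ⟨_, not_lt.1 hcon, fun i hi => by
      simpa using hi⟩
    -- If d edges at `p` had heavy parts, then `p` would be simpler than the assumed lower bound
    -- allows.
    have h5 := hlow (by omega)
    rw [add_mul] at h5
    omega
  · have hmany : ¬ T (q, s) (f q (edge E (4 * deg q.1 q.2.2.2) p i)) := fun h =>
      hiB (mem_filter.2 ⟨mem_range.2 hi, h⟩)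
    have h3 := h₂ q (code [f q (edge E (4 * deg q.1 q.2.2.2) p i), s]) p (L q.1 + 3 * q.2.2.2 + 17)
      ⟨i, by simpa using ⟨hp, hps, hi, E, hE, rfl⟩⟩ fun S hS => ?_
    · rw [add_mul]
      omega
    · simp only [entry_zero, entry_one] at hS
      choose! j hj using hS
      by_contra hcon
      -- A part that is not heavy belongs to fewer than 2^(r+13)·4d edges, so it leaves at most 2^(L
      -- k + 3r + 17) candidates for the vertex.
      refine hmany ⟨S.image fun p => (p, j p), ?_, fun v hv => ?_⟩
      · rw [card_image_of_injective _ fun a b h => (Prod.mk.inj h).1]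
        refine le_trans ?_ (not_le.1 hcon).le
        calc 2 ^ (q.2.2.2 + 13) * (4 * deg q.1 q.2.2.2)
            ≤ 2 ^ (q.2.2.2 + 13) * 2 ^ (L q.1 + 2 * q.2.2.2 + 4) :=
              Nat.mul_le_mul_left _ (four_mul_deg_le _ _)
          _ = _ := by rw [← pow_add]; congr 1; ring
      · obtain ⟨p', hp', rfl⟩ := mem_image.1 hv
        exact hj p' hp'

end Fingerprint

/-! ### Construction of the fingerprints -/

section Fingerprint

open Finset

variable {U : Machine} {code : List Str ≃ Str}

/-- The precision r = c·L n must exceed a multiple of the cost of the parameters, among which r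
itself occurs. This is consistent because r enters the cost only through its logarithm. -/
theorem exists_precision (K : ℕ) :
    ∃ c : ℕ, ∀ n, K * (14 * L n + 8 * L (c * L n)) ≤ c * L n := by
  refine ⟨2 ^ (46 * K) * 2 ^ (46 * K), fun n => ?_⟩
  generalize hj : 46 * K = j
  have h1 : L (2 ^ j * 2 ^ j) ≤ 2 * j + 1 := by
    refine L_le ?_
    rw [← pow_add, show 2 * j + 1 + 1 = j + j + 2 by ring, pow_add _ (j + j) 2]
    have := Nat.one_le_two_pow (n := j + j)
    omega
  have h2 := L_mul_le (2 ^ j * 2 ^ j) (L n)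
  have h3 := L_le_self (L n)
  have h4 := one_le_L n
  have h5 : j + 1 ≤ 2 ^ j := Nat.lt_two_pow_self
  have h6 : 46 * K * (j + 1) ≤ 2 ^ j * 2 ^ j := Nat.mul_le_mul (by omega) h5
  calc K * (14 * L n + 8 * L (2 ^ j * 2 ^ j * L n))
      ≤ K * ((46 + 16 * j) * L n) := by
        refine Nat.mul_le_mul_left _ ?_
        nlinarith
    _ ≤ K * (46 * (j + 1) * L n) := by gcongr; omega
    _ = 46 * K * (j + 1) * L n := by ring
    _ ≤ _ := Nat.mul_le_mul_right _ h6

/-- A computable choice of shortest programs, given the output and the length of the program. -/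
theorem exists_program_search (hU : IsOptimal U) : ∃ F : ℕ × Str →. Str, Partrec F ∧
    (∀ k t, ∀ p ∈ F (k, t), p.length = k ∧ t ∈ U p []) ∧ ∀ t, ∃ p, p ∈ F (C U t, t) := by
  obtain ⟨F, hF, hs, hc⟩ := RE.uniformize
    (P := fun (q : ℕ × Str) p => p.length = q.1 ∧ q.2 ∈ U p [])
    (RE.and (RE.eq (by fun_prop) (by fun_prop))
      (RE.mem₂ hU.1 (by fun_prop) (by fun_prop) (by fun_prop)))
  refine ⟨F, hF, fun k t p hp => hs _ _ hp, fun t => ?_⟩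
  obtain ⟨p, hp⟩ := hU.exists_program t []
  exact hc _ p hp

/-- The search picks one program for each t and length, so there are at most as many programs as
outputs t of bounded complexity. -/
theorem CC_program_le (hU : IsOptimal U) {F : ℕ × Str →. Str} (hF : Partrec F) :
    ∃ c : ℕ, ∀ k t p s n, p ∈ F (k, t) → k ≤ n → CC U t s ≤ n →
      CC U p s ≤ CC U t s + c * L n := by
  obtain ⟨c, hc⟩ := hU.CC_le_of_card_le (R := fun (q : (ℕ × ℕ) × Str) p =>
    ∃ t, CC U t q.2 ≤ q.1.1 ∧ p ∈ F (q.1.2, t))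
    (RE.ex (RE.and (RE.CC_le hU (by fun_prop) (by fun_prop) (by fun_prop))
      (RE.mem₁ hF (by fun_prop) (by fun_prop))))
  refine ⟨1 + 4 * c, fun k t p s n hp hk ht => ?_⟩
  have h1 := hc (CC U t s, k) s p (CC U t s + 1) ⟨t, le_rfl, hp⟩ fun S hS => ?_
  · have h2 := L_encode_pair_le (CC U t s) k
    simp only [L_encode_nat] at h2
    have h3 := L_mono hk
    have h4 := L_mono ht
    have h5 := one_le_L n
    have h6 := Nat.mul_le_mul_left c (h2.trans (show _ ≤ 4 * L n by omega))
    linarith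
  · choose! g hg hgF using hS
    rw [← card_image_of_injOn (f := g)]
    · refine hU.card_le (y := s) fun t' ht' => ?_
      obtain ⟨p', hp', rfl⟩ := mem_image.1 ht'
      exact hg p' hp'
    · intro p₁ h₁ p₂ h₂ e
      have e₁ := hgF p₁ h₁
      rw [e] at e₁
      exact Part.mem_unique e₁ (hgF p₂ h₂)

theorem le_CC_program (hU : IsOptimal U) :
    ∃ c : ℕ, ∀ t p s, t ∈ U p [] → CC U t s ≤ CC U p s + c := by
  obtain ⟨c, hc⟩ := hU.CC_le_CC_of_RE (R := fun q v => v ∈ U q.1 []) (g := fun s => s)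
    (RE.mem₂ hU.1 (by fun_prop) (by fun_prop) (by fun_prop)) (by fun_prop)
  exact ⟨c, fun t p s ht => hc p s t ht fun t' ht' => Part.mem_unique ht' ht⟩

/-- The graph parameters and the edge index are all that is needed besides t: they yield the
program, the graph and the label. -/
theorem CC_label_le (hU : IsOptimal U) {G : ℕ × ℕ × ℕ × ℕ →. List Str} (hG : Partrec G)
    {F : ℕ × Str →. Str} (hF : Partrec F)
    {f : ℕ × ℕ × ℕ × ℕ → Str → Str}
    (hf : Computable fun q : (ℕ × ℕ × ℕ × ℕ) × Str => f q.1 q.2) :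
    ∃ c : ℕ, ∀ q i t p E, p ∈ F (q.1, t) → E ∈ G q →
      CC U (f q (edge E (4 * deg q.1 q.2.2.2) p i)) t ≤ c * (L (Encodable.encode q) + L i) := by
  have hf' : Computable fun v : (((((ℕ × ℕ × ℕ × ℕ) × ℕ) × Str) × Str) × Str) × List Str =>
      f v.1.1.1.1.1 (edge v.2 (4 * deg v.1.1.1.1.1.1 v.1.1.1.1.1.2.2.2) v.1.2 v.1.1.1.1.2) :=
    hf.comp (g := fun v : (((((ℕ × ℕ × ℕ × ℕ) × ℕ) × Str) × Str) × Str) × List Str =>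
      (v.1.1.1.1.1, edge v.2 (4 * deg v.1.1.1.1.1.1 v.1.1.1.1.1.2.2.2) v.1.2 v.1.1.1.1.2))
      (by fun_prop)
  obtain ⟨c, hc⟩ := hU.CC_le_of_unique (R := fun (v : ((ℕ × ℕ × ℕ × ℕ) × ℕ) × Str) u =>
    ∃ p, ∃ E, p ∈ F (v.1.1.1, v.2) ∧ E ∈ G v.1.1 ∧
      u = f v.1.1 (edge E (4 * deg v.1.1.1 v.1.1.2.2.2) p v.1.2))
    (RE.ex (RE.ex (RE.and (RE.mem₁ hF (by fun_prop) (by fun_prop))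
      (RE.and (RE.mem₁ hG (by fun_prop) (by fun_prop)) (RE.eq (by fun_prop) hf')))))
  refine ⟨2 * c, fun q i t p E hp hE => ?_⟩
  refine (hc (q, i) t _ ⟨p, E, hp, hE, rfl⟩ ?_).trans ?_
  · rintro u ⟨p', E', hp', hE', rfl⟩
    dsimp only at hp' hE' ⊢
    rw [Part.mem_unique hp hp', Part.mem_unique hE hE']
  · have h := Nat.mul_le_mul_left c (L_encode_pair_le q i)
    rw [L_encode_nat] at h
    linarith

theorem card_compressible_le (hU : IsOptimal U) {m : ℕ} {H : Finset Str}
    (hH : ∀ w ∈ H, CC U w [] + 13 ≤ m) : 2 ^ 12 * #H ≤ 2 ^ m := by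
  rcases H.eq_empty_or_nonempty with rfl | ⟨w, hw⟩
  · simp
  · have h1 : 13 ≤ m := by have := hH w hw; omega
    have h2 := hU.card_le (y := []) (m := m - 13) (s := H) fun w hw => by have := hH w hw; omega
    calc 2 ^ 12 * #H ≤ 2 ^ 12 * 2 ^ (m - 13 + 1) := Nat.mul_le_mul_left _ h2
      _ = 2 ^ m := by rw [← pow_add]; congr 1; omega

/-- If the complexities of `t` given `x` and given `y` add up to at most the complexity of `t`, then
`t` has fingerprints `u`, `v` of these lengths that determine `t` together with `x`, respectively
`y`, and that are jointly incompressible. -/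
theorem exists_fingerprints (hU : IsOptimal U) (hcode : code.Computable) (c₀ : ℕ) :
    ∃ c : ℕ, ∀ n x y t, C U t ≤ n → CC U t x ≤ n → CC U t y ≤ n →
      CC U t x + CC U t y ≤ C U t + c₀ * L n →
      ∃ u v : Str, u.length = CC U t x ∧ v.length = CC U t y ∧
        CC U u t ≤ c * L n ∧ CC U v t ≤ c * L n ∧
        CC U t (code [u, x]) ≤ c * L n ∧ CC U t (code [v, y]) ≤ c * L n ∧
        CC U t x + CC U t y ≤ C U (code [u, v]) + c * L n := by
  classical
  obtain ⟨G, hG, hGs, hGc⟩ := exists_graph_search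
  obtain ⟨F, hF, hFs, hFc⟩ := exists_program_search hU
  obtain ⟨cB, hB⟩ := le_CC_program hU
  obtain ⟨cC, hC⟩ := CC_program_le hU hF
  obtain ⟨c₁, h₁⟩ := CC_vertex_le hU hcode hG (f := fun q w => w.take q.2.1) (by fun_prop)
    (m := fun q => q.2.1) (by fun_prop)
  obtain ⟨c₂, h₂⟩ := CC_vertex_le hU hcode hG (f := fun q w => w.drop q.2.1) (by fun_prop)
    (m := fun q => q.2.2.1) (by fun_prop)
  obtain ⟨c₃, h₃⟩ := CC_le_of_many_labels hU hG (f := fun _ w => w) (by fun_prop)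
    (m := fun q => q.2.1 + q.2.2.1) (e := fun q => q.1 - q.2.2.2)
    (T := fun v w => CC U w [] ≤ v.1.2.1 + v.1.2.2.1 - 13 ∧ 13 ≤ v.1.2.1 + v.1.2.2.1)
    (RE.and (RE.CC_le hU (by fun_prop) (by fun_prop) (by fun_prop))
      (RE.le (by fun_prop) (by fun_prop)))
  obtain ⟨c₄, h₄⟩ := CC_label_le hU hG hF (f := fun q w => w.take q.2.1) (by fun_prop)
  obtain ⟨c₅, h₅⟩ := CC_label_le hU hG hF (f := fun q w => w.drop q.2.1) (by fun_prop)
  obtain ⟨c₆, h₆⟩ := hU.CC_le_CC (f := fun w _ => entry code 0 w ++ entry code 1 w)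
    (g := fun s => s) (by fun_prop) (by fun_prop)
  obtain ⟨c', hc'⟩ := exists_precision (c₁ + c₂ + c₃ + cB + cC + c₀ + 1)
  refine ⟨(c₄ + c₅) * (3 * c' + 5) + (18 + 3 * c' + (c₁ + c₂) * c' + cB) + (13 + c₆),
    fun n x y t hk ha hb hab => ?_⟩
  have hprec := hc' n
  have hℓ := one_le_L n
  generalize hr : c' * L n = r at hprec
  obtain ⟨p, hp⟩ := hFc t
  obtain ⟨hpk, hpt⟩ := hFs _ _ p hp
  generalize hq : (C U t, CC U t x, CC U t y, r) = q
  -- Each nested pair doubles the cost: 2, 4 and 8 for the three complexities, and 8 for r.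
  have hLq : L (Encodable.encode q) ≤ 14 * L n + 8 * L r := by
    have e1 := L_encode_pair_le (C U t) (CC U t x, CC U t y, r)
    have e2 := L_encode_pair_le (CC U t x) (CC U t y, r)
    have e3 := L_encode_pair_le (CC U t y) r
    simp only [L_encode_nat] at e1 e2 e3
    have f1 := L_mono hk
    have f2 := L_mono ha
    have f3 := L_mono hb
    rw [← hq]
    omega
  have hK : ∀ d ≤ c₁ + c₂ + c₃ + cB + cC + c₀ + 1, d * (14 * L n + 8 * L r) ≤ r := fun d hd =>
    (Nat.mul_le_mul_right _ hd).trans hprec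
  have hcases : (c₁ + cB + 1) * (14 * L n + 8 * L r) ≤ r ∧
      (c₂ + cB + 1) * (14 * L n + 8 * L r) ≤ r ∧ (c₃ + cB + 1) * (14 * L n + 8 * L r) ≤ r ∧
      cC * (14 * L n + 8 * L r) ≤ r ∧ c₀ * (14 * L n + 8 * L r) ≤ r ∧
      1 * (14 * L n + 8 * L r) ≤ r :=
    ⟨hK _ (by omega), hK _ (by omega), hK _ (by omega), hK _ (by omega), hK _ (by omega),
      hK _ (by omega)⟩
  generalize hM : 14 * L n + 8 * L r = M at hLq hcases
  have hMn : L n ≤ M := by omega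
  obtain ⟨k1, k2, k3, k4, k5, k6⟩ := hcases
  have hgap : ∀ d, (d + cB + 1) * M ≤ r → d * L (Encodable.encode q) + cB < r := by
    intro d hd
    have := Nat.mul_le_mul_left d hLq
    have := Nat.mul_le_mul_left cB (hℓ.trans hMn)
    have : 1 ≤ M := hℓ.trans hMn
    linarith
  have g1 := hgap c₁ k1
  have g2 := hgap c₂ k2
  have g3 := hgap c₃ k3
  have hq1 : q.1 = C U t := by rw [← hq]
  have hqa : q.2.1 = CC U t x := by rw [← hq]
  have hqb : q.2.2.1 = CC U t y := by rw [← hq]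
  have hqr : q.2.2.2 = r := by rw [← hq]
  -- The graph exists because a + b ≤ k + c₀·L n and c₀·L n ≤ r.
  obtain ⟨E, hE⟩ := hGc (C U t) (CC U t x) (CC U t y) r
    (by have := Nat.mul_le_mul_left c₀ hMn; omega)
  rw [hq] at hE
  obtain ⟨hlen, hD1, hD2, hD3⟩ := hGs q E hE
  have hpx := hC _ _ _ x n hp hk ha
  have hpy := hC _ _ _ y n hp hk hb
  have hcC := Nat.mul_le_mul_left cC hMn
  have hlx := hB _ _ x hpt
  have hly := hB _ _ y hpt
  have hl0 : C U t ≤ CC U p [] + cB := hB _ _ [] hpt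
  have hlen' : ∀ p ∈ allStr q.1, ∀ i < 4 * deg q.1 q.2.2.2,
      (edge E (4 * deg q.1 q.2.2.2) p i).length = q.2.1 + q.2.2.1 := fun p hp i hi =>
    hlen p hp i (List.mem_range.2 hi)
  -- The complexity of `p` given `x` is at most a+r and at least a-cB; since r exceeds c₁·L(q) + cB,
  -- it lies above the bound for bad vertices. The same holds for `y` below.
  obtain ⟨B1, hB1, hB1'⟩ := h₁ q x E p hE hD1 (fun p hp i hi => by simp [hlen' p hp i hi])
    (hpk.trans hq1.symm) (by rw [hqa, hqr]; omega) (fun h => by rw [hqa, hqr] at *; omega)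
  obtain ⟨B2, hB2, hB2'⟩ := h₂ q y E p hE hD2 (fun p hp i hi => by simp [hlen' p hp i hi])
    (hpk.trans hq1.symm) (by rw [hqb, hqr]; omega) (fun h => by rw [hqb, hqr] at *; omega)
  -- A quarter of compressible labels would give C(p) ≤ k - r + O(L(q)), against C(p) ≥ k - cB.
  have hB3 : #{i ∈ range (4 * deg q.1 q.2.2.2) | CC U (edge E (4 * deg q.1 q.2.2.2) p i) []
      ≤ q.2.1 + q.2.2.1 - 13 ∧ 13 ≤ q.2.1 + q.2.2.1} < deg q.1 q.2.2.2 := by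
    by_contra hcon
    obtain ⟨e1, e2⟩ := h₃ q [] E p hE hD3 hlen' (fun H hH => card_compressible_le hU
      fun w hw => by have := (hH w hw).2; dsimp only at this ⊢; omega) (hpk.trans hq1.symm)
      ⟨_, not_lt.1 hcon, fun i hi => by simpa using hi⟩
    rw [hq1, hqr] at e1 e2
    omega
  -- Three sets of fewer than d edges cannot cover all 4d edges at `p`.
  obtain ⟨i, hi, hiB1, hiB2, hi3⟩ : ∃ i < 4 * deg q.1 q.2.2.2, i ∉ B1 ∧ i ∉ B2 ∧
      q.2.1 + q.2.2.1 ≤ CC U (edge E (4 * deg q.1 q.2.2.2) p i) [] + 13 := by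
    have hcard : #(B1 ∪ B2 ∪ {i ∈ range (4 * deg q.1 q.2.2.2) |
        CC U (edge E (4 * deg q.1 q.2.2.2) p i) [] ≤ q.2.1 + q.2.2.1 - 13 ∧
          13 ≤ q.2.1 + q.2.2.1}) < #(range (4 * deg q.1 q.2.2.2)) := by
      have e1 := card_union_le (B1 ∪ B2) {i ∈ range (4 * deg q.1 q.2.2.2) |
        CC U (edge E (4 * deg q.1 q.2.2.2) p i) [] ≤ q.2.1 + q.2.2.1 - 13 ∧
          13 ≤ q.2.1 + q.2.2.1}
      have e2 := card_union_le B1 B2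
      rw [card_range]
      omega
    obtain ⟨i, hi, hi'⟩ := exists_mem_notMem_of_card_lt_card hcard
    simp only [mem_union, mem_filter, not_or, not_and] at hi'
    refine ⟨i, mem_range.1 hi, hi'.1.1, hi'.1.2, ?_⟩
    by_contra hcon
    exact hi'.2 hi (by omega) (by omega)
  -- The edge index has O(log n) bits because r is a multiple of L n.
  have hiL : L i ≤ L n + 2 * r + 4 := by
    refine L_le ?_
    have e1 := four_mul_deg_le q.1 q.2.2.2
    rw [hqr, hq1] at e1
    rw [hqr, hq1] at hi
    have e2 : 2 ^ (L (C U t) + 2 * r + 4) ≤ 2 ^ (L n + 2 * r + 4) :=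
      Nat.pow_le_pow_right (by norm_num) (by have := L_mono hk; omega)
    have e3 : 2 ^ 1 ≤ 2 ^ (L n + 2 * r + 4) := Nat.pow_le_pow_right (by norm_num) (by omega)
    rw [pow_succ]
    omega
  have hlab : L (Encodable.encode q) + L i ≤ (3 * c' + 5) * L n := by
    have : (3 * c' + 5) * L n = 3 * r + 5 * L n := by rw [← hr]; ring
    omega
  have hw : edge E (4 * deg q.1 q.2.2.2) p i =
      (edge E (4 * deg q.1 q.2.2.2) p i).take q.2.1 ++
      (edge E (4 * deg q.1 q.2.2.2) p i).drop q.2.1 := (List.take_append_drop _ _).symm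
  have hwl := hlen' p (mem_allStr.2 (hpk.trans hq1.symm)) i hi
  have r4 := h₄ q i t p E (by rwa [hq1]) hE
  have r5 := h₅ q i t p E (by rwa [hq1]) hE
  have r1 := hB1' i hi hiB1
  have r2 := hB2' i hi hiB2
  refine ⟨(edge E (4 * deg q.1 q.2.2.2) p i).take q.2.1,
    (edge E (4 * deg q.1 q.2.2.2) p i).drop q.2.1, by simp [hwl, hqa], by simp [hwl, hqb],
    r4.trans ?_, r5.trans ?_, (hB _ _ _ hpt).trans ((Nat.add_le_add_right r1 _).trans ?_),
    (hB _ _ _ hpt).trans ((Nat.add_le_add_right r2 _).trans ?_), ?_⟩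
  · refine (Nat.mul_le_mul_left _ hlab).trans ?_
    rw [← mul_assoc]
    exact Nat.mul_le_mul_right _ (by
      rw [add_mul c₄ c₅]
      generalize c₄ * (3 * c' + 5) = X
      omega)
  · refine (Nat.mul_le_mul_left _ hlab).trans ?_
    rw [← mul_assoc]
    exact Nat.mul_le_mul_right _ (by
      rw [add_mul c₄ c₅]
      generalize c₅ * (3 * c' + 5) = X
      omega)
  · have e1 := Nat.mul_le_mul_left c₁ (hLq.trans (by simpa using k6))
    have e2 := L_mono hk
    rw [hqr, hq1]
    have e3 : (18 + 3 * c' + c₁ * c' + cB) * L n ≤ ((c₄ + c₅) * (3 * c' + 5) +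
        (18 + 3 * c' + (c₁ + c₂) * c' + cB) + (13 + c₆)) * L n :=
      Nat.mul_le_mul_right _ (by
        rw [add_mul c₁ c₂]
        generalize (c₄ + c₅) * (3 * c' + 5) = X
        generalize c₁ * c' = Y
        generalize c₂ * c' = Z
        omega)
    refine le_trans ?_ e3
    have e4 : (18 + 3 * c' + c₁ * c' + cB) * L n = 18 * L n + 3 * r + c₁ * r + cB * L n := by
      rw [← hr]; ring
    have e5 := Nat.mul_le_mul_left cB hℓ
    omega
  · have e1 := Nat.mul_le_mul_left c₂ (hLq.trans (by simpa using k6))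
    have e2 := L_mono hk
    rw [hqr, hq1]
    have e3 : (18 + 3 * c' + c₂ * c' + cB) * L n ≤ ((c₄ + c₅) * (3 * c' + 5) +
        (18 + 3 * c' + (c₁ + c₂) * c' + cB) + (13 + c₆)) * L n :=
      Nat.mul_le_mul_right _ (by
        rw [add_mul c₁ c₂]
        generalize (c₄ + c₅) * (3 * c' + 5) = X
        generalize c₁ * c' = Y
        generalize c₂ * c' = Z
        omega)
    refine le_trans ?_ e3
    have e4 : (18 + 3 * c' + c₂ * c' + cB) * L n = 18 * L n + 3 * r + c₂ * r + cB * L n := by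
      rw [← hr]; ring
    have e5 := Nat.mul_le_mul_left cB hℓ
    omega
  · have e1 := h₆ (code [(edge E (4 * deg q.1 q.2.2.2) p i).take q.2.1,
      (edge E (4 * deg q.1 q.2.2.2) p i).drop q.2.1]) []
    simp only [entry_zero, entry_one] at e1
    rw [← hw] at e1
    have e2 : (13 + c₆) * L n ≤ ((c₄ + c₅) * (3 * c' + 5) +
        (18 + 3 * c' + (c₁ + c₂) * c' + cB) + (13 + c₆)) * L n :=
      Nat.mul_le_mul_right _ (Nat.le_add_left _ _)
    have e3 := Nat.mul_le_mul_left (13 + c₆) hℓ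
    rw [hqa, hqb] at hi3
    change _ ≤ CC U _ [] + _
    linarith

end Fingerprint

/-! ### Complexity profiles of tuples -/

section Profile

variable {U : Machine} {code : List Str ≃ Str}

theorem L_linear_le {m k n : ℕ} (h : m ≤ k * (n + 1)) : L m ≤ (L k + 3) * L n := by
  have h1 := L_mono h
  have h2 := L_mul_le k (n + 1)
  have h3 := L_add_le n 1
  have h4 := one_le_L n
  have h5 : L 1 = 1 := by decide
  nlinarith

theorem CC_le_C (hU : IsOptimal U) : ∃ c : ℕ, ∀ v s, CC U v s ≤ C U v + c :=
  hU.CC_le_CC (f := fun w _ => w) (g := fun _ => []) (by fun_prop) (by fun_prop)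

theorem C_le_length (hU : IsOptimal U) : ∃ c : ℕ, ∀ v, C U v ≤ v.length + c := by
  obtain ⟨c, hc⟩ := hU.CC_le_length (G := fun q v => v = q.1) (RE.eq (by fun_prop) (by fun_prop))
  exact ⟨c, fun v => hc v [] v rfl fun _ h => h⟩

/-- Conditioning costs only a constant, so bounds on the unconditional complexities already control
the logarithmic error. -/
theorem CC_le_step (hU : IsOptimal U) (hcode : code.Computable) :
    ∃ c : ℕ, ∀ N v w s, C U w ≤ N → C U v ≤ N →
      CC U v s ≤ CC U w s + CC U v (code [w, s]) + c * L N := by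
  obtain ⟨c₁, h₁⟩ := CC_le_add hU hcode
  obtain ⟨c₂, h₂⟩ := CC_le_C hU
  refine ⟨c₁ * (1 + L c₂), fun N v w s hw hv => ?_⟩
  have k₁ := h₁ (N + c₂) v w s ((h₂ w s).trans (by omega)) ((h₂ v _).trans (by omega))
  have k₂ := Nat.mul_le_mul_left c₁ (L_add_const_le N c₂)
  linarith

theorem CC_le_via (hU : IsOptimal U) (hcode : code.Computable) :
    ∃ c : ℕ, ∀ N v w s, C U w ≤ N → C U v ≤ N → CC U v s ≤ CC U w s + CC U v w + c * L N := by
  obtain ⟨c₁, h₁⟩ := CC_le_step hU hcode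
  obtain ⟨c₂, h₂⟩ := hU.CC_le_CC (f := fun w _ => w) (g := fun s => entry code 0 s)
    (by fun_prop) (by fun_prop)
  refine ⟨c₁ + c₂, fun N v w s hw hv => ?_⟩
  have k₁ := h₁ N v w s hw hv
  have k₂ := h₂ v (code [w, s])
  rw [entry_zero] at k₂
  have := Nat.mul_le_mul_left c₂ (one_le_L N)
  linarith

/-- One computes w from the new condition first; thus conditions that determine each other are
interchangeable. -/
theorem CC_le_subst (hU : IsOptimal U) (hcode : code.Computable) :
    ∃ c : ℕ, ∀ N v w w' s, C U w ≤ N → C U v ≤ N →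
      CC U v (code [w', s]) ≤ CC U w (code [w', s]) + CC U v (code [w, s]) + c * L N := by
  obtain ⟨c₁, h₁⟩ := CC_le_step hU hcode
  obtain ⟨c₂, h₂⟩ := hU.CC_le_CC (f := fun w _ => w)
    (g := fun s => code [entry code 0 s, entry code 1 (entry code 1 s)]) (by fun_prop)
    (by fun_prop)
  refine ⟨c₁ + c₂, fun N v w w' s hw hv => ?_⟩
  have k₁ := h₁ N v w (code [w', s]) hw hv
  have k₂ := h₂ v (code [w, code [w', s]])
  simp only [entry_zero, entry_one] at k₂
  have := Nat.mul_le_mul_left c₂ (one_le_L N)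
  linarith

theorem CC_pair_le (hU : IsOptimal U) (hcode : code.Computable) :
    ∃ c : ℕ, ∀ N a b z, C U a ≤ N → C U b ≤ N →
      CC U (code [a, b]) z ≤ CC U a z + CC U b (code [a, z]) + c * L N := by
  obtain ⟨c₁, h₁⟩ := CC_le_add hU hcode
  obtain ⟨c₂, h₂⟩ := CC_le_C hU
  obtain ⟨c₃, h₃⟩ := hU.CC_le_CC (f := fun w y => code [entry code 0 y, w]) (g := fun s => s)
    (by fun_prop) (by fun_prop)
  refine ⟨c₁ * (1 + L (c₂ + c₃)) + c₃, fun N a b z ha hb => ?_⟩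
  have k₃ := h₃ b (code [a, z])
  rw [entry_zero] at k₃
  have k₁ := h₁ (N + (c₂ + c₃)) (code [a, b]) a z ((h₂ a z).trans (by omega))
    (k₃.trans (by have := h₂ b (code [a, z]); omega))
  have k₂ := Nat.mul_le_mul_left c₁ (L_add_const_le N (c₂ + c₃))
  have := Nat.mul_le_mul_left c₃ (one_le_L N)
  linarith

theorem C_pair_eq (hU : IsOptimal U) (hcode : code.Computable) :
    ∃ c : ℕ, ∀ N a b, C U a ≤ N → C U b ≤ N →
      C U (code [a, b]) ≤ C U a + CC U b a + c * L N ∧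
      C U a + CC U b a ≤ C U (code [a, b]) + c * L N := by
  obtain ⟨c₁, h₁⟩ := CC_pair_le hU hcode
  obtain ⟨c₂, h₂⟩ := CC_add_le hU hcode
  obtain ⟨c₃, h₃⟩ := hU.CC_le_CC (f := fun w _ => w) (g := fun s => entry code 0 s)
    (by fun_prop) (by fun_prop)
  obtain ⟨c₄, h₄⟩ := hU.CC_le_CC (f := fun w _ => w) (g := fun s => code [s, []])
    (by fun_prop) (by fun_prop)
  obtain ⟨c₅, h₅⟩ := CC_le_C hU
  refine ⟨c₁ + c₃ + c₂ * (L (2 + c₅ + c₁) + 3) + c₄, fun N a b ha hb => ?_⟩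
  have k₁ := h₁ N a b [] ha hb
  have k₂ := h₂ a b []
  have k₃ := h₃ b (code [a, []])
  have k₄ := h₄ b a
  rw [entry_zero] at k₃
  have k₅ := h₅ b (code [a, []])
  change C U (code [a, b]) ≤ C U a + _ + _ at k₁
  change C U a + _ ≤ C U (code [a, b]) + c₂ * L (C U (code [a, b])) at k₂
  have l₁ := one_le_L N
  have l₂ := Nat.mul_le_mul_left c₁ (L_le_self N)
  have l₃ : L (C U (code [a, b])) ≤ (L (2 + c₅ + c₁) + 3) * L N := L_linear_le (by nlinarith)
  have l₄ := Nat.mul_le_mul_left c₂ l₃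
  have l₅ := Nat.mul_le_mul_left c₃ l₁
  have l₆ := Nat.mul_le_mul_left c₄ l₁
  have l₇ : 0 ≤ c₂ * (L (2 + c₅ + c₁) + 3) * L N := Nat.zero_le _
  constructor <;> nlinarith

/-- A string that is simple given `x` and `y` can be joined to one of them when the other one is
the condition. -/
theorem CC_absorb (hU : IsOptimal U) (hcode : code.Computable) :
    ∃ c : ℕ, ∀ N x y w, C U x ≤ N → C U y ≤ N → C U w ≤ N →
      (CC U (code [w, x]) y ≤ CC U x y + CC U w (code [x, y]) + c * L N ∧
        CC U x y ≤ CC U (code [w, x]) y + c * L N) ∧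
      (CC U (code [w, y]) x ≤ CC U y x + CC U w (code [x, y]) + c * L N ∧
        CC U y x ≤ CC U (code [w, y]) x + c * L N) := by
  obtain ⟨c₁, h₁⟩ := CC_pair_le hU hcode
  obtain ⟨c₂, h₂⟩ := hU.CC_le_CC (f := fun w _ => code [entry code 1 w, entry code 0 w])
    (g := fun s => s) (by fun_prop) (by fun_prop)
  obtain ⟨c₃, h₃⟩ := hU.CC_le_CC (f := fun w _ => entry code 1 w)
    (g := fun s => s) (by fun_prop) (by fun_prop)
  obtain ⟨c₄, h₄⟩ := hU.CC_le_CC (f := fun w _ => w)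
    (g := fun s => code [entry code 1 s, entry code 0 s]) (by fun_prop) (by fun_prop)
  refine ⟨c₁ + c₂ + c₃ + c₄, fun N x y w hx hy hw => ?_⟩
  have k₁ := h₁ N x w y hx hw
  have k₁' := h₁ N y w x hy hw
  have k₂ := h₂ (code [x, w]) y
  have k₂' := h₂ (code [y, w]) x
  have k₃ := h₃ (code [w, x]) y
  have k₃' := h₃ (code [w, y]) x
  have k₄ := h₄ w (code [y, x])
  simp only [entry_zero, entry_one] at k₂ k₂' k₃ k₃' k₄
  have l₁ := one_le_L N
  have l₂ := Nat.mul_le_mul_left c₂ l₁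
  have l₃ := Nat.mul_le_mul_left c₃ l₁
  have l₄ := Nat.mul_le_mul_left c₄ l₁
  have l₅ : 0 ≤ c₁ * L N := Nat.zero_le _
  refine ⟨⟨?_, ?_⟩, ?_, ?_⟩ <;> linarith

/-- The complexities that involve `x`, `y` and a pair of fingerprints of `t`. -/
theorem fingerprint_profile (hU : IsOptimal U) (hcode : code.Computable) :
    ∃ c : ℕ, ∀ N δ x y t u v T, T = code [u, v] → C U x ≤ N → C U y ≤ N → C U t ≤ N →
      C U (code [x, y]) ≤ N → C U u ≤ N → C U v ≤ N → C U T ≤ N →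
      CC U t (code [x, y]) ≤ δ → CC U u t ≤ δ → CC U v t ≤ δ →
      CC U t (code [u, x]) ≤ δ → CC U t (code [v, y]) ≤ δ → ∀ e, e = c * L N + 4 * δ →
      CC U T (code [x, y]) ≤ e ∧
      (CC U t x ≤ CC U T x + e ∧ CC U T x ≤ CC U t x + e) ∧
      (CC U t y ≤ CC U T y + e ∧ CC U T y ≤ CC U t y + e) ∧
      (CC U x (code [T, y]) ≤ CC U x (code [t, y]) + e ∧
        CC U x (code [t, y]) ≤ CC U x (code [T, y]) + e) ∧
      (CC U y (code [T, x]) ≤ CC U y (code [t, x]) + e ∧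
        CC U y (code [t, x]) ≤ CC U y (code [T, x]) + e) := by
  obtain ⟨c₁, h₁⟩ := CC_pair_le hU hcode
  obtain ⟨c₂, h₂⟩ := CC_le_via hU hcode
  obtain ⟨c₃, h₃⟩ := CC_le_step hU hcode
  obtain ⟨c₄, h₄⟩ := CC_le_subst hU hcode
  obtain ⟨d₁, g₁⟩ := hU.CC_le_CC (f := fun w _ => w) (g := fun s => entry code 1 s)
    (by fun_prop) (by fun_prop)
  obtain ⟨d₂, g₂⟩ := hU.CC_le_CC (f := fun w _ => w) (g := fun s => entry code 0 s)
    (by fun_prop) (by fun_prop)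
  obtain ⟨d₃, g₃⟩ := hU.CC_le_CC (f := fun w _ => w)
    (g := fun s => code [entry code 0 (entry code 0 s), entry code 1 s])
    (by fun_prop) (by fun_prop)
  obtain ⟨d₄, g₄⟩ := hU.CC_le_CC (f := fun w _ => w)
    (g := fun s => code [entry code 1 (entry code 0 s), entry code 1 s])
    (by fun_prop) (by fun_prop)
  refine ⟨c₁ + c₂ + c₃ + c₄ + d₁ + d₂ + d₃ + d₄, fun N δ x y t u v T hT hx hy ht hxy hu hv hTN
    hδ₁ hδ₂ hδ₃ hδ₄ hδ₅ e he => ?_⟩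
  have a1 := h₁ N u v t hu hv
  have a2 := g₁ v (code [u, t])
  have a3 := h₂ N T t (code [x, y]) ht hTN
  have a4 := h₂ N T t x ht hTN
  -- The pair T is simple given t, while t is simple given T with x (through u) or with y (through
  -- v). Hence t and T are interchangeable next to either input.
  have a5 := h₂ N T t y ht hTN
  have a6 := h₃ N t T x hTN ht
  have a7 := h₃ N t T y hTN ht
  have a8 := g₃ t (code [T, x])
  have a9 := g₄ t (code [T, y])
  have b1 := h₄ N x t T y ht hx
  have b2 := h₄ N x T t y hTN hx
  have b3 := h₄ N y t T x ht hy
  have b4 := h₄ N y T t x hTN hy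
  have b5 := g₂ T (code [t, y])
  have b6 := g₂ T (code [t, x])
  rw [← hT] at a1
  simp only [hT, entry_zero, entry_one] at a8 a9 a2 b5 b6
  rw [← hT] at a8 a9 b5 b6
  have l := one_le_L N
  have l₁ := Nat.mul_le_mul_left d₁ l
  have l₂ := Nat.mul_le_mul_left d₂ l
  have l₃ := Nat.mul_le_mul_left d₃ l
  have l₄ := Nat.mul_le_mul_left d₄ l
  have he' : e = c₁ * L N + c₂ * L N + c₃ * L N + c₄ * L N + d₁ * L N + d₂ * L N + d₃ * L N +
      d₄ * L N + 4 * δ := by rw [he]; ring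
  refine ⟨?_, ⟨?_, ?_⟩, ⟨?_, ?_⟩, ⟨?_, ?_⟩, ⟨?_, ?_⟩⟩ <;> omega

/-- The complexities of tuples formed from `x`, `y` and a string that is simple given both. -/
theorem tuple_profile (hU : IsOptimal U) (hcode : code.Computable) :
    ∃ c : ℕ, ∀ N x y T, C U x ≤ N → C U y ≤ N → C U (code [x, y]) ≤ N → C U T ≤ N →
      ∀ e, e = c * L N + CC U T (code [x, y]) →
      (C U (code [x, T]) ≤ C U x + CC U T x + e ∧ C U x + CC U T x ≤ C U (code [x, T]) + e) ∧
      (C U (code [y, T]) ≤ C U y + CC U T y + e ∧ C U y + CC U T y ≤ C U (code [y, T]) + e) ∧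
      (C U (code [x, T]) ≤ C U T + CC U x T + e ∧ C U T + CC U x T ≤ C U (code [x, T]) + e) ∧
      (C U (code [y, T]) ≤ C U T + CC U y T + e ∧ C U T + CC U y T ≤ C U (code [y, T]) + e) ∧
      (C U (code [x, y, T]) ≤ C U (code [x, y]) + e ∧
        C U (code [x, y]) ≤ C U (code [x, y, T]) + e) ∧
      (C U (code [x, y, T]) ≤ C U T + CC U (code [x, y]) T + e ∧
        C U T + CC U (code [x, y]) T ≤ C U (code [x, y, T]) + e) := by
  obtain ⟨c, h⟩ := C_pair_eq hU hcode
  obtain ⟨d₁, g₁⟩ := hU.CC_le_CC (f := fun w _ => code [entry code 1 w, entry code 0 w])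
    (g := fun s => s) (by fun_prop) (by fun_prop)
  obtain ⟨d₂, g₂⟩ := hU.CC_le_CC (f := fun w _ => code [entry code 0 (entry code 0 w),
    entry code 1 (entry code 0 w), entry code 1 w]) (g := fun s => s) (by fun_prop) (by fun_prop)
  obtain ⟨d₃, g₃⟩ := hU.CC_le_CC (f := fun w _ => code [code [entry code 0 w, entry code 1 w],
    entry code 2 w]) (g := fun s => s) (by fun_prop) (by fun_prop)
  obtain ⟨d₄, g₄⟩ := hU.CC_le_CC (f := fun w _ => code [entry code 0 w, entry code 1 w])
    (g := fun s => s) (by fun_prop) (by fun_prop)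
  refine ⟨c + d₁ + d₂ + d₃ + d₄, fun N x y T hx hy hxy hT e he => ?_⟩
  obtain ⟨a1, a2⟩ := h N x T hx hT
  obtain ⟨a3, a4⟩ := h N y T hy hT
  obtain ⟨a5, a6⟩ := h N T x hT hx
  obtain ⟨a7, a8⟩ := h N T y hT hy
  obtain ⟨a9, a10⟩ := h N (code [x, y]) T hxy hT
  obtain ⟨a11, a12⟩ := h N T (code [x, y]) hT hxy
  have b1 := g₁ (code [x, T]) []
  have b2 := g₁ (code [T, x]) []
  have b3 := g₁ (code [y, T]) []
  have b4 := g₁ (code [T, y]) []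
  have b5 := g₂ (code [code [x, y], T]) []
  have b6 := g₃ (code [x, y, T]) []
  have b7 := g₁ (code [code [x, y], T]) []
  have b8 := g₁ (code [T, code [x, y]]) []
  have b9 := g₄ (code [x, y, T]) []
  simp only [entry_zero, entry_one, entry_two] at b1 b2 b3 b4 b5 b6 b7 b8 b9
  change C U _ ≤ C U _ + _ at b1 b2 b3 b4 b5 b6 b7 b8 b9
  have l := one_le_L N
  have l₁ := Nat.mul_le_mul_left d₁ l
  have l₂ := Nat.mul_le_mul_left d₂ l
  have l₃ := Nat.mul_le_mul_left d₃ l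
  have l₄ := Nat.mul_le_mul_left d₄ l
  have he' : e = c * L N + d₁ * L N + d₂ * L N + d₃ * L N + d₄ * L N + CC U T (code [x, y]) := by
    rw [he]; ring
  clear he
  refine ⟨⟨?_, ?_⟩, ⟨?_, ?_⟩, ⟨?_, ?_⟩, ⟨?_, ?_⟩, ⟨?_, ?_⟩, ⟨?_, ?_⟩⟩ <;> omega

end Profile

/-! ### All estimates with a common error term -/

theorem LeUpTo.of_le {e : ℝ} {k : ℕ} (hk : (k : ℝ) ≤ e) {A B : ℤ} (h : A ≤ B + k) :
    LeUpTo e A B := by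
  have h1 : (A : ℝ) ≤ B + k := by exact_mod_cast h
  rw [LeUpTo]
  linarith

theorem EqUpTo.of_le {e : ℝ} {k : ℕ} (hk : (k : ℝ) ≤ e) {A B : ℤ} (h₁ : A ≤ B + k)
    (h₂ : B ≤ A + k) : EqUpTo e A B := by
  have h3 : (A : ℝ) ≤ B + k := by exact_mod_cast h₁
  have h4 : (B : ℝ) ≤ A + k := by exact_mod_cast h₂
  rw [EqUpTo, abs_le]
  constructor <;> linarith

theorem L_le_logb (n : ℕ) : (L n : ℝ) ≤ Real.logb 2 (n + 2) := by
  have h := Real.natLog_le_logb (n + 2) 2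
  push_cast at h
  exact h

variable {U : Machine} {code : List Str ≃ Str}

theorem CC_transcript_inputs_le (hU : IsOptimal U) (hcode : code.Computable) (π : Protocol) :
    ∃ c : ℕ, ∀ x y t, π.IsTranscript code x y t → CC U t (code [x, y]) ≤ c := by
  obtain ⟨c, hc⟩ := hU.CC_le_of_unique (α := Unit)
    (R := fun q t => π.IsTranscript code (entry code 0 q.2) (entry code 1 q.2) t)
    ((π.re_isTranscript hcode).comp (g := fun q : (Unit × Str) × Str =>
      ((entry code 0 q.1.2, entry code 1 q.1.2), q.2)) (by fun_prop))
  refine ⟨c * L 0, fun x y t ht => ?_⟩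
  exact hc () (code [x, y]) t (by simpa using ht) fun t' ht' => ht.unique (by simpa using ht')

set_option maxHeartbeats 1000000 in
/-- All the estimates on which the main theorem depends, with a common error term. -/
theorem exists_transcript_fingerprints (hU : IsOptimal U) (hcode : code.Computable)
    (π : Protocol) : ∃ c : ℕ, ∀ x y t, π.IsTranscript code x y t →
      ∀ e, e = c * L (C U (code [x, y, t])) →
      CC U t (code [x, y]) ≤ e ∧
      (CC U (code [t, x]) y ≤ CC U x y + e ∧ CC U x y ≤ CC U (code [t, x]) y + e) ∧
      (CC U (code [t, y]) x ≤ CC U y x + e ∧ CC U y x ≤ CC U (code [t, y]) x + e) ∧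
      CC U t x + CC U t y ≤ C U t + e ∧
      ∃ u v T : Str, T = code [u, v] ∧ u.length = CC U t x ∧ v.length = CC U t y ∧
        C U u ≤ CC U t x + e ∧ C U v ≤ CC U t y + e ∧ C U T ≤ C U u + C U v + e ∧
        CC U t x + CC U t y ≤ C U T + e ∧
        CC U u t ≤ e ∧ CC U v t ≤ e ∧ CC U t (code [u, x]) ≤ e ∧ CC U t (code [v, y]) ≤ e ∧
        CC U T (code [x, y]) ≤ e ∧
        (CC U t x ≤ CC U T x + e ∧ CC U T x ≤ CC U t x + e) ∧
        (CC U t y ≤ CC U T y + e ∧ CC U T y ≤ CC U t y + e) ∧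
        (CC U x (code [T, y]) ≤ CC U x (code [t, y]) + e ∧
          CC U x (code [t, y]) ≤ CC U x (code [T, y]) + e) ∧
        (CC U y (code [T, x]) ≤ CC U y (code [t, x]) + e ∧
          CC U y (code [t, x]) ≤ CC U y (code [T, x]) + e) ∧
        (C U (code [x, T]) ≤ C U x + CC U T x + e ∧ C U x + CC U T x ≤ C U (code [x, T]) + e) ∧
        (C U (code [y, T]) ≤ C U y + CC U T y + e ∧ C U y + CC U T y ≤ C U (code [y, T]) + e) ∧
        (C U (code [x, T]) ≤ C U T + CC U x T + e ∧ C U T + CC U x T ≤ C U (code [x, T]) + e) ∧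
        (C U (code [y, T]) ≤ C U T + CC U y T + e ∧ C U T + CC U y T ≤ C U (code [y, T]) + e) ∧
        (C U (code [x, y, T]) ≤ C U (code [x, y]) + e ∧
          C U (code [x, y]) ≤ C U (code [x, y, T]) + e) ∧
        (C U (code [x, y, T]) ≤ C U T + CC U (code [x, y]) T + e ∧
          C U T + CC U (code [x, y]) T ≤ C U (code [x, y, T]) + e) ∧
        (CC U (code [T, x]) y ≤ CC U x y + e ∧ CC U x y ≤ CC U (code [T, x]) y + e) ∧
        (CC U (code [T, y]) x ≤ CC U y x + e ∧ CC U y x ≤ CC U (code [T, y]) x + e) := by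
  obtain ⟨cA, hA⟩ := CC_transcript_inputs_le hU hcode π
  obtain ⟨cT, hT⟩ := CC_transcript_add_le hU hcode π
  obtain ⟨cF, hF⟩ := exists_fingerprints hU hcode cT
  obtain ⟨cP, hP⟩ := fingerprint_profile hU hcode
  obtain ⟨cQ, hQ⟩ := tuple_profile hU hcode
  obtain ⟨cB, hB⟩ := CC_absorb hU hcode
  obtain ⟨cR, hR⟩ := CC_pair_le hU hcode
  obtain ⟨d₀, g₀⟩ := CC_le_C hU
  obtain ⟨d₁, g₁⟩ := C_le_length hU
  obtain ⟨d₂, g₂⟩ := hU.CC_le_CC (f := fun w _ => entry code 0 w) (g := fun s => s)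
    (by fun_prop) (by fun_prop)
  obtain ⟨d₃, g₃⟩ := hU.CC_le_CC (f := fun w _ => entry code 1 w) (g := fun s => s)
    (by fun_prop) (by fun_prop)
  obtain ⟨d₄, g₄⟩ := hU.CC_le_CC (f := fun w _ => entry code 2 w) (g := fun s => s)
    (by fun_prop) (by fun_prop)
  obtain ⟨d₅, g₅⟩ := hU.CC_le_CC (f := fun w _ => code [entry code 0 w, entry code 1 w])
    (g := fun s => s) (by fun_prop) (by fun_prop)
  generalize hD : d₀ + d₁ + d₂ + d₃ + d₄ + d₅ = D
  generalize hM : (L (3 + d₀ + cR) + 3) * (1 + L D) = M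
  generalize hδc : cA + cF * (1 + L D) = δc
  generalize hPc : cP * M + 4 * δc = Pc
  refine ⟨cA + cT + cF * (1 + L D) + Pc + (cQ * M + Pc) + (cB * M + cA + Pc) + cR * M + d₀ + d₁,
    fun x y t ht e he => ?_⟩
  have hx := g₂ (code [x, y, t]) []
  have hy := g₃ (code [x, y, t]) []
  have htn := g₄ (code [x, y, t]) []
  have hxy := g₅ (code [x, y, t]) []
  simp only [entry_zero, entry_one, entry_two] at hx hy htn hxy
  change C U _ ≤ C U _ + _ at hx hy htn hxy
  have hA' := hA x y t ht
  have hT' := hT x y t ht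
  generalize hn : C U (code [x, y, t]) = n at *
  have hl := one_le_L n
  have hLD : L (n + D) ≤ (1 + L D) * L n := L_add_const_le n D
  have hln : L n ≤ L (n + D) := L_mono (Nat.le_add_right _ _)
  obtain ⟨u, v, hu, hv, f1, f2, f3, f4, f5⟩ := hF (n + D) x y t (by omega)
    ((g₀ t x).trans (by omega)) ((g₀ t y).trans (by omega))
    (by have := Nat.mul_le_mul_left cT hln; omega)
  have ha : CC U t x ≤ n + d₄ + d₀ := (g₀ t x).trans (by omega)
  have hb : CC U t y ≤ n + d₄ + d₀ := (g₀ t y).trans (by omega)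
  have hCu := g₁ u
  have hCv := g₁ v
  have hpair := hR (n + D) u v [] (by omega) (by omega)
  have hvu := g₀ v (code [u, []])
  change C U (code [u, v]) ≤ C U u + _ + _ at hpair
  generalize hTe : code [u, v] = T at *
  -- A crude linear bound on all complexities involved, including that of T; its logarithm is still
  -- O(L n).
  generalize hN : (3 + d₀ + cR) * (n + D + 1) = N
  have hND : n + D ≤ N := by
    have h1 : 1 * (n + D + 1) ≤ (3 + d₀ + cR) * (n + D + 1) := Nat.mul_le_mul_right _ (by omega)
    omega
  have hTN : C U T ≤ N := by
    have h1 := Nat.mul_le_mul_left cR (L_le_self (n + D))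
    have h2 : (3 + d₀ + cR) * (n + D + 1) = 3 * (n + D + 1) + d₀ * (n + D + 1) +
      cR * (n + D + 1) := by ring
    have h3 : d₀ ≤ d₀ * (n + D + 1) := Nat.le_mul_of_pos_right _ (by omega)
    omega
  have hLN : L N ≤ M * L n := by
    have h1 : L N ≤ (L (3 + d₀ + cR) + 3) * L (n + D) := L_linear_le hN.ge
    refine h1.trans ((Nat.mul_le_mul_left _ hLD).trans_eq ?_)
    rw [← hM]; ring
  have hcL : ∀ c, c * L N ≤ c * M * L n := fun c =>
    (Nat.mul_le_mul_left c hLN).trans_eq (mul_assoc _ _ _).symm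
  have hcF : cF * L (n + D) ≤ cF * (1 + L D) * L n :=
    (Nat.mul_le_mul_left cF hLD).trans_eq (mul_assoc _ _ _).symm
  have hcR : cR * L (n + D) ≤ cR * M * L n :=
    (Nat.mul_le_mul_left cR (L_mono hND)).trans (hcL cR)
  have hδ : cA + cF * L (n + D) ≤ δc * L n := by
    rw [← hδc, add_mul]
    have := Nat.mul_le_mul_left cA hl
    omega
  obtain ⟨p1, p2, p3, p4, p5⟩ := hP N (cA + cF * L (n + D)) x y t u v T hTe.symm (by omega)
    (by omega) (by omega) (by omega) (by omega) (by omega) hTN (by omega) (by omega) (by omega)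
    (by omega) (by omega) _ rfl
  have hP' : cP * L N + 4 * (cA + cF * L (n + D)) ≤ Pc * L n := by
    rw [← hPc, add_mul, mul_assoc 4]
    have := hcL cP
    omega
  generalize cP * L N + 4 * (cA + cF * L (n + D)) = eP at *
  obtain ⟨q1, q2, q3, q4, q5, q6⟩ := hQ N x y T (by omega) (by omega) (by omega) hTN _ rfl
  have hQ' := hcL cQ
  obtain ⟨⟨b1, b2⟩, b3, b4⟩ := hB N x y t (by omega) (by omega) (by omega)
  obtain ⟨⟨b5, b6⟩, b7, b8⟩ := hB N x y T (by omega) (by omega) hTN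
  have hB' := hcL cB
  have k0 := Nat.mul_le_mul_left d₀ hl
  have k1 := Nat.mul_le_mul_left d₁ hl
  have kA := Nat.mul_le_mul_left cA hl
  have he' : e = cA * L n + cT * L n + cF * (1 + L D) * L n + Pc * L n + (cQ * M * L n + Pc * L n)
      + (cB * M * L n + cA * L n + Pc * L n) + cR * M * L n + d₀ * L n + d₁ * L n := by
    rw [he]; ring
  clear he
  generalize cF * (1 + L D) * L n = X1 at *
  generalize cQ * M * L n = X2 at *
  generalize cB * M * L n = X3 at *
  generalize cR * M * L n = X4 at *
  generalize Pc * L n = X5 at *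
  refine ⟨by omega, ⟨by omega, by omega⟩, ⟨by omega, by omega⟩, by omega, u, v, T, hTe.symm, hu,
    hv, by omega, by omega, by omega, by omega, by omega, by omega, by omega, by omega, by omega,
    ⟨by omega, by omega⟩, ⟨by omega, by omega⟩, ⟨by omega, by omega⟩, ⟨by omega, by omega⟩,
    ⟨by omega, by omega⟩, ⟨by omega, by omega⟩, ⟨by omega, by omega⟩, ⟨by omega, by omega⟩,
    ⟨by omega, by omega⟩, ⟨by omega, by omega⟩, ⟨by omega, by omega⟩, ⟨by omega, by omega⟩⟩

end AlgInfo

/-! ### Derivation of the theorem -/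

theorem mainTheorem2 (U : Machine) (hU : IsOptimal U)
    (code : List Str ≃ Str) (hcode : code.Computable)
    (π : Protocol) (hπ : π.Terminates) :
    ∃ c : ℝ, ∀ x y t : Str, π.IsTranscript code x y t →
      ∀ n : ℕ, n = C U (code [x, y, t]) →
      ∀ e : ℝ, e = c * Real.logb 2 (n + 2) →
        -- (a)
        LeUpTo e (CC U t (code [x, y])) 0 ∧
        -- (b)
        EqUpTo e (CC U t x) (IC U code t y x) ∧
        -- (c)
        EqUpTo e (CC U t y) (IC U code t x y) ∧
        -- (d)
        EqUpTo e (CC U t x + CC U t y) (IC U code t x y + IC U code t y x) ∧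
        LeUpTo e (IC U code t x y + IC U code t y x) (C U t) ∧
        -- (e)
        ∃ tx ty : Str,
          tx.length = CC U t x ∧ ty.length = CC U t y ∧
          EqUpTo e (C U tx) (CC U t x) ∧ EqUpTo e (C U ty) (CC U t y) ∧
          LeUpTo e (CC U tx t) 0 ∧ LeUpTo e (CC U ty t) 0 ∧
          LeUpTo e (CC U t (code [tx, x])) 0 ∧ LeUpTo e (CC U t (code [ty, y])) 0 ∧
          EqUpTo e (C U (code [tx, ty])) (C U tx + C U ty) ∧
          -- the complexity profile of `x`, `y` and `t' = ⟨tx, ty⟩`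
          ∀ t' : Str, t' = code [tx, ty] →
            LeUpTo e (CC U t' (code [x, y])) 0 ∧
            EqUpTo e (I3 U code x y t') 0 ∧
            EqUpTo e (IC U code x y t') (I U code x y) ∧
            EqUpTo e (IC U code t' x y) (C U ty) ∧
            EqUpTo e (IC U code t' y x) (C U tx) ∧
            EqUpTo e (CC U x (code [t', y])) (CC U x (code [t, y])) ∧
            EqUpTo e (CC U y (code [t', x])) (CC U y (code [t, x])) := by
  obtain ⟨c, hc⟩ := exists_transcript_fingerprints hU hcode π
  -- Every claim combines boundedly many estimates of error E; the factor 30 leaves room for their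
  -- sum.
  refine ⟨30 * c, ?_⟩
  rintro x y t ht n rfl e he
  obtain ⟨h1, h2, h3, h4, u, v, T, hT, hu, hv, k1, k2, k3, k4, k5, k6, k7, k8, k9, l1, l2, l3, l4,
    m1, m2, m3, m4, m5, m6, m7, m8⟩ := hc x y t ht _ rfl
  have hk : ((30 * (c * L (C U (code [x, y, t]))) : ℕ) : ℝ) ≤ e := by
    rw [he]
    push_cast
    have := L_le_logb (C U (code [x, y, t]))
    rw [← mul_assoc]
    gcongr
  generalize c * L (C U (code [x, y, t])) = E at *
  refine ⟨LeUpTo.of_le hk ?_, EqUpTo.of_le hk ?_ ?_, EqUpTo.of_le hk ?_ ?_,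
    EqUpTo.of_le hk ?_ ?_, LeUpTo.of_le hk ?_, u, v, hu, hv, EqUpTo.of_le hk ?_ ?_,
    EqUpTo.of_le hk ?_ ?_, LeUpTo.of_le hk ?_, LeUpTo.of_le hk ?_, LeUpTo.of_le hk ?_,
    LeUpTo.of_le hk ?_, EqUpTo.of_le hk ?_ ?_, ?_⟩
  rotate_right
  · rintro t' rfl
    rw [← hT]
    refine ⟨LeUpTo.of_le hk ?_, EqUpTo.of_le hk ?_ ?_, EqUpTo.of_le hk ?_ ?_,
      EqUpTo.of_le hk ?_ ?_, EqUpTo.of_le hk ?_ ?_, EqUpTo.of_le hk ?_ ?_,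
      EqUpTo.of_le hk ?_ ?_⟩
    -- The chain rule reduces I(x:y:t') to C(t') - C(t'|x) - C(t'|y), which nearly vanishes, and
    -- I(x:y|t') differs from I(x:y) by it. Absorbing t' into (x,y) gives I(t':x|y) =⁺ C(t'|y) and
    -- its mirror image.
    all_goals
      try simp only [IC, I, I3]
      omega
  all_goals
    try rw [← hT]
    try simp only [IC]
    omega
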